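/- A sentence in normal form is $$\Psi=\forall x\,\gamma(x)\ \wedge\ \bigwedge_{i=1}^{k}\forall x\forall y\,\big((S_i(x,y)\wedge x\neq y)\to\beta_i(x,y)\big)\ \wedge\ \bigwedge_{i=1}^{\ell}\forall x\,\big(q_i(x)\to\mathcal P_i(x)\big),$$ where $\gamma,\beta_i$ are quantifier-free formulas with equality over unary and binary relation symbols, each $S_i$ is a binary symbol, each $q_i(x)$ is an atom $P(x)$ or $R(x,x)$, and $\mathcal P_i(x)$ is a local Presburger quantifier $\sum_{j=1}^{t_i}\lambda_{i,j}\cdot\#_y^{R_{i,j}(x,y)}[x\neq y]\circledast_i\delta_i$ with $\lambda_{i,j},\delta_i\in\mathbb Z$ and $\circledast_i$ one of $=,\neq,\le,\ge,<,>,\equiv_d,\not\equiv_d$ ($d\in\mathbb N$; $\equiv_0$ is equality). Let $|\Psi|$ be the length of $\Psi$ as a string with numbers in binary, let $n$ and $m$ be the numbers of unary and binary symbols occurring in $\Psi$, let $d_i$ be the modulus of $\circledast_i$ ($0$ if there is none), and let $$d=2\ell+1,\qquad t=2^{n+3m}+4\ell+1,\qquad M=1+\max_{1\le i\le\ell}\Big(\sum_j|\lambda_{i,j}|+|\delta_i|+d_i\Big)$$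 (the maximum being $0$ if $\ell=0$). Let $\Pi$ be the set of unary types over these symbols (maximal consistent sets of literals over the atoms $P(x)$, $R(x,x)$), and $\mathcal K$ the set of binary types (maximal consistent sets of literals over the atoms $R(x,y)$, $R(y,x)$) that contain at least one positive atom. A graph $G=(V,E)$ has $V\subseteq\Pi$ and $E\subseteq\Pi\times\mathcal K\times\Pi$. For an edge $(\pi_1,\eta,\pi_2)\in E$ let $\mathcal Z^{G}_{\pi_1,\eta,\pi_2}$ be the system, in the variables $z_{\eta',\pi'}$ with $(\eta',\pi')\in\mathcal K\times\Pi$, that consists of $z_{\eta,\pi_2}\ge 1$ and, for each $i$ with $q_i(x)\in\pi_1$, of $$\sum_{j=1}^{t_i}\lambda_{i,j}\Big(\sum_{(\pi_1,\eta',\pi')\in E,\ R_{i,j}(x,y)\in\eta'}z_{\eta',\pi'}\Big)\circledast_i\delta_i .$$ (1) There are a deterministic (multi-stack) Turing machine $T$ and a polynomial $p$ such that, for every sentence $\Psi$ in normal form, every graph $G$ and every edge $(\pi_1,\eta,\pi_2)$ of $G$, the machine $T$, given $\Psi$, $G$ (its vertices and edges listed without repetition) and the edge, halts within $2^{p(|\Psi|)}$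 steps and tells whether $\mathcal Z^{G}_{\pi_1,\eta,\pi_2}$ has a solution in $\mathbb N$. Moreover, for all such $\Psi$, $G$ and $(\pi_1,\eta,\pi_2)$: (2) $\mathcal Z^{G}_{\pi_1,\eta,\pi_2}$ has at most $\ell+1$ constraints and at most $2^{n+3m}$ variables; also $n+m\le|\Psi|$ and $M\le 2^{|\Psi|}$. (3) Let $u$ be the number of $i$ for which $\circledast_i$ is $\neq$ or $\not\equiv_0$. There are $2^u$ systems $A_s\binom{z}{y}=b_s$ (so a single one if $u=0$), each with $d=O(\ell+1)$ rows, with $4\ell+1$ additional variables $y$ (hence at most $t$ columns), and with integer entries of absolute value at most $M$, such that $z\in\mathbb N^{\mathcal K\times\Pi}$ is a solution of $\mathcal Z^{G}_{\pi_1,\eta,\pi_2}$ if and only if for some $s$ there is $y\in\mathbb N^{4\ell+1}$ with $A_s\binom{z}{y}=b_s$. (4) If $\mathcal Z^{G}_{\pi_1,\eta,\pi_2}$ has a solution in $\mathbb N$, then it has one with at most $2d\log_2(4dM)$ non-zero entries, all of them at most $t(dM)^{2d+1}$. -/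

import Mathlib

/-! Sentences in normal form of the two-variable guarded fragment with local Presburger
quantifiers, over relation symbols named by natural numbers (unary symbols `P_i`, binary
symbols `R_j`), and the linear systems attached to the edges of a graph of types. -/

namespace GP2

/-! ### Syntax -/

/-- Quantifier-free formulas, with equality, over the variables `Fin k`. -/
inductive QF (k : ℕ) : Type where
  | top : QF k
  | bot : QF k
  | un (i : ℕ) (v : Fin k) : QF k
  | bin (j : ℕ) (v w : Fin k) : QF k
  | eq (v w : Fin k) : QF k
  | neg (f : QF k) : QF k
  | and (f g : QF k) : QF k
  | or (f g : QF k) : QF k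
  | imp (f g : QF k) : QF k

/-- The comparison `⊛` of a local Presburger quantifier. -/
inductive Cmp : Type where
  | eq | ne | le | ge | lt | gt
  | modEq (d : ℕ)
  | notModEq (d : ℕ)

/-- The relation `a ⊛ b` on integers; `a ≡ b` modulo `0` means `a = b`. -/
def Cmp.Holds : Cmp → ℤ → ℤ → Prop
  | .eq, a, b => a = b
  | .ne, a, b => a ≠ b
  | .le, a, b => a ≤ b
  | .ge, a, b => a ≥ b
  | .lt, a, b => a < b
  | .gt, a, b => a > b
  | .modEq d, a, b => a ≡ b [ZMOD d]
  | .notModEq d, a, b => ¬ a ≡ b [ZMOD d]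

/-- The modulus of a congruence comparison, and `0` for the others. -/
def Cmp.modulus : Cmp → ℕ
  | .modEq d => d
  | .notModEq d => d
  | _ => 0

/-- The comparisons that say `≠`: `≠` itself and `≢` modulo `0`. -/
def Cmp.isNe : Cmp → Bool
  | .ne => true
  | .notModEq 0 => true
  | _ => false

/-- A local Presburger quantifier in basic form:
`∑ λ · #_y^{R(x,y)}[x ≠ y] ⊛ δ`, the sum being over the pairs `(λ, R)` in `terms`. -/
structure LP : Type where
  terms : List (ℤ × ℕ)
  cmp : Cmp
  rhs : ℤ

/-- Atoms in the variable `x`: `P_i(x)`, or `R_j(x,x)`, which counts as a unary predicate. -/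
inductive UAtom : Type where
  | pred (i : ℕ)
  | loop (j : ℕ)

/-- The sentence `∀x γ(x) ∧ ⋀ ∀x∀y ((R(x,y) ∧ x ≠ y) → β(x,y)) ∧ ⋀ ∀x (q(x) → 𝒫(x))`.
The second conjunction is over the pairs `(R, β)` in `guarded`, the third one over the pairs
`(q, 𝒫)` in `counting`. -/
structure Sentence : Type where
  gamma : QF 1
  guarded : List (ℕ × QF 2)
  counting : List (UAtom × LP)

/-! ### The symbols that occur in a sentence -/

def QF.unarySyms {k : ℕ} : QF k → Finset ℕ
  | .top | .bot | .bin _ _ _ | .eq _ _ => ∅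
  | .un i _ => {i}
  | .neg f => f.unarySyms
  | .and f g | .or f g | .imp f g => f.unarySyms ∪ g.unarySyms

def QF.binarySyms {k : ℕ} : QF k → Finset ℕ
  | .top | .bot | .un _ _ | .eq _ _ => ∅
  | .bin j _ _ => {j}
  | .neg f => f.binarySyms
  | .and f g | .or f g | .imp f g => f.binarySyms ∪ g.binarySyms

def UAtom.unarySyms : UAtom → Finset ℕ
  | .pred i => {i}
  | .loop _ => ∅

def UAtom.binarySyms : UAtom → Finset ℕ
  | .pred _ => ∅
  | .loop j => {j}

def LP.binarySyms (P : LP) : Finset ℕ := (P.terms.map Prod.snd).toFinset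

/-- The unary relation symbols of the signature, i.e. those that occur in the sentence. -/
def Sentence.unarySyms (Ψ : Sentence) : Finset ℕ :=
  Ψ.gamma.unarySyms
    ∪ (Ψ.guarded.map fun c => c.2.unarySyms).foldr (· ∪ ·) ∅
    ∪ (Ψ.counting.map fun c => c.1.unarySyms).foldr (· ∪ ·) ∅

/-- The binary relation symbols of the signature, i.e. those that occur in the sentence. -/
def Sentence.binarySyms (Ψ : Sentence) : Finset ℕ :=
  Ψ.gamma.binarySyms
    ∪ (Ψ.guarded.map fun c => insert c.1 c.2.binarySyms).foldr (· ∪ ·) ∅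
    ∪ (Ψ.counting.map fun c => c.1.binarySyms ∪ c.2.binarySyms).foldr (· ∪ ·) ∅

/-! ### Types and graphs -/

/-- A unary type over the signature of `Ψ`, given by its positive literals: the symbols `i` with
`P_i(x)` in the type and the symbols `j` with `R_j(x,x)` in the type. -/
abbrev UnaryType (Ψ : Sentence) : Type :=
  ↥Ψ.unarySyms.powerset × ↥Ψ.binarySyms.powerset

/-- A binary type over the signature of `Ψ`, given by its positive literals: the symbols `j` with
`R_j(x,y)` in the type and the symbols `j` with `R_j(y,x)` in the type. -/
abbrev BinaryType (Ψ : Sentence) : Type :=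
  ↥Ψ.binarySyms.powerset × ↥Ψ.binarySyms.powerset

/-- A non-null binary type: it has a positive literal. -/
abbrev NonNullType (Ψ : Sentence) : Type :=
  {η : BinaryType Ψ // ¬ (η.1.1 = ∅ ∧ η.2.1 = ∅)}

instance (Ψ : Sentence) : DecidableEq (NonNullType Ψ) :=
  fun a b => decidable_of_iff (a.1 = b.1) Subtype.ext_iff.symm

/-- The atom `q(x)` belongs to the unary type `π`. -/
def UAtom.Mem {Ψ : Sentence} (q : UAtom) (π : UnaryType Ψ) : Prop :=
  match q with
  | .pred i => i ∈ π.1.1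
  | .loop j => j ∈ π.2.1

instance {Ψ : Sentence} (q : UAtom) (π : UnaryType Ψ) : Decidable (q.Mem π) := by
  unfold UAtom.Mem
  cases q <;> infer_instance

/-- An edge `(π, η, π')` from `π` to `π'` with label `η`. -/
abbrev Edge (Ψ : Sentence) : Type := UnaryType Ψ × NonNullType Ψ × UnaryType Ψ

instance (Ψ : Sentence) : DecidableEq (Edge Ψ) := instDecidableEqProd

/-- A finite edge-labelled directed graph whose vertices are unary types and whose labels are
non-null binary types. -/
structure Graph (Ψ : Sentence) : Type where
  V : Finset (UnaryType Ψ)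
  E : Finset (Edge Ψ)

/-- The indices `(η', π')` of the variables `z_{η',π'}`. -/
abbrev Var (Ψ : Sentence) : Type := NonNullType Ψ × UnaryType Ψ

/-- The edges going out from `π`. -/
def Graph.out {Ψ : Sentence} (G : Graph Ψ) (π : UnaryType Ψ) : Finset (Var Ψ) :=
  Finset.univ.filter fun v => (π, v.1, v.2) ∈ G.E

/-! ### Linear constraints -/

/-- The constraint `∑ λ · (∑_{v ∈ S} z_v) ⊛ δ`, the outer sum being over the pairs `(λ, S)` in
`terms`. -/
structure LinConstraint (ι : Type) : Type where
  terms : List (ℤ × Finset ι)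
  cmp : Cmp
  rhs : ℤ

def LinConstraint.Sat {ι : Type} (C : LinConstraint ι) (z : ι → ℕ) : Prop :=
  C.cmp.Holds ((C.terms.map fun t => t.1 * ∑ v ∈ t.2, (z v : ℤ)).sum) C.rhs

/-- The constraint `𝒬^{G,π}` of a local Presburger quantifier. -/
def LP.constraint {Ψ : Sentence} (P : LP) (G : Graph Ψ) (π : UnaryType Ψ) :
    LinConstraint (Var Ψ) where
  terms := P.terms.map fun t => (t.1, (G.out π).filter fun v => t.2 ∈ v.1.1.1.1)
  cmp := P.cmp
  rhs := P.rhs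

/-- The system `𝒵^G_{π₁,η,π₂}` of the edge `e = (π₁, η, π₂)`: the constraint `z_{η,π₂} ≥ 1` and
`𝒬_i^{G,π₁}` for each `i` with `q_i(x) ∈ π₁`. -/
def edgeSystem {Ψ : Sentence} (G : Graph Ψ) (e : Edge Ψ) : List (LinConstraint (Var Ψ)) :=
  ⟨[(1, {e.2})], .ge, 1⟩ ::
    (Ψ.counting.filter fun c => decide (c.1.Mem e.1)).map fun c => c.2.constraint G e.1

/-- `z` is a solution in `ℕ` of a system of linear constraints. -/
def IsSolution {ι : Type} (S : List (LinConstraint ι)) (z : ι → ℕ) : Prop :=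
  ∀ C ∈ S, C.Sat z

/-! ### Parameters of a sentence -/

/-- The number `ℓ` of conjuncts `∀x (q_i(x) → 𝒫_i(x))`. -/
def Sentence.ell (Ψ : Sentence) : ℕ := Ψ.counting.length

/-- The number of these conjuncts whose comparison says `≠`. -/
def Sentence.numNe (Ψ : Sentence) : ℕ := Ψ.counting.countP fun c => c.2.cmp.isNe

/-- `∑ |λ_j| + |δ| + d`, where `d` is the modulus if there is one and `0` otherwise. -/
def LP.weight (P : LP) : ℕ :=
  (P.terms.map fun t => t.1.natAbs).sum + P.rhs.natAbs + P.cmp.modulus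

/-- `1 + max_i (∑_j |λ_{i,j}| + |δ_i| + d_i)`. -/
def Sentence.maxCoeff (Ψ : Sentence) : ℕ :=
  1 + (Ψ.counting.map fun c => c.2.weight).foldr max 0

/-! ### Writing sentences, graphs and edges as strings

Formulas are written in prefix notation, all numbers in binary. -/

/-- The alphabet. -/
inductive Tok : Type where
  | bit (b : Bool)
  | endNum | item | endList
  | pos | neg
  | top | bot | un | bin | eqv | not | and | or | imp
  | eq | ne | le | ge | lt | gt | modEq | notModEq
  deriving DecidableEq, Fintype

/-- Binary digits, the least significant one first, and an end mark. -/
def encNat (n : ℕ) : List Tok := n.bits.map Tok.bit ++ [.endNum]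

def encInt (a : ℤ) : List Tok := (if a < 0 then .neg else .pos) :: encNat a.natAbs

def encList {α : Type} (f : α → List Tok) (l : List α) : List Tok :=
  l.flatMap (fun a => .item :: f a) ++ [.endList]

def QF.enc {k : ℕ} : QF k → List Tok
  | .top => [.top]
  | .bot => [.bot]
  | .un i v => .un :: (encNat i ++ encNat v)
  | .bin j v w => .bin :: (encNat j ++ encNat v ++ encNat w)
  | .eq v w => .eqv :: (encNat v ++ encNat w)
  | .neg f => .not :: f.enc
  | .and f g => .and :: (f.enc ++ g.enc)
  | .or f g => .or :: (f.enc ++ g.enc)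
  | .imp f g => .imp :: (f.enc ++ g.enc)

def Cmp.enc : Cmp → List Tok
  | .eq => [.eq]
  | .ne => [.ne]
  | .le => [.le]
  | .ge => [.ge]
  | .lt => [.lt]
  | .gt => [.gt]
  | .modEq d => .modEq :: encNat d
  | .notModEq d => .notModEq :: encNat d

def UAtom.enc : UAtom → List Tok
  | .pred i => .un :: encNat i
  | .loop j => .bin :: encNat j

def LP.enc (P : LP) : List Tok :=
  encList (fun t => encInt t.1 ++ encNat t.2) P.terms ++ P.cmp.enc ++ encInt P.rhs

def Sentence.enc (Ψ : Sentence) : List Tok :=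
  Ψ.gamma.enc ++ encList (fun c => encNat c.1 ++ c.2.enc) Ψ.guarded
    ++ encList (fun c => c.1.enc ++ c.2.enc) Ψ.counting

/-- The length of a sentence. -/
def Sentence.length (Ψ : Sentence) : ℕ := Ψ.enc.length

/-- A set of symbols is written in increasing order. -/
def encSet (s : Finset ℕ) : List Tok := encList encNat s.sort

def encUnaryType {Ψ : Sentence} (π : UnaryType Ψ) : List Tok := encSet π.1.1 ++ encSet π.2.1

def encEdge {Ψ : Sentence} (e : Edge Ψ) : List Tok :=
  encUnaryType e.1 ++ (encSet e.2.1.1.1.1 ++ encSet e.2.1.1.2.1) ++ encUnaryType e.2.2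

/-- `w` describes the sentence `Ψ`, the graph `G` and the edge `e`: the vertices and the edges of
`G` are listed without repetition, in any order. -/
def Describes (Ψ : Sentence) (G : Graph Ψ) (e : Edge Ψ) (w : List Tok) : Prop :=
  ∃ (vs : List (UnaryType Ψ)) (es : List (Edge Ψ)),
    vs.Nodup ∧ vs.toFinset = G.V ∧ es.Nodup ∧ es.toFinset = G.E ∧
    w = Ψ.enc ++ encList encUnaryType vs ++ encList encEdge es ++ encEdge e

/-- On the input `w`, the Turing machine `T` halts within `N` steps with the output `b`. -/
def AnswersWithin (T : Turing.TM2ComputableAux Tok Bool) (w : List Tok) (b : Bool) (N : ℕ) :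
    Prop :=
  Nonempty (Turing.TM2OutputsInTime T.tm (w.map T.inputAlphabet.invFun)
    (some ([b].map T.outputAlphabet.invFun)) N)

end GP2

/-! The mathematical core is a bound on minimal solutions of integer systems. Each edge system is
rewritten as `A x = b` over the naturals. An inequality costs one slack variable, a congruence a
difference of two multiples of the modulus, and a non-congruence a nonzero remainder, bounded by a
second equation. A disequality is resolved as `<` or `>`, which is the only source of the `2 ^ u`
systems (`Cmp.holds_iff_exists_slack`, `exists_matrix_form`).

Small solutions come from one minimality argument, `exists_reduced_solution`. Among all solutions,
take one with as few entries above `D` as possible. If a nonzero kernel vector with entries at most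
`D + 1` were supported on those entries, adding it or its negative repeatedly would bring one of
them down without creating a new large entry. With `D = 0` this forbids kernel vectors with entries
in `{-1, 0, 1}` on the support, so all subset sums of the support columns are distinct. Counting
them gives `2 ^ k ≤ (2kM + 1) ^ d`, hence the logarithmic bound on the support. With `D = (dM) ^ d`
the columns of the large entries must be independent, because by Cramer's rule a dependency yields a
kernel vector with entries at most `D`. Cramer's rule once more then bounds the large entries. The
second reduction is carried out inside the support found by the first, so both bounds hold together
(`exists_small_solution`).

For the algorithm, only the number of chosen edges whose label contains `R(x,y)` matters, for each
`R`. A solution can therefore be represented by a word whose letters are the sets of such symbols,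
with one letter per unit of the solution. The letter of the distinguished edge is put in front of
every word, which accounts for `z_{η,π₂} ≥ 1`. By binary expansion, a solution with `K` nonzero
entries of `b` bits is reached from the empty word in `b (K + 1)` rounds of doubling the word or
adding a letter (`exists_word`). Both `b` and `K` are quadratic in `L = |Ψ|`, so `L ^ 8` rounds
suffice. The procedure generates all words obtainable in that many rounds and evaluates every
constraint on each by unary arithmetic. One round multiplies the total length by `2 ^ O(L)`, so all
strings keep length `2 ^ poly(L)`.

To obtain an actual machine, the procedure is written in a small language of loops over stacks,
compiled to `Turing.TM2`. If every loop makes at most `N` passes, the running time of a fixed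
program is polynomial in `N` (`Prog.exists_time_le`, `Exec.reachIn`). It remains to verify each
subprogram and to bound its loops by `N = 2 ^ (10 L ^ 9)`. -/

namespace GP2

/-! ### Programs over registers that hold strings -/

/-- Structured programs over registers indexed by `ρ`, each of which holds a stack of tokens.
Tests look at the top tokens of two registers. -/
inductive Prog (ρ : Type) : Type where
  | skip : Prog ρ
  | push (r : ρ) (a : Tok) : Prog ρ
  | pop (r : ρ) : Prog ρ
  | cp (a b : ρ) : Prog ρ
  | seq (p q : Prog ρ) : Prog ρ
  | ite (a b : ρ) (f : Option Tok → Option Tok → Bool) (p q : Prog ρ) : Prog ρ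
  | loop (a b : ρ) (f : Option Tok → Option Tok → Bool) (p : Prog ρ) : Prog ρ

infixr:60 ";;" => Prog.seq

/-- Contents of the registers. -/
abbrev Store (ρ : Type) : Type := ρ → List Tok

/-- `k`-fold composition of a relation. -/
def Chain {σ : Type} (R : σ → σ → Prop) : ℕ → σ → σ → Prop
  | 0, s, u => s = u
  | k + 1, s, u => ∃ m, R s m ∧ Chain R k m u

/-- The value of a test. -/
def testVal {ρ : Type} (a b : ρ) (f : Option Tok → Option Tok → Bool) (s : Store ρ) : Bool :=
  f (s a).head? (s b).head?

/-- The program takes `s` to `s'`, and each time a loop is entered it is iterated at most `N`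
times. -/
def Exec {ρ : Type} [DecidableEq ρ] (N : ℕ) : Prog ρ → Store ρ → Store ρ → Prop
  | .skip, s, s' => s' = s
  | .push r a, s, s' => s' = Function.update s r (a :: s r)
  | .pop r, s, s' => s' = Function.update s r (s r).tail
  | .cp a b, s, s' => s' = Function.update s b ((s a).head?.toList ++ s b)
  | .seq p q, s, s' => ∃ m, Exec N p s m ∧ Exec N q m s'
  | .ite a b f p q, s, s' =>
      (testVal a b f s = true ∧ Exec N p s s') ∨ (testVal a b f s = false ∧ Exec N q s s')
  | .loop a b f p, s, u => testVal a b f u = false ∧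
      ∃ k ≤ N, Chain (fun s m => testVal a b f s = true ∧ Exec N p s m) k s u

/-- A bound for the running time of a program whose loops are iterated at most `N` times. -/
def Prog.time {ρ : Type} (N : ℕ) : Prog ρ → ℕ
  | .skip | .push _ _ | .pop _ | .cp _ _ => 1
  | .seq p q => p.time N + q.time N
  | .ite _ _ _ p q => 1 + p.time N + q.time N
  | .loop _ _ _ p => N * (p.time N + 1) + 1

/-- The program is fixed while `N` varies, and each enclosing loop contributes one factor `N`. With
`N = 2 ^ poly` this gives a running time `2 ^ poly`. -/
theorem Prog.exists_time_le {ρ : Type} (p : Prog ρ) :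
    ∃ c k : ℕ, ∀ N, p.time N ≤ c * (N + 1) ^ k := by
  induction p with
  | skip => exact ⟨1, 0, fun N => by simp [Prog.time]⟩
  | push => exact ⟨1, 0, fun N => by simp [Prog.time]⟩
  | pop => exact ⟨1, 0, fun N => by simp [Prog.time]⟩
  | cp => exact ⟨1, 0, fun N => by simp [Prog.time]⟩
  | seq p q hp hq =>
    obtain ⟨c, k, h⟩ := hp
    obtain ⟨c', k', h'⟩ := hq
    refine ⟨c + c', k + k', fun N => ?_⟩
    have h1 : (N + 1) ^ k ≤ (N + 1) ^ (k + k') := Nat.pow_le_pow_right (by omega) (by omega)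
    have h2 : (N + 1) ^ k' ≤ (N + 1) ^ (k + k') := Nat.pow_le_pow_right (by omega) (by omega)
    have h3 := Nat.mul_le_mul_left c h1
    have h4 := Nat.mul_le_mul_left c' h2
    have := h N
    have := h' N
    simp only [Prog.time, add_mul]
    omega
  | ite _ _ _ p q hp hq =>
    obtain ⟨c, k, h⟩ := hp
    obtain ⟨c', k', h'⟩ := hq
    refine ⟨1 + c + c', k + k', fun N => ?_⟩
    have h0 : 1 ≤ (N + 1) ^ (k + k') := Nat.one_le_pow _ _ (by omega)
    have h1 : (N + 1) ^ k ≤ (N + 1) ^ (k + k') := Nat.pow_le_pow_right (by omega) (by omega)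
    have h2 : (N + 1) ^ k' ≤ (N + 1) ^ (k + k') := Nat.pow_le_pow_right (by omega) (by omega)
    have h3 := Nat.mul_le_mul_left c h1
    have h4 := Nat.mul_le_mul_left c' h2
    have := h N
    have := h' N
    simp only [Prog.time, add_mul]
    omega
  | loop _ _ _ p hp =>
    obtain ⟨c, k, h⟩ := hp
    refine ⟨c + 2, k + 1, fun N => ?_⟩
    have h0 : 1 ≤ (N + 1) ^ k := Nat.one_le_pow _ _ (by omega)
    have := h N
    simp only [Prog.time]
    calc N * (p.time N + 1) + 1 ≤ (N + 1) * (c * (N + 1) ^ k + 1) + (N + 1) * 1 := by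
          gcongr <;> omega
      _ ≤ (N + 1) * (c * (N + 1) ^ k + (N + 1) ^ k) + (N + 1) * (N + 1) ^ k := by gcongr
      _ = (c + 2) * (N + 1) ^ (k + 1) := by ring

/-! ### Compilation to a machine with several stacks -/

/-- The stack alphabets: the stack `none` is for the output. -/
def StackAlphabet (ρ : Type) : Option ρ → Type
  | none => Bool
  | some _ => Tok

/-- The labels of the compiled program. -/
def Prog.Label {ρ : Type} : Prog ρ → Type
  | .skip | .push _ _ | .pop _ | .cp _ _ => Unit
  | .seq p q => p.Label ⊕ q.Label
  | .ite _ _ _ p q => Unit ⊕ (p.Label ⊕ q.Label)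
  | .loop _ _ _ p => Unit ⊕ p.Label

@[reducible] def Prog.labelFintype {ρ : Type} : (p : Prog ρ) → Fintype p.Label
  | .skip | .push _ _ | .pop _ | .cp _ _ => inferInstanceAs (Fintype Unit)
  | .seq p q =>
    let _ := p.labelFintype
    let _ := q.labelFintype
    inferInstanceAs (Fintype (p.Label ⊕ q.Label))
  | .ite _ _ _ p q =>
    let _ := p.labelFintype
    let _ := q.labelFintype
    inferInstanceAs (Fintype (Unit ⊕ (p.Label ⊕ q.Label)))
  | .loop _ _ _ p =>
    let _ := p.labelFintype
    inferInstanceAs (Fintype (Unit ⊕ p.Label))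

def Prog.entry {ρ : Type} : (p : Prog ρ) → p.Label
  | .skip | .push _ _ | .pop _ | .cp _ _ => ()
  | .seq p _ => Sum.inl p.entry
  | .ite _ _ _ _ _ => Sum.inl ()
  | .loop _ _ _ _ => Sum.inl ()

/-- The local variables of the machine: the tokens looked at last. -/
abbrev LocalVar : Type := Option Tok × Option Tok

open Turing in
/-- Look at the tops of two registers and branch. -/
def branchStmt {ρ Λ : Type} (a b : ρ) (f : Option Tok → Option Tok → Bool) (l l' : Λ) :
    TM2.Stmt (StackAlphabet ρ) Λ LocalVar :=
  .peek (some a) (fun v (t : Option Tok) => (t, v.2)) <|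
    .peek (some b) (fun v (t : Option Tok) => (v.1, t)) <|
      .branch (fun v => f v.1 v.2) (.goto fun _ => l) (.goto fun _ => l')

open Turing in
/-- The compiled statements, for an embedding of the labels and a label to leave to. -/
def Prog.stmt {ρ Λ : Type} : (p : Prog ρ) → (p.Label → Λ) → Λ → p.Label →
    TM2.Stmt (StackAlphabet ρ) Λ LocalVar
  | .skip, _, exit, _ => .goto fun _ => exit
  | .push r a, _, exit, _ => .push (some r) (fun _ => (a : Tok)) (.goto fun _ => exit)
  | .pop r, _, exit, _ => .pop (some r) (fun v _ => v) (.goto fun _ => exit)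
  | .cp a b, _, exit, _ =>
    .peek (some a) (fun v (t : Option Tok) => (t, v.2)) <|
      .branch (fun v => v.1.isSome)
        (.push (some b) (fun v => (v.1.getD .top : Tok)) (.goto fun _ => exit))
        (.goto fun _ => exit)
  | .seq p q, emb, exit, l =>
    match l with
    | .inl l => p.stmt (fun l => emb (.inl l)) (emb (.inr q.entry)) l
    | .inr l => q.stmt (fun l => emb (.inr l)) exit l
  | .ite a b f p q, emb, exit, l =>
    match l with
    | .inl _ => branchStmt a b f (emb (.inr (.inl p.entry))) (emb (.inr (.inr q.entry)))
    | .inr (.inl l) => p.stmt (fun l => emb (.inr (.inl l))) exit l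
    | .inr (.inr l) => q.stmt (fun l => emb (.inr (.inr l))) exit l
  | .loop a b f p, emb, exit, l =>
    match l with
    | .inl _ => branchStmt a b f (emb (.inr p.entry)) exit
    | .inr l => p.stmt (fun l => emb (.inr l)) (emb (.inl ())) l

/-- The stacks of the machine. -/
def stackVals {ρ : Type} (s : Store ρ) (o : List Bool) : (k : Option ρ) → List (StackAlphabet ρ k)
  | none => o
  | some r => s r

theorem update_stackVals_some {ρ : Type} [DecidableEq ρ] (s : Store ρ) (o : List Bool) (r : ρ)
    (x : List Tok) :
    Function.update (stackVals s o) (some r) x = stackVals (Function.update s r x) o := by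
  funext k
  cases k with
  | none => rfl
  | some r' =>
    by_cases h : r' = r
    · subst h
      exact (Function.update_self (f := stackVals s o) _ _).trans
        (Function.update_self (f := s) _ _).symm
    · exact (Function.update_of_ne (f := stackVals s o) (by simpa using h) _).trans
        (Function.update_of_ne (f := s) h _).symm

/-- `f` leads from `a` to `b` within `t` steps. -/
def ReachIn {α : Type} (f : α → Option α) (a b : α) (t : ℕ) : Prop :=
  ∃ k ≤ t, (flip bind f)^[k] (some a) = some b

theorem ReachIn.single {α : Type} {f : α → Option α} {a b : α} (h : f a = some b) :
    ReachIn f a b 1 := ⟨1, le_rfl, by simpa [flip] using h⟩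

theorem ReachIn.trans {α : Type} {f : α → Option α} {a b c : α} {t u : ℕ}
    (h : ReachIn f a b t) (h' : ReachIn f b c u) : ReachIn f a c (t + u) := by
  obtain ⟨k, hk, e⟩ := h
  obtain ⟨k', hk', e'⟩ := h'
  exact ⟨k' + k, by omega, by rw [Function.iterate_add_apply, e, e']⟩

theorem ReachIn.mono {α : Type} {f : α → Option α} {a b : α} {t u : ℕ}
    (h : ReachIn f a b t) (h' : t ≤ u) : ReachIn f a b u := by
  obtain ⟨k, hk, e⟩ := h
  exact ⟨k, by omega, e⟩

open Turing in
-- Both looks and the jump form one statement, so a test costs one machine step. The local variables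
-- are overwritten, hence the existential.
theorem step_branchStmt {ρ Λ : Type} [DecidableEq ρ] (a b : ρ)
    (f : Option Tok → Option Tok → Bool) (l l' : Λ) (v : LocalVar) (s : Store ρ) (o : List Bool) :
    ∃ v', TM2.stepAux (branchStmt a b f l l') v (stackVals s o) =
      ⟨some (if testVal a b f s then l else l'), v', stackVals s o⟩ := by
  refine ⟨((s a).head?, (s b).head?), ?_⟩
  change cond (testVal a b f s) _ _ = _
  cases testVal a b f s <;> rfl

open Turing in
-- Correctness of the compiler. The embedding of labels and the exit label are arbitrary so that the
-- induction hypothesis applies to a subprogram sitting inside a larger one. The local variables at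
-- the start are arbitrary because the compiled code always reloads the ones it uses.
theorem Exec.reachIn {ρ Λ : Type} [DecidableEq ρ] {N : ℕ}
    (m : Λ → TM2.Stmt (StackAlphabet ρ) Λ LocalVar) (o : List Bool) (p : Prog ρ) :
    ∀ (emb : p.Label → Λ) (exit : Λ), (∀ l, m (emb l) = p.stmt emb exit l) →
    ∀ {s s' : Store ρ}, Exec N p s s' → ∀ v : LocalVar, ∃ v',
      ReachIn (TM2.step m) ⟨some (emb p.entry), v, stackVals s o⟩ ⟨some exit, v', stackVals s' o⟩
        (p.time N) := by
  induction p with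
  | skip =>
    intro emb exit hm s s' h v
    obtain rfl : s' = s := h
    refine ⟨v, ReachIn.single ?_⟩
    rw [TM2.step.eq_2, hm]; rfl
  | push r a =>
    intro emb exit hm s s' h v
    obtain rfl : s' = _ := h
    refine ⟨v, ReachIn.single ?_⟩
    rw [TM2.step.eq_2, hm, ← update_stackVals_some]; rfl
  | pop r =>
    intro emb exit hm s s' h v
    obtain rfl : s' = _ := h
    refine ⟨v, ReachIn.single ?_⟩
    rw [TM2.step.eq_2, hm, ← update_stackVals_some]; rfl
  | cp a b =>
    intro emb exit hm s s' h v
    obtain rfl : s' = _ := h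
    refine ⟨((s a).head?, v.2), ReachIn.single ?_⟩
    rw [TM2.step.eq_2, hm]
    change some (cond (s a).head?.isSome
      (TM2.stepAux (.push (some b) (fun v => (v.1.getD .top : Tok)) (.goto fun _ => exit))
        ((s a).head?, v.2) (stackVals s o)) ⟨some exit, ((s a).head?, v.2), stackVals s o⟩) = _
    cases hh : (s a).head? with
    | none => simp
    | some t => rw [← update_stackVals_some]; rfl
  | seq p q hp hq =>
    intro emb exit hm s s' h v
    obtain ⟨r, h₁, h₂⟩ := h
    obtain ⟨v₁, e₁⟩ := hp (fun l => emb (.inl l)) (emb (.inr q.entry))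
      (fun l => hm (.inl l)) h₁ v
    obtain ⟨v₂, e₂⟩ := hq (fun l => emb (.inr l)) exit (fun l => hm (.inr l)) h₂ v₁
    exact ⟨v₂, e₁.trans e₂⟩
  | ite a b f p q hp hq =>
    intro emb exit hm s s' h v
    obtain ⟨v₁, e₁⟩ := step_branchStmt a b f (emb (.inr (.inl p.entry)))
      (emb (.inr (.inr q.entry))) v s o
    have e₁' : TM2.step m ⟨some (emb (Prog.ite a b f p q).entry), v, stackVals s o⟩ = _ :=
      (congrArg some ((congrArg (fun S => TM2.stepAux S v (stackVals s o)) (hm (.inl ()))).trans e₁))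
    rcases h with ⟨ht, h⟩ | ⟨ht, h⟩
    · rw [ht] at e₁'
      obtain ⟨v₂, e₂⟩ := hp (fun l => emb (.inr (.inl l))) exit (fun l => hm (.inr (.inl l))) h v₁
      exact ⟨v₂, ((ReachIn.single e₁').trans e₂).mono (by simp [Prog.time])⟩
    · rw [ht] at e₁'
      obtain ⟨v₂, e₂⟩ := hq (fun l => emb (.inr (.inr l))) exit (fun l => hm (.inr (.inr l))) h v₁
      exact ⟨v₂, ((ReachIn.single e₁').trans e₂).mono (by simp [Prog.time])⟩
  | loop a b f p hp =>
    intro emb exit hm s s' h v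
    obtain ⟨hf, k, hk, hc⟩ := h
    -- Each of the `k` passes pays for its successful test and the body; the last `+ 1` is the
    -- failing test.
    have key : ∀ k s v, Chain (fun s m => testVal a b f s = true ∧ Exec N p s m) k s s' →
        ∃ v', ReachIn (TM2.step m) ⟨some (emb (.inl ())), v, stackVals s o⟩
          ⟨some exit, v', stackVals s' o⟩ (k * (p.time N + 1) + 1) := by
      intro k
      induction k with
      | zero =>
        intro s v hc
        obtain rfl : s = s' := hc
        obtain ⟨v₁, e₁⟩ := step_branchStmt a b f (emb (.inr p.entry)) exit v s o
        have e₁' : TM2.step m ⟨some (emb (.inl ())), v, stackVals s o⟩ = _ :=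
          (congrArg some
            ((congrArg (fun S => TM2.stepAux S v (stackVals s o)) (hm (.inl ()))).trans e₁))
        rw [hf] at e₁'
        exact ⟨v₁, (ReachIn.single e₁').mono (by omega)⟩
      | succ k ih =>
        intro s v hc
        obtain ⟨r, ⟨ht, hr⟩, hc⟩ := hc
        obtain ⟨v₁, e₁⟩ := step_branchStmt a b f (emb (.inr p.entry)) exit v s o
        have e₁' : TM2.step m ⟨some (emb (.inl ())), v, stackVals s o⟩ = _ :=
          (congrArg some
            ((congrArg (fun S => TM2.stepAux S v (stackVals s o)) (hm (.inl ()))).trans e₁))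
        rw [ht] at e₁'
        obtain ⟨v₂, e₂⟩ := hp (fun l => emb (.inr l)) (emb (.inl ())) (fun l => hm (.inr l)) hr v₁
        obtain ⟨v₃, e₃⟩ := ih r v₂ hc
        exact ⟨v₃, (((ReachIn.single e₁').trans e₂).trans e₃).mono (by ring_nf; omega)⟩
    obtain ⟨v', e⟩ := key k s v hc
    exact ⟨v', e.mono (by simp only [Prog.time]; gcongr)⟩

open Turing in
/-- The machine that runs `p` with its input in `inp`, and answers whether `res` is non-empty
in the end. -/
def Prog.machine {ρ : Type} [DecidableEq ρ] [Fintype ρ] (p : Prog ρ) (inp res : ρ) :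
    TM2ComputableAux Tok Bool where
  tm :=
    { K := Option ρ
      k₀ := some inp
      k₁ := none
      Γ := StackAlphabet ρ
      Λ := Option p.Label
      main := some p.entry
      ΛFin := let _ := p.labelFintype; inferInstanceAs (Fintype (Option p.Label))
      σ := LocalVar
      initialState := (none, none)
      Γk₀Fin := inferInstanceAs (Fintype Tok)
      m := fun l =>
        match l with
        | some l => p.stmt some none l
        -- The exit label turns the result register into the output bit. It also resets the local
        -- variables, since the final configuration has to be exactly `Turing.haltList`.
        | none =>
          .pop (some res) (fun _ (t : Option Tok) => (t, none)) <|
            .push none (fun v => (v.1.isSome : Bool)) <| .load (fun _ => (none, none)) .halt }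
  inputAlphabet := Equiv.refl Tok
  outputAlphabet := Equiv.refl Bool

/-- The halting configuration prescribes empty stacks apart from the output. This is why every
program has to clean up all its registers except `res`. The extra step is the one at the exit label.
-/
theorem Prog.machine_answers {ρ : Type} [DecidableEq ρ] [Fintype ρ] (p : Prog ρ) (inp res : ρ)
    {N : ℕ} {w : List Tok} {b : Bool}
    (h : Exec N p (fun r => if r = inp then w else [])
      (fun r => if r = res ∧ b = true then [.top] else [])) :
    AnswersWithin (p.machine inp res) w b (p.time N + 1) := by
  obtain ⟨v, e⟩ := Exec.reachIn (p.machine inp res).tm.m [] p some none (fun l => rfl) h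
    (none, none)
  have hlast : Turing.TM2.step (p.machine inp res).tm.m
      ⟨some none, v, stackVals (fun r => if r = res ∧ b = true then [.top] else []) []⟩ =
      some (Turing.haltList (p.machine inp res).tm [b]) := by
    refine congrArg some ?_
    change Turing.TM2.Cfg.mk none (none, none) _ = Turing.TM2.Cfg.mk none (none, none) _
    congr 1
    funext k
    cases k with
    | none =>
      refine (Function.update_self (β := fun k => List (StackAlphabet ρ k)) _ _ _).trans ?_
      refine Eq.trans (b := [b]) ?_ (by rfl)
      change (if res = res ∧ b = true then [Tok.top] else []).head?.isSome :: [] = [b]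
      cases b <;> simp
    | some r =>
      refine (congrFun (update_stackVals_some _ _ _ _) (some r)).trans ?_
      change Function.update (fun r => if r = res ∧ b = true then [Tok.top] else []) res
        (List.tail (if res = res ∧ b = true then [Tok.top] else [])) r = []
      by_cases hr : r = res
      · subst hr; cases b <;> simp
      · simp [hr]
  obtain ⟨k, hk, e'⟩ := e.trans (ReachIn.single hlast)
  refine ⟨⟨⟨k, ?_⟩, hk⟩⟩
  rw [show Turing.initList (p.machine inp res).tm (w.map (p.machine inp res).inputAlphabet.invFun) =
    (⟨some (some p.entry), (none, none), stackVals (fun r => if r = inp then w else []) []⟩ :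
      Turing.TM2.Cfg _ _ _) from ?_]
  · exact e'
  · change Turing.TM2.Cfg.mk _ _ _ = Turing.TM2.Cfg.mk _ _ _
    congr 1
    funext k
    cases k with
    | none => rfl
    | some r =>
      by_cases hr : r = inp
      · subst hr
        refine (dif_pos rfl).trans ?_
        change w.map id = if r = r then w else []
        simp
      · refine (dif_neg (fun h => hr (Option.some.inj h))).trans ?_
        exact (if_neg hr).symm

-- Execution rules for the basic programs

notation:max s "⟦" r "↦" x "⟧" => Function.update s r x

section Basic

variable {ρ : Type} [DecidableEq ρ] {N : ℕ}

theorem Exec.seq {p q : Prog ρ} {s m s' : Store ρ} (h : Exec N p s m) (h' : Exec N q m s') :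
    Exec N (p ;; q) s s' := ⟨m, h, h'⟩

theorem Exec.to {p : Prog ρ} {s s' s'' : Store ρ} (h : Exec N p s s') (e : s' = s'') :
    Exec N p s s'' := e ▸ h

theorem Exec.of_eq {p : Prog ρ} {s₀ s s' : Store ρ} (h : Exec N p s₀ s') (e : s₀ = s) :
    Exec N p s s' := e ▸ h

theorem Exec.ite_pos {a b : ρ} {f : Option Tok → Option Tok → Bool} {p q : Prog ρ}
    {s s' : Store ρ} (h : testVal a b f s = true) (h' : Exec N p s s') :
    Exec N (.ite a b f p q) s s' := Or.inl ⟨h, h'⟩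

theorem Exec.ite_neg {a b : ρ} {f : Option Tok → Option Tok → Bool} {p q : Prog ρ}
    {s s' : Store ρ} (h : testVal a b f s = false) (h' : Exec N q s s') :
    Exec N (.ite a b f p q) s s' := Or.inr ⟨h, h'⟩

theorem Exec.push (r : ρ) (a : Tok) (s : Store ρ) :
    Exec N (.push r a) s s⟦r ↦ a :: s r⟧ := rfl

theorem Exec.pop (r : ρ) (s : Store ρ) : Exec N (.pop r) s s⟦r ↦ (s r).tail⟧ := rfl

theorem Exec.skip (s : Store ρ) : Exec N .skip s s := rfl

theorem Chain.trans {σ : Type} {R : σ → σ → Prop} {k l : ℕ} {s m s' : σ}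
    (h : Chain R k s m) (h' : Chain R l m s') : Chain R (k + l) s s' := by
  induction k generalizing s with
  | zero => obtain rfl : s = m := h; simpa using h'
  | succ k ih =>
    obtain ⟨r, hr, h⟩ := h
    rw [Nat.succ_add]
    exact ⟨r, hr, ih h⟩

theorem Chain.to {σ : Type} {R : σ → σ → Prop} {k : ℕ} {s s' s'' : σ} (h : Chain R k s s')
    (e : s' = s'') : Chain R k s s'' := e ▸ h

theorem Chain.single {σ : Type} {R : σ → σ → Prop} {s s' : σ} (h : R s s') : Chain R 1 s s' :=
  ⟨s', h, rfl⟩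

/-- One iteration for each element of a list; the intermediate states are given as a function of
the elements that are done and those that are left. -/
theorem Chain.of_list {σ α : Type} {R : σ → σ → Prop} (l : List α) (st : List α → List α → σ)
    (h : ∀ pre x suf, l = pre ++ x :: suf → R (st pre (x :: suf)) (st (pre ++ [x]) suf)) :
    Chain R l.length (st [] l) (st l []) := by
  have key : ∀ suf pre, l = pre ++ suf → Chain R suf.length (st pre suf) (st l []) := by
    intro suf
    induction suf with
    | nil => intro pre e; simp [Chain, e]
    | cons x suf ih =>
      intro pre e
      exact ⟨_, h pre x suf e, ih (pre ++ [x]) (by simp [e])⟩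
  exact key l [] rfl

/-- The form in which most loops are verified: `st pre suf` is the loop invariant when the elements
of `pre` are done and those of `suf` remain, so the number of passes is the length of the list. -/
theorem Exec.loop_of_list {α : Type} {a b : ρ} {f : Option Tok → Option Tok → Bool} {p : Prog ρ}
    (l : List α) (st : List α → List α → Store ρ) (hN : l.length ≤ N)
    (h : ∀ pre x suf, l = pre ++ x :: suf →
      testVal a b f (st pre (x :: suf)) = true ∧ Exec N p (st pre (x :: suf)) (st (pre ++ [x]) suf))
    (hf : testVal a b f (st l []) = false) :
    Exec N (.loop a b f p) (st [] l) (st l []) :=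
  ⟨hf, l.length, hN, Chain.of_list l st h⟩

/-- Test for a non-empty register. -/
def isSomeTest (o _ : Option Tok) : Bool := o.isSome

/-- Test for a given token. -/
def tokTest (t : Tok) (o _ : Option Tok) : Bool := o == some t

/-- Test for a token different from a given one. -/
def notTokTest (t : Tok) (o _ : Option Tok) : Bool := o.isSome && o != some t

/-- Move a token. -/
def Prog.mv (a b : ρ) : Prog ρ := .cp a b ;; .pop a

def Prog.mvAll (a b : ρ) : Prog ρ := .loop a a isSomeTest (.mv a b)

/-- Move the tokens before the first `t`. -/
def Prog.mvBefore (t : Tok) (a b : ρ) : Prog ρ := .loop a a (notTokTest t) (.mv a b)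

def Prog.mvThru (t : Tok) (a b : ρ) : Prog ρ := .mvBefore t a b ;; .mv a b

def Prog.mvUntil (t : Tok) (a b : ρ) : Prog ρ := .mvBefore t a b ;; .pop a

def Prog.clear (a : ρ) : Prog ρ := .loop a a isSomeTest (.pop a)

/-- Put a copy of `a` on top of `b`, with the help of the empty register `t`. -/
def Prog.copy (a b t : ρ) : Prog ρ :=
  .mvAll a t ;; .loop t t isSomeTest (.cp t b ;; .mv t a)

theorem exec_mv {a b : ρ} (hab : a ≠ b) {s : Store ρ} {t : Tok} {v : List Tok}
    (h : s a = t :: v) : Exec N (.mv a b) s s⟦a ↦ v⟧⟦b ↦ t :: s b⟧ := by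
  refine ⟨_, rfl, ?_⟩
  change _ = _
  rw [Function.update_comm hab]
  simp [h, Function.update_of_ne hab]

/-- Moving from stack to stack token by token reverses the string; a second move restores the order.
-/
theorem exec_mvWhile {a b : ρ} (hab : a ≠ b) (g : Option Tok → Option Tok → Bool) {s : Store ρ}
    {u v : List Tok} (h : s a = u ++ v) (hu : ∀ t ∈ u, g (some t) (some t) = true)
    (hv : g v.head? v.head? = false) (hN : u.length ≤ N) :
    Exec N (.loop a a g (.mv a b)) s s⟦a ↦ v⟧⟦b ↦ u.reverse ++ s b⟧ := by
  have := Exec.loop_of_list (N := N) (a := a) (b := a) (f := g) (p := .mv a b) u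
    (fun pre suf => s⟦a ↦ suf ++ v⟧⟦b ↦ pre.reverse ++ s b⟧) hN ?_ ?_
  · simpa [← h] using this
  · intro pre x suf e
    refine ⟨?_, ?_⟩
    · simp only [testVal, Function.update_of_ne hab, Function.update_self, List.cons_append,
        List.head?_cons]
      exact hu x (by simp [e])
    · refine (exec_mv hab (t := x) (v := suf ++ v) ?_).to ?_
      · simp [Function.update_of_ne hab]
      · funext r
        simp only [Function.update_apply]
        grind
  · simpa [testVal, Function.update_of_ne hab] using hv

theorem exec_mvAll {a b : ρ} (hab : a ≠ b) {s : Store ρ} (hN : (s a).length ≤ N) :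
    Exec N (.mvAll a b) s s⟦a ↦ []⟧⟦b ↦ (s a).reverse ++ s b⟧ :=
  exec_mvWhile hab _ (by simp) (by simp [isSomeTest]) (by simp [isSomeTest]) hN

theorem exec_mvBefore {a b : ρ} (hab : a ≠ b) {s : Store ρ} {t : Tok} {u v : List Tok}
    (h : s a = u ++ t :: v) (hu : t ∉ u) (hN : u.length ≤ N) :
    Exec N (.mvBefore t a b) s s⟦a ↦ t :: v⟧⟦b ↦ u.reverse ++ s b⟧ :=
  exec_mvWhile hab _ h
    (fun t' h' => by
      have : t' ≠ t := by rintro rfl; exact hu h'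
      simp [notTokTest, this])
    (by simp [notTokTest]) hN

theorem exec_mvThru {a b : ρ} (hab : a ≠ b) {s : Store ρ} {t : Tok} {u v : List Tok}
    (h : s a = u ++ t :: v) (hu : t ∉ u) (hN : u.length ≤ N) :
    Exec N (.mvThru t a b) s s⟦a ↦ v⟧⟦b ↦ (u ++ [t]).reverse ++ s b⟧ := by
  refine ((exec_mvBefore hab h hu hN).seq (exec_mv hab (t := t) (v := v) ?_)).to ?_
  · simp [Function.update_of_ne hab]
  · funext r
    simp only [Function.update_apply]
    grind

theorem exec_mvUntil {a b : ρ} (hab : a ≠ b) {s : Store ρ} {t : Tok} {u v : List Tok}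
    (h : s a = u ++ t :: v) (hu : t ∉ u) (hN : u.length ≤ N) :
    Exec N (.mvUntil t a b) s s⟦a ↦ v⟧⟦b ↦ u.reverse ++ s b⟧ := by
  refine ((exec_mvBefore hab h hu hN).seq (Exec.pop a _)).to ?_
  rw [Function.update_comm hab.symm]
  simp [Function.update_of_ne hab]

theorem exec_clear {a : ρ} {s : Store ρ} (hN : (s a).length ≤ N) :
    Exec N (.clear a) s s⟦a ↦ []⟧ := by
  have := Exec.loop_of_list (N := N) (a := a) (b := a) (f := isSomeTest) (p := .pop a) (s a)
    (fun _ suf => s⟦a ↦ suf⟧) hN ?_ ?_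
  · rwa [Function.update_eq_self] at this
  · intro pre x suf e
    exact ⟨by simp [testVal, isSomeTest], (Exec.pop a _).to (by simp)⟩
  · simp [testVal, isSomeTest]

/-- The string is reversed into `t`, and on the way back each token is put on both `a` and `b`, so
both receive it in the original order. -/
theorem exec_copy {a b t : ρ} (hab : a ≠ b) (hat : a ≠ t) (hbt : b ≠ t) {s : Store ρ}
    (ht : s t = []) (hN : (s a).length ≤ N) :
    Exec N (.copy a b t) s s⟦b ↦ s a ++ s b⟧ := by
  refine (exec_mvAll hat hN).seq ?_
  have := Exec.loop_of_list (N := N) (a := t) (b := t) (f := isSomeTest)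
    (p := .cp t b ;; .mv t a) (s a).reverse
    (fun pre suf => s⟦a ↦ pre.reverse⟧⟦t ↦ suf⟧⟦b ↦ pre.reverse ++ s b⟧) (by simpa using hN) ?_ ?_
  · simp only [ht, List.append_nil]
    convert this using 1
    · funext r
      simp only [Function.update_apply]
      grind
    · funext r
      simp only [Function.update_apply]
      grind
  · intro pre x suf e
    refine ⟨by simp [testVal, isSomeTest, Function.update_of_ne hbt.symm], ?_⟩
    refine Exec.seq (m := s⟦a ↦ pre.reverse⟧⟦t ↦ x :: suf⟧⟦b ↦ x :: pre.reverse ++ s b⟧) ?_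
      ((exec_mv hat.symm (t := x) (v := suf) ?_).to ?_)
    · change _ = _
      simp [Function.update_of_ne hbt.symm]
    · simp [Function.update_of_ne hbt.symm]
    · funext r
      simp only [Function.update_apply]
      grind
  · simp [testVal, isSomeTest, Function.update_of_ne hbt.symm]

/-! ### Moving the code of an object from one register to another -/

/-- The program takes the string `c` off the register `a` and puts its tokens on `b`. -/
def Moves (N : ℕ) (p : Prog ρ) (a b : ρ) (c : List Tok) : Prop :=
  ∀ (s : Store ρ) (v : List Tok), s a = c ++ v → Exec N p s s⟦a ↦ v⟧⟦b ↦ c.reverse ++ s b⟧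

variable {a b : ρ}

theorem Moves.seq (hab : a ≠ b) {p q : Prog ρ} {c c' : List Tok} (h : Moves N p a b c)
    (h' : Moves N q a b c') : Moves N (p ;; q) a b (c ++ c') := by
  intro s v hs
  refine ((h s (c' ++ v) (by simp [hs])).seq (h' _ v ?_)).to ?_
  · simp [Function.update_of_ne hab]
  · funext r
    simp only [Function.update_apply]
    grind

theorem Moves.mv (hab : a ≠ b) (t : Tok) : Moves N (.mv a b) a b [t] := by
  intro s v hs
  exact exec_mv hab hs

theorem Moves.cons (hab : a ≠ b) {p : Prog ρ} (t : Tok) {c : List Tok} (h : Moves N p a b c) :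
    Moves N (.mv a b ;; p) a b (t :: c) :=
  Moves.seq hab (Moves.mv hab t) h

theorem endNum_notMem_bits (n : ℕ) : Tok.endNum ∉ n.bits.map Tok.bit := by simp

theorem Moves.nat (hab : a ≠ b) (n : ℕ) (hN : (encNat n).length ≤ N) :
    Moves N (.mvThru .endNum a b) a b (encNat n) := by
  intro s v hs
  exact exec_mvThru hab (by simpa [encNat] using hs) (endNum_notMem_bits n)
    (by simp [encNat] at hN ⊢; omega)

theorem Moves.int (hab : a ≠ b) (n : ℤ) (hN : (encInt n).length ≤ N) :
    Moves N (.mv a b ;; .mvThru .endNum a b) a b (encInt n) :=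
  Moves.cons hab _ (Moves.nat hab _ (by simp [encInt] at hN; omega))

/-- Move a list whose elements are moved by `p`. -/
def Prog.mvList (p : Prog ρ) (a b : ρ) : Prog ρ :=
  .loop a a (tokTest .item) (.mv a b ;; p) ;; .mv a b

/-- Each element is announced by `item` and the list is closed by `endList`, so the next token alone
decides whether the loop goes on. -/
theorem Moves.list (hab : a ≠ b) {α : Type} {p : Prog ρ} {f : α → List Tok} {l : List α}
    (h : ∀ x ∈ l, Moves N p a b (f x)) (hN : l.length ≤ N) :
    Moves N (.mvList p a b) a b (encList f l) := by
  intro s v hs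
  have key := Exec.loop_of_list (N := N) (a := a) (b := a) (f := tokTest .item)
    (p := .mv a b ;; p) l
    (fun pre suf =>
      s⟦a ↦ encList f suf ++ v⟧⟦b ↦ (pre.flatMap fun x => .item :: f x).reverse ++ s b⟧) hN ?_ ?_
  · rw [← hs, List.flatMap_nil, List.reverse_nil, List.nil_append, Function.update_eq_self,
      Function.update_eq_self] at key
    refine (key.seq (exec_mv hab (t := .endList) (v := v) ?_)).to ?_
    · simp [Function.update_of_ne hab, encList]
    · funext r
      simp only [Function.update_apply, encList]
      grind
  · intro pre x suf e
    refine ⟨by simp [testVal, tokTest, Function.update_of_ne hab, encList], ?_⟩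
    refine (Moves.cons hab .item (h x (by simp [e])) _ (encList f suf ++ v) ?_).to ?_
    · simp [Function.update_of_ne hab, encList]
    · funext r
      simp only [Function.update_apply]
      grind
  · simp [testVal, tokTest, Function.update_of_ne hab, encList]

/-! ### Moving the code of a formula -/

/-- Treat the first token of a formula; `pend` holds an `item` for each formula still to come. -/
def Prog.qfStep (a b pend : ρ) : Prog ρ :=
  .pop pend ;;
  .ite a a (fun o _ => o == some .un || o == some .eqv)
    (.mv a b ;; .mvThru .endNum a b ;; .mvThru .endNum a b)
    (.ite a a (tokTest .bin)
      (.mv a b ;; .mvThru .endNum a b ;; .mvThru .endNum a b ;; .mvThru .endNum a b)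
      (.ite a a (tokTest .not) (.mv a b ;; .push pend .item)
        (.ite a a (fun o _ => o == some .and || o == some .or || o == some .imp)
          (.mv a b ;; .push pend .item ;; .push pend .item) (.mv a b))))

def Prog.mvQF (a b pend : ρ) : Prog ρ :=
  .push pend .endList ;; .push pend .item ;;
  .loop pend pend (tokTest .item) (.qfStep a b pend) ;; .pop pend

/-- The number of connectives and atoms. -/
def QF.size {k : ℕ} : QF k → ℕ
  | .top | .bot | .un _ _ | .bin _ _ _ | .eq _ _ => 1
  | .neg f => 1 + f.size
  | .and f g | .or f g | .imp f g => 1 + f.size + g.size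

theorem QF.size_le {k : ℕ} (f : QF k) : f.size ≤ f.enc.length := by
  induction f <;> simp [QF.size, QF.enc] <;> omega

theorem QF.size_pos {k : ℕ} (f : QF k) : 0 < f.size := by
  cases f <;> simp [QF.size]

theorem exec_qfStep_atom {pend : ρ} (ha : a ≠ pend) (hb : b ≠ pend) {k : ℕ}
    (hab : a ≠ b) {f : QF k} (hf : f.size = 1) (hN : f.enc.length ≤ N) {s : Store ρ}
    {v P : List Tok} (hs : s a = f.enc ++ v) (hp : s pend = .item :: P) :
    Exec N (.qfStep a b pend) s s⟦a ↦ v⟧⟦b ↦ f.enc.reverse ++ s b⟧⟦pend ↦ P⟧ := by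
  refine Exec.seq (Exec.pop pend s) ?_
  have e : s⟦a ↦ v⟧⟦b ↦ f.enc.reverse ++ s b⟧⟦pend ↦ P⟧ =
      s⟦pend ↦ P⟧⟦a ↦ v⟧⟦b ↦ f.enc.reverse ++ s⟦pend ↦ P⟧ b⟧ := by
    funext r
    simp only [Function.update_apply]
    grind
  rw [e, hp, List.tail_cons]
  have hs' : s⟦pend ↦ P⟧ a = f.enc ++ v := by rw [Function.update_of_ne ha, hs]
  cases f with
  | top =>
    refine Exec.ite_neg ?_ (Exec.ite_neg ?_ (Exec.ite_neg ?_ (Exec.ite_neg ?_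
      (Moves.mv hab _ _ _ hs')))) <;> simp [testVal, tokTest, hs', QF.enc]
  | bot =>
    refine Exec.ite_neg ?_ (Exec.ite_neg ?_ (Exec.ite_neg ?_ (Exec.ite_neg ?_
      (Moves.mv hab _ _ _ hs')))) <;> simp [testVal, tokTest, hs', QF.enc]
  | un i w =>
    simp only [QF.enc, List.length_cons, List.length_append] at hN
    refine Exec.ite_pos (by simp [testVal, hs', QF.enc]) ?_
    exact Moves.cons hab _ (Moves.seq hab (Moves.nat hab _ (by omega))
      (Moves.nat hab _ (by omega))) _ _ hs'
  | eq w x =>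
    simp only [QF.enc, List.length_cons, List.length_append] at hN
    refine Exec.ite_pos (by simp [testVal, hs', QF.enc]) ?_
    exact Moves.cons hab _ (Moves.seq hab (Moves.nat hab _ (by omega))
      (Moves.nat hab _ (by omega))) _ _ hs'
  | bin i w x =>
    simp only [QF.enc, List.length_cons, List.length_append] at hN
    refine Exec.ite_neg (by simp [testVal, hs', QF.enc])
      (Exec.ite_pos (by simp [testVal, tokTest, hs', QF.enc]) ?_)
    have := Moves.cons hab .bin (Moves.seq hab (Moves.nat (N := N) hab i (by omega))
      (Moves.seq hab (Moves.nat hab w (by omega)) (Moves.nat hab x (by omega))))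
    rw [← List.append_assoc] at this
    exact this _ _ hs'
  | neg g => have := g.size_pos; simp only [QF.size] at hf; omega
  | and g h => have := g.size_pos; simp only [QF.size] at hf; omega
  | or g h => have := g.size_pos; simp only [QF.size] at hf; omega
  | imp g h => have := g.size_pos; simp only [QF.size] at hf; omega

theorem exec_qfStep_not {pend : ρ} (ha : a ≠ pend) (hb : b ≠ pend) (hab : a ≠ b) {s : Store ρ}
    {v P : List Tok} (hs : s a = .not :: v) (hp : s pend = .item :: P) :
    Exec N (.qfStep a b pend) s s⟦a ↦ v⟧⟦b ↦ .not :: s b⟧⟦pend ↦ .item :: P⟧ := by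
  refine Exec.seq (Exec.pop pend s) ?_
  rw [hp, List.tail_cons]
  have hs' : s⟦pend ↦ P⟧ a = .not :: v := by rw [Function.update_of_ne ha, hs]
  refine Exec.ite_neg (by simp [testVal, hs']) (Exec.ite_neg (by simp [testVal, tokTest, hs'])
    (Exec.ite_pos (by simp [testVal, tokTest, hs']) ?_))
  refine ((exec_mv hab hs').seq (Exec.push _ _ _)).to ?_
  funext r
  simp only [Function.update_apply]
  grind

theorem exec_qfStep_binary {pend : ρ} (ha : a ≠ pend) (hb : b ≠ pend) (hab : a ≠ b) {t : Tok}
    (ht : t = .and ∨ t = .or ∨ t = .imp) {s : Store ρ}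
    {v P : List Tok} (hs : s a = t :: v) (hp : s pend = .item :: P) :
    Exec N (.qfStep a b pend) s s⟦a ↦ v⟧⟦b ↦ t :: s b⟧⟦pend ↦ .item :: .item :: P⟧ := by
  refine Exec.seq (Exec.pop pend s) ?_
  rw [hp, List.tail_cons]
  have hs' : s⟦pend ↦ P⟧ a = t :: v := by rw [Function.update_of_ne ha, hs]
  refine Exec.ite_neg ?_ (Exec.ite_neg ?_ (Exec.ite_neg ?_ (Exec.ite_pos ?_ ?_)))
  · rcases ht with rfl | rfl | rfl <;> simp [testVal, hs']
  · rcases ht with rfl | rfl | rfl <;> simp [testVal, tokTest, hs']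
  · rcases ht with rfl | rfl | rfl <;> simp [testVal, tokTest, hs']
  · rcases ht with rfl | rfl | rfl <;> simp [testVal, hs']
  refine ((exec_mv hab hs').seq ((Exec.push _ _ _).seq (Exec.push _ _ _))).to ?_
  funext r
  simp only [Function.update_apply]
  grind

/-- Prefix notation is parsed with a counter of the formulas still owed: an atom settles one, a
negation leaves the count unchanged, and a binary connective raises it by one. Arbitrary `v` and `P`
allow the two arguments of a connective to be handled in succession. -/
theorem chain_qfStep {pend : ρ} (hab : a ≠ b) (ha : a ≠ pend) (hb : b ≠ pend) {k : ℕ} (f : QF k)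
    (hN : f.enc.length ≤ N) : ∀ (s : Store ρ) (v P : List Tok),
      s a = f.enc ++ v → s pend = .item :: P →
    Chain (fun s m => testVal pend pend (tokTest .item) s = true ∧ Exec N (.qfStep a b pend) s m)
      f.size s s⟦a ↦ v⟧⟦b ↦ f.enc.reverse ++ s b⟧⟦pend ↦ P⟧ := by
  have test : ∀ (s : Store ρ) (P : List Tok), s pend = .item :: P →
      testVal pend pend (tokTest .item) s = true := by
    intro s P h
    simp [testVal, tokTest, h]
  have binary : ∀ (g h : QF k) (t : Tok), (t = .and ∨ t = .or ∨ t = .imp) →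
      (∀ (s : Store ρ) (v P : List Tok), s a = g.enc ++ v → s pend = .item :: P →
        Chain (fun s m => testVal pend pend (tokTest .item) s = true ∧
          Exec N (.qfStep a b pend) s m) g.size s
          s⟦a ↦ v⟧⟦b ↦ g.enc.reverse ++ s b⟧⟦pend ↦ P⟧) →
      (∀ (s : Store ρ) (v P : List Tok), s a = h.enc ++ v → s pend = .item :: P →
        Chain (fun s m => testVal pend pend (tokTest .item) s = true ∧
          Exec N (.qfStep a b pend) s m) h.size s
          s⟦a ↦ v⟧⟦b ↦ h.enc.reverse ++ s b⟧⟦pend ↦ P⟧) →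
      ∀ (s : Store ρ) (v P : List Tok), s a = t :: (g.enc ++ h.enc) ++ v → s pend = .item :: P →
        Chain (fun s m => testVal pend pend (tokTest .item) s = true ∧
          Exec N (.qfStep a b pend) s m) (1 + g.size + h.size) s
          s⟦a ↦ v⟧⟦b ↦ (t :: (g.enc ++ h.enc)).reverse ++ s b⟧⟦pend ↦ P⟧ := by
    intro g h t ht hg hh s v P hs hp
    have h1 := exec_qfStep_binary (N := N) ha hb hab ht (v := g.enc ++ (h.enc ++ v))
      (by simpa using hs) hp
    have h2 := hg (s⟦a ↦ g.enc ++ (h.enc ++ v)⟧⟦b ↦ t :: s b⟧⟦pend ↦ .item :: .item :: P⟧)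
      (h.enc ++ v) (.item :: P) (by simp [ha, hab]) (by simp)
    have h3 := hh (s⟦a ↦ h.enc ++ v⟧⟦b ↦ g.enc.reverse ++ t :: s b⟧⟦pend ↦ .item :: P⟧) v P
      (by simp [ha, hab]) (by simp)
    replace h2 := h2.to
        (s'' := s⟦a ↦ h.enc ++ v⟧⟦b ↦ g.enc.reverse ++ t :: s b⟧⟦pend ↦ .item :: P⟧) (by
      funext r
      simp only [Function.update_apply]
      grind)
    convert ((Chain.single ⟨test _ _ hp, h1⟩).trans h2).trans h3 using 1
    funext r
    simp only [Function.update_apply]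
    grind
  induction f with
  | top => intro s v P hs hp; exact .single ⟨test _ _ hp, exec_qfStep_atom ha hb hab rfl hN hs hp⟩
  | bot => intro s v P hs hp; exact .single ⟨test _ _ hp, exec_qfStep_atom ha hb hab rfl hN hs hp⟩
  | un => intro s v P hs hp; exact .single ⟨test _ _ hp, exec_qfStep_atom ha hb hab rfl hN hs hp⟩
  | bin => intro s v P hs hp; exact .single ⟨test _ _ hp, exec_qfStep_atom ha hb hab rfl hN hs hp⟩
  | eq => intro s v P hs hp; exact .single ⟨test _ _ hp, exec_qfStep_atom ha hb hab rfl hN hs hp⟩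
  | neg f ih =>
    intro s v P hs hp
    have h1 := exec_qfStep_not (N := N) ha hb hab (v := f.enc ++ v)
      (by simpa [QF.enc] using hs) hp
    have h2 := ih (by simp [QF.enc] at hN; omega)
      (s⟦a ↦ f.enc ++ v⟧⟦b ↦ .not :: s b⟧⟦pend ↦ .item :: P⟧) v P (by simp [ha, hab]) (by simp)
    convert (Chain.single ⟨test _ _ hp, h1⟩).trans h2 using 1
    · rfl
    · funext r
      simp only [Function.update_apply, QF.enc]
      grind
  | and g h hg hh =>
    simp only [QF.enc, List.length_cons, List.length_append] at hN
    exact binary g h .and (by simp) (hg (by omega)) (hh (by omega))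
  | or g h hg hh =>
    simp only [QF.enc, List.length_cons, List.length_append] at hN
    exact binary g h .or (by simp) (hg (by omega)) (hh (by omega))
  | imp g h hg hh =>
    simp only [QF.enc, List.length_cons, List.length_append] at hN
    exact binary g h .imp (by simp) (hg (by omega)) (hh (by omega))

theorem Moves.qf {pend : ρ} (hab : a ≠ b) (ha : a ≠ pend) (hb : b ≠ pend) {k : ℕ} (f : QF k)
    (hN : f.enc.length ≤ N) : Moves N (.mvQF a b pend) a b f.enc := by
  intro s v hs
  -- The token `endList` under the counter stops the loop, whatever `pend` held before.
  have h1 := chain_qfStep (N := N) hab ha hb f hN (s⟦pend ↦ .item :: .endList :: s pend⟧) v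
    (.endList :: s pend) (by rw [Function.update_of_ne ha, hs]) (by simp)
  have h2 : Exec N (.loop pend pend (tokTest .item) (.qfStep a b pend))
      (s⟦pend ↦ .endList :: s pend⟧⟦pend ↦ .item :: s⟦pend ↦ .endList :: s pend⟧ pend⟧)
      (s⟦a ↦ v⟧⟦b ↦ f.enc.reverse ++ s b⟧⟦pend ↦ .endList :: s pend⟧) := by
    refine ⟨by simp [testVal, tokTest], f.size, f.size_le.trans hN, ?_⟩
    convert h1 using 1
    · simp
    · funext r
      simp only [Function.update_apply]
      grind
  refine ((Exec.push _ _ _).seq ((Exec.push _ _ _).seq (h2.seq (Exec.pop _ _)))).to ?_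
  funext r
  simp only [Function.update_apply]
  grind

/-! ### Moving the codes of the other parts of the input -/

def Prog.mvUAtom (a b : ρ) : Prog ρ := .mv a b ;; .mvThru .endNum a b

def Prog.mvInt (a b : ρ) : Prog ρ := .mv a b ;; .mvThru .endNum a b

def Prog.mvCmp (a b : ρ) : Prog ρ :=
  .ite a a (fun o _ => o == some .modEq || o == some .notModEq)
    (.mv a b ;; .mvThru .endNum a b) (.mv a b)

def Prog.mvLP (a b : ρ) : Prog ρ :=
  .mvList (.mvInt a b ;; .mvThru .endNum a b) a b ;; .mvCmp a b ;; .mvInt a b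

def Prog.mvGuarded (a b pend : ρ) : Prog ρ :=
  .mvList (.mvThru .endNum a b ;; .mvQF a b pend) a b

def Prog.mvCounting (a b : ρ) : Prog ρ := .mvList (.mvUAtom a b ;; .mvLP a b) a b

def Prog.mvSet (a b : ρ) : Prog ρ := .mvList (.mvThru .endNum a b) a b

def Prog.mvUnaryType (a b : ρ) : Prog ρ := .mvSet a b ;; .mvSet a b

def Prog.mvEdge (a b : ρ) : Prog ρ :=
  (.mvUnaryType a b ;; (.mvSet a b ;; .mvSet a b)) ;; .mvUnaryType a b

theorem length_le_encList {α : Type} (f : α → List Tok) (l : List α) :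
    l.length ≤ (encList f l).length := by
  induction l with
  | nil => simp
  | cons x l ih => simp [encList] at ih ⊢; omega

theorem length_le_encList_of_mem {α : Type} (f : α → List Tok) {l : List α} {x : α} (h : x ∈ l) :
    (f x).length ≤ (encList f l).length := by
  induction l with
  | nil => simp at h
  | cons y l ih =>
    rcases List.mem_cons.1 h with rfl | h
    · simp [encList]; omega
    · have := ih h
      simp [encList] at this ⊢; omega

theorem Moves.list' (hab : a ≠ b) {α : Type} {p : Prog ρ} {f : α → List Tok} {l : List α}
    (hN : (encList f l).length ≤ N) (h : ∀ x, (f x).length ≤ N → Moves N p a b (f x)) :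
    Moves N (.mvList p a b) a b (encList f l) :=
  Moves.list hab (fun x hx => h x ((length_le_encList_of_mem f hx).trans hN))
    ((length_le_encList f l).trans hN)

theorem Moves.uatom (hab : a ≠ b) (q : UAtom) (hN : q.enc.length ≤ N) :
    Moves N (.mvUAtom a b) a b q.enc := by
  cases q with
  | pred i => exact Moves.cons hab _ (Moves.nat hab i (by simp [UAtom.enc] at hN; omega))
  | loop j => exact Moves.cons hab _ (Moves.nat hab j (by simp [UAtom.enc] at hN; omega))

theorem Moves.cmp (hab : a ≠ b) (c : Cmp) (hN : c.enc.length ≤ N) :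
    Moves N (.mvCmp a b) a b c.enc := by
  intro s v hs
  cases c with
  | modEq d =>
    exact Exec.ite_pos (by simp [testVal, hs, Cmp.enc])
      (Moves.cons hab _ (Moves.nat hab d (by simp [Cmp.enc] at hN; omega)) s v hs)
  | notModEq d =>
    exact Exec.ite_pos (by simp [testVal, hs, Cmp.enc])
      (Moves.cons hab _ (Moves.nat hab d (by simp [Cmp.enc] at hN; omega)) s v hs)
  | _ => exact Exec.ite_neg (by simp [testVal, hs, Cmp.enc]) (Moves.mv hab _ s v hs)

theorem Moves.lp (hab : a ≠ b) (P : LP) (hN : P.enc.length ≤ N) :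
    Moves N (.mvLP a b) a b P.enc := by
  simp only [LP.enc, List.length_append] at hN
  rw [LP.enc, List.append_assoc]
  refine Moves.seq hab (Moves.list' hab (by omega) fun x hx => ?_)
    (Moves.seq hab (Moves.cmp hab _ (by omega)) (Moves.int hab _ (by omega)))
  simp only [List.length_append] at hx
  exact Moves.seq hab (Moves.int hab _ (by omega)) (Moves.nat hab _ (by omega))

theorem Moves.guarded {pend : ρ} (hab : a ≠ b) (ha : a ≠ pend) (hb : b ≠ pend)
    (l : List (ℕ × QF 2)) (hN : (encList (fun c => encNat c.1 ++ c.2.enc) l).length ≤ N) :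
    Moves N (.mvGuarded a b pend) a b (encList (fun c => encNat c.1 ++ c.2.enc) l) := by
  refine Moves.list' hab hN fun x hx => ?_
  simp only [List.length_append] at hx
  exact Moves.seq hab (Moves.nat hab _ (by omega)) (Moves.qf hab ha hb _ (by omega))

theorem Moves.counting (hab : a ≠ b) (l : List (UAtom × LP))
    (hN : (encList (fun c => c.1.enc ++ c.2.enc) l).length ≤ N) :
    Moves N (.mvCounting a b) a b (encList (fun c => c.1.enc ++ c.2.enc) l) := by
  refine Moves.list' hab hN fun x hx => ?_
  simp only [List.length_append] at hx
  exact Moves.seq hab (Moves.uatom hab _ (by omega)) (Moves.lp hab _ (by omega))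

theorem Moves.set (hab : a ≠ b) (t : Finset ℕ) (hN : (encSet t).length ≤ N) :
    Moves N (.mvSet a b) a b (encSet t) :=
  Moves.list' hab hN fun x hx => Moves.nat hab x hx

theorem Moves.unaryType (hab : a ≠ b) {Ψ : Sentence} (π : UnaryType Ψ)
    (hN : (encUnaryType π).length ≤ N) : Moves N (.mvUnaryType a b) a b (encUnaryType π) := by
  simp only [encUnaryType, List.length_append] at hN
  exact Moves.seq hab (Moves.set hab _ (by omega)) (Moves.set hab _ (by omega))

theorem Moves.edge (hab : a ≠ b) {Ψ : Sentence} (e : Edge Ψ)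
    (hN : (encEdge e).length ≤ N) : Moves N (.mvEdge a b) a b (encEdge e) := by
  simp only [encEdge, List.length_append] at hN
  exact Moves.seq hab (Moves.seq hab (Moves.unaryType hab _ (by omega))
    (Moves.seq hab (Moves.set hab _ (by omega)) (Moves.set hab _ (by omega))))
    (Moves.unaryType hab _ (by omega))

end Basic

/-! ### The registers of the decision procedure -/

/-- `cn`, `es`, `pp`, `he` hold the conjuncts, the edges, the source type and the symbols `R` with
`R(x,y)` in the label of the given edge. `opt` holds these sets of symbols for the edges from the
source, `wds` and `wds2` hold lists of words, `x` the current word, and `fuel` a unary count of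
rounds. During the evaluation of a conjunct, `c` is its unread part, `pos` and `neg` are unary
accumulators, `cm` is the comparison, `dd` the modulus and `ee` the remainder. `act`, `no`, `bad`
and `res` carry verdicts. Most of the other registers are scratch space. -/
inductive Reg : Type where
  | inp | fuel | fuel2 | cn | es | pp | he | opt | oo | wds | wds2
  | x | xx | y | k | kk | m | fl | c | u | pw | sg | cm | dd | ee | pos | neg
  | act | no | bad | res | t | t1 | pend | j
  deriving DecidableEq

instance : Fintype Reg where
  elems := {.inp, .fuel, .fuel2, .cn, .es, .pp, .he, .opt, .oo, .wds, .wds2, .x, .xx, .y, .k, .kk,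
    .m, .fl, .c, .u, .pw, .sg, .cm, .dd, .ee, .pos, .neg, .act, .no, .bad, .res, .t, .t1, .pend, .j}
  complete r := by cases r <;> decide

/-! ### Comparing strings, membership in a coded set, and binary to unary conversion -/

section

variable {N : ℕ}

/-- Test for two registers with the same token on top. -/
def sameTest (o p : Option Tok) : Bool := o.isSome && o == p

/-- Test for two empty registers. -/
def bothNoneTest (o o' : Option Tok) : Bool := o.isNone && o'.isNone

/-- Test for two non-empty registers. -/
def bothSomeTest (o o' : Option Tok) : Bool := o.isSome && o'.isSome

/-- This is the equality test for strings: after the common prefix is stripped, the strings were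
equal exactly if nothing is left on either side. About the remainders only emptiness and length are
needed later. -/
theorem exec_stripCommon {ρ : Type} [DecidableEq ρ] {a b : ρ} (hab : a ≠ b) :
    ∀ (s : Store ρ), (s a).length ≤ N → ∃ u v : List Tok,
      (u = [] ∧ v = [] ↔ s a = s b) ∧ u.length ≤ (s a).length ∧ v.length ≤ (s b).length ∧
      Exec N (.loop a b sameTest (.pop a ;; .pop b)) s s⟦a ↦ u⟧⟦b ↦ v⟧ := by
  have key : ∀ (l : List Tok) (s : Store ρ), s a = l → ∃ u v : List Tok,
      (u = [] ∧ v = [] ↔ s a = s b) ∧ u.length ≤ (s a).length ∧ v.length ≤ (s b).length ∧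
      ¬ (sameTest u.head? v.head? = true) ∧ ∃ k ≤ (s a).length,
      Chain (fun s m => testVal a b sameTest s = true ∧ Exec N (.pop a ;; .pop b) s m) k s
        s⟦a ↦ u⟧⟦b ↦ v⟧ := by
    intro l
    induction l with
    | nil =>
      intro s hs
      refine ⟨[], s b, by simp [hs, eq_comm], by simp, le_rfl, by simp [sameTest], 0, by simp, ?_⟩
      change _ = _
      rw [← hs]; simp
    | cons x l ih =>
      intro s hs
      by_cases hx : (s b).head? = some x
      · obtain ⟨w, hw⟩ : ∃ w, s b = x :: w := List.head?_eq_some_iff.1 hx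
        obtain ⟨u, v, h1, h2, h3, h4, k, hk, h5⟩ := ih s⟦a ↦ l⟧⟦b ↦ w⟧ (by simp [hab])
        simp only [Function.update_self, Function.update_of_ne hab] at h1 h2 h3 hk
        refine ⟨u, v, by rw [h1, hs, hw]; simp, by rw [hs, List.length_cons]; omega,
          by rw [hw, List.length_cons]; omega, h4, k + 1, by rw [hs, List.length_cons]; omega,
          s⟦a ↦ l⟧⟦b ↦ w⟧, ⟨by simp [testVal, sameTest, hs, hw], ?_⟩, h5.to ?_⟩
        · refine ((Exec.pop _ _).seq (Exec.pop _ _)).to ?_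
          funext r
          simp only [Function.update_apply]
          grind
        · funext r
          simp only [Function.update_apply]
          grind
      · refine ⟨x :: l, s b, ?_, by simp [hs], le_rfl, ?_, 0, by simp, ?_⟩
        · rw [hs]
          constructor
          · simp
          · intro h; rw [← h] at hx; simp at hx
        · simp only [sameTest, List.head?_cons, Option.isSome_some, Bool.true_and, beq_iff_eq]
          exact fun h => hx h.symm
        · change _ = _
          rw [← hs]; simp
  intro s hN
  obtain ⟨u, v, h1, h2, h3, h4, k, hk, h5⟩ := key _ s rfl
  refine ⟨u, v, h1, h2, h3, ?_, k, hk.trans hN, h5⟩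
  simpa [testVal, Function.update_of_ne hab] using h4

/-- Take a set off the register `a` and test whether it contains the number in `k`. -/
def memTest (a : Reg) : Prog Reg :=
  .loop a a (tokTest .item)
    (.pop a ;; .mvUntil .endNum a .m ;; .copy .k .kk .t ;;
      .loop .m .kk sameTest (.pop .m ;; .pop .kk) ;;
      .ite .m .kk bothNoneTest (.push .fl .top) .skip ;; .clear .m ;; .clear .kk) ;;
  .pop a

/-- The binary digits of a number, the most significant one first. -/
def revBits (n : ℕ) : List Tok := (n.bits.map Tok.bit).reverse

theorem revBits_injective : Function.Injective revBits := by
  intro a b h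
  have h1 : a.bits = b.bits :=
    List.map_injective_iff.2 (fun _ _ h => Tok.bit.inj h) (List.reverse_injective h)
  have h2 := congrArg (fun l => Nat.ofDigits 2 (l.map fun b => cond b 1 0)) h1
  simpa only [← Nat.digits_two_eq_bits, Nat.ofDigits_digits] using h2

theorem length_revBits_le (n : ℕ) : (revBits n).length ≤ (encNat n).length := by
  simp [revBits, encNat]

theorem exec_memTest {a : Reg} (ha : a = .y ∨ a = .xx) {s : Store Reg} {T : Finset ℕ} {n : ℕ}
    {v : List Tok} (hs : s a = encSet T ++ v) (hk : s .k = revBits n) (hm : s .m = [])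
    (hkk : s .kk = []) (ht : s .t = []) (hN : (encSet T).length ≤ N) (hN' : (encNat n).length ≤ N) :
    Exec N (memTest a) s s⟦a ↦ v⟧⟦.fl ↦ (if n ∈ T then [.top] else []) ++ s .fl⟧ := by
  have hkN := (length_revBits_le n).trans hN'
  have ham : a ≠ .m := by rcases ha with rfl | rfl <;> simp
  have hak : a ≠ .k := by rcases ha with rfl | rfl <;> simp
  have hat : a ≠ .t := by rcases ha with rfl | rfl <;> simp
  have hakk : a ≠ .kk := by rcases ha with rfl | rfl <;> simp
  have hafl : a ≠ .fl := by rcases ha with rfl | rfl <;> simp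
  obtain ⟨L, hL, hnd, hmem⟩ : ∃ L : List ℕ, encSet T = encList encNat L ∧ L.Nodup ∧
      ∀ i, i ∈ L ↔ i ∈ T := ⟨_, rfl, T.sort_nodup _, by simp⟩
  rw [hL] at hN hs
  have key := Exec.loop_of_list (N := N) (a := a) (b := a) (f := tokTest .item)
    (p := .pop a ;; .mvUntil .endNum a .m ;; .copy .k .kk .t ;;
      .loop .m .kk sameTest (.pop .m ;; .pop .kk) ;;
      .ite .m .kk bothNoneTest (.push .fl .top) .skip ;; .clear .m ;; .clear .kk)
    L (fun pre suf => s⟦a ↦ encList encNat suf ++ v⟧⟦.fl ↦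
      List.replicate (pre.count n) .top ++ s .fl⟧)
    ((length_le_encList encNat _).trans hN) ?_ ?_
  · rw [← hs] at key
    simp only [List.count_nil, List.replicate_zero, List.nil_append, Function.update_eq_self] at key
    refine (key.seq (Exec.pop _ _)).to ?_
    -- The loop leaves one token per occurrence of `n`; a set is listed without repetition, so there
    -- is at most one.
    have hc : List.replicate (L.count n) Tok.top = if n ∈ T then [.top] else [] := by
      by_cases h : n ∈ T
      · simp [h, List.count_eq_one_of_mem hnd ((hmem n).2 h)]
      · simp [h, List.count_eq_zero_of_not_mem (mt (hmem n).1 h)]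
    rw [hc]
    funext r
    simp only [Function.update_apply, encList]
    grind
  · intro pre i suf e
    have hiN : (encNat i).length ≤ N :=
      (length_le_encList_of_mem encNat (l := L) (by simp [e])).trans hN
    refine ⟨by simp [testVal, tokTest, encList, hafl], ?_⟩
    set s0 := s⟦a ↦ encList encNat (i :: suf) ++ v⟧⟦.fl ↦
      List.replicate (pre.count n) .top ++ s .fl⟧ with hs0
    have hfl0 : s0 .fl = List.replicate (pre.count n) .top ++ s .fl := by simp [hs0]
    have hm0 : s0 .m = [] := by simp [hs0, hm, ham.symm]
    have hkk0 : s0 .kk = [] := by simp [hs0, hkk, hakk.symm]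
    refine Exec.seq (m := s0⟦a ↦ (i.bits.map Tok.bit ++ .endNum :: (encList encNat suf ++ v))⟧)
      ((Exec.pop _ _).to (by simp [hs0, encList, hafl, encNat])) ?_
    refine Exec.seq (m := s0⟦a ↦ encList encNat suf ++ v⟧⟦.m ↦ revBits i⟧)
      ((exec_mvUntil ham (t := .endNum) (u := i.bits.map Tok.bit) (v := encList encNat suf ++ v)
        (by simp) (endNum_notMem_bits i) (by simp [encNat] at hiN ⊢; omega)).to ?_) ?_
    · funext r
      simp only [Function.update_apply, revBits]
      grind
    refine Exec.seq (m := s0⟦a ↦ encList encNat suf ++ v⟧⟦.m ↦ revBits i⟧⟦.kk ↦ revBits n⟧)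
      ((exec_copy (by simp) (by simp) (by simp) ?_ ?_).to ?_) ?_
    · simp [hs0, ht, hat.symm]
    · simpa [hs0, hk, hak.symm] using hkN
    · simp [hs0, hk, hak.symm, hkk, hakk.symm]
    obtain ⟨u, w, h1, h2, h3, h4⟩ := exec_stripCommon (N := N) (a := Reg.m) (b := .kk) (by simp)
      s0⟦a ↦ encList encNat suf ++ v⟧⟦.m ↦ revBits i⟧⟦.kk ↦ revBits n⟧
      (by simpa using (length_revBits_le i).trans hiN)
    simp only [Function.update_self, ne_eq, reduceCtorEq, not_false_eq_true,
      Function.update_of_ne] at h1 h2 h3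
    rw [revBits_injective.eq_iff] at h1
    have hu : u.length ≤ N := h2.trans ((length_revBits_le i).trans hiN)
    have hw : w.length ≤ N := h3.trans hkN
    refine h4.seq (Exec.seq (m := s0⟦a ↦ encList encNat suf ++ v⟧⟦.m ↦ u⟧⟦.kk ↦ w⟧⟦.fl ↦
      List.replicate ((pre ++ [i]).count n) .top ++ s .fl⟧) ?_ ?_)
    · by_cases hin : i = n
      · obtain ⟨rfl, rfl⟩ := h1.2 hin
        refine Exec.ite_pos (by simp [testVal, bothNoneTest]) ((Exec.push _ _ _).to ?_)
        subst hin
        simp only [List.count_append, List.count_singleton_self]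
        funext r
        simp only [Function.update_apply]
        grind
      · refine Exec.ite_neg ?_ ((Exec.skip _).to ?_)
        · have := mt h1.1 hin
          simp only [testVal, bothNoneTest]
          cases u <;> cases w <;> simp_all
        · rw [List.count_append, List.count_singleton, if_neg (by simpa using hin), add_zero]
          funext r
          simp only [Function.update_apply]
          grind
    · refine ((exec_clear ?_).seq (exec_clear ?_)).to ?_
      · simpa using hu
      · simpa using hw
      · funext r
        simp only [Function.update_apply]
        grind
  · simp [testVal, tokTest, encList, hafl]

/-- Take a number off `c` and add it, in unary, to `dst`. -/
def toUnary (dst : Reg) : Prog Reg :=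
  .push .pw .top ;;
  .loop .c .c (fun o _ => o == some (.bit true) || o == some (.bit false))
    (.ite .c .c (tokTest (.bit true)) (.copy .pw dst .t) .skip ;;
      .copy .pw .t1 .t ;; .mvAll .t1 .pw ;; .pop .c) ;;
  .pop .c ;; .clear .pw

/-- The number with the given binary digits. -/
def bitsVal (l : List Bool) : ℕ := Nat.ofDigits 2 (l.map fun b => cond b 1 0)

theorem bitsVal_bits (n : ℕ) : bitsVal n.bits = n := by
  rw [bitsVal, ← Nat.digits_two_eq_bits, Nat.ofDigits_digits]

theorem bitsVal_concat (l : List Bool) (b : Bool) :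
    bitsVal (l ++ [b]) = (if b then 2 ^ l.length else 0) + bitsVal l := by
  cases b <;> simp [bitsVal, Nat.ofDigits_append, add_comm]

/-- The conversion to unary keeps the current power of two in `pw` and doubles it after the last
digit too. This bound is the origin of the hypotheses `2 * n + 1 ≤ N`. -/
theorem two_pow_length_bits_le (n : ℕ) : 2 ^ n.bits.length ≤ 2 * n + 1 := by
  have := Nat.lt_size_self n
  rw [Nat.size_eq_bits_len]
  rcases Nat.eq_zero_or_pos n with rfl | h
  · simp
  · have h1 : n.size - 1 < n.size := by
      have := Nat.size_pos.2 h
      omega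
    have := Nat.lt_size.1 h1
    have h2 : 2 ^ n.size = 2 * 2 ^ (n.size - 1) := by
      rw [← pow_succ']; congr 1; omega
    omega

theorem exec_toUnary {dst : Reg} (hu : dst ∉ ([.c, .pw, .t, .t1] : List Reg)) {s : Store Reg} {n : ℕ}
    {v : List Tok} (hs : s .c = encNat n ++ v) (hpw : s .pw = []) (ht : s .t = [])
    (ht1 : s .t1 = []) (hN : 2 * n + 1 ≤ N) (hN' : (encNat n).length ≤ N) :
    Exec N (toUnary dst) s s⟦.c ↦ v⟧⟦dst ↦ List.replicate n .top ++ s dst⟧ := by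
  simp only [List.mem_cons, List.not_mem_nil, or_false, not_or] at hu
  obtain ⟨huc, hupw, hut, hut1⟩ := hu
  -- Digits come least significant first: after the digits `pre`, `pw` holds the weight of the next
  -- digit and `dst` has received the value of `pre`.
  have key := Exec.loop_of_list (N := N) (a := Reg.c) (b := .c)
    (f := fun o _ => o == some (.bit true) || o == some (.bit false))
    (p := .ite .c .c (tokTest (.bit true)) (.copy .pw dst .t) .skip ;;
      .copy .pw .t1 .t ;; .mvAll .t1 .pw ;; .pop .c)
    n.bits (fun pre suf => s⟦.c ↦ suf.map Tok.bit ++ .endNum :: v⟧⟦.pw ↦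
      List.replicate (2 ^ pre.length) .top⟧⟦dst ↦ List.replicate (bitsVal pre) .top ++ s dst⟧)
    (by simp [encNat] at hN' ⊢; omega) ?_ ?_
  · refine (Exec.seq ((Exec.push _ _ _).to ?_) (key.seq ((Exec.pop _ _).seq (exec_clear ?_)))).to ?_
    · funext r
      simp only [Function.update_apply, encNat, bitsVal] at hs ⊢
      simp
      grind
    · have := two_pow_length_bits_le n
      simp [Function.update_of_ne (Ne.symm hupw)]
      omega
    · rw [bitsVal_bits]
      funext r
      simp only [Function.update_apply]
      grind
  · intro pre b suf e
    refine ⟨by cases b <;> simp [testVal, Ne.symm huc], ?_⟩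
    have hp : 2 ^ pre.length ≤ N := by
      have h1 := two_pow_length_bits_le n
      have h2 : 2 ^ pre.length ≤ 2 ^ n.bits.length := Nat.pow_le_pow_right (by omega) (by simp [e])
      omega
    refine Exec.seq (m := s⟦.c ↦ (b :: suf).map Tok.bit ++ .endNum :: v⟧⟦.pw ↦
      List.replicate (2 ^ pre.length) .top⟧⟦dst ↦
        List.replicate (bitsVal (pre ++ [b])) .top ++ s dst⟧) ?_ ?_
    · cases b with
      | true =>
        refine Exec.ite_pos (by simp [testVal, tokTest, Ne.symm huc]) ((exec_copy ?_ ?_ ?_ ?_ ?_).to ?_)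
        · exact Ne.symm hupw
        · simp
        · exact hut
        · simp [Ne.symm hut, ht]
        · simpa [Ne.symm hupw] using hp
        · rw [bitsVal_concat, if_pos rfl, ← List.replicate_append_replicate]
          funext r
          simp only [Function.update_apply]
          grind
      | false =>
        refine Exec.ite_neg (by simp [testVal, tokTest, Ne.symm huc]) ((Exec.skip _).to ?_)
        rw [bitsVal_concat]
        simp
    · refine ((exec_copy (by simp) (by simp) (by simp) ?_ ?_).seq
        ((exec_mvAll (by simp) ?_).seq (Exec.pop _ _))).to ?_
      · simp [Ne.symm hut, ht]
      · simpa [Ne.symm hupw] using hp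
      · simpa [Ne.symm hupw, Ne.symm hut1, ht1] using hp
      · simp only [List.length_append, List.length_singleton, pow_succ, mul_two,
          ← List.replicate_append_replicate]
        funext r
        simp only [Function.update_apply]
        grind
  · simp [testVal, Ne.symm huc]

end

section

variable {N : ℕ}

/-! ### Evaluating a constraint -/

/-- Take an atom `q(x)` off `c` and put a token on `act` if it belongs to the type in `pp`. -/
def atomTest : Prog Reg :=
  .copy .pp .y .t ;; .ite .c .c (tokTest .un) .skip (.mvSet .y .j ;; .clear .j) ;; .pop .c ;;
  .mvUntil .endNum .c .k ;; memTest .y ;; .clear .y ;; .clear .k ;; .mvAll .fl .act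

theorem exec_atomTest {Ψ : Sentence} {π : UnaryType Ψ} {q : UAtom} {s : Store Reg} {v : List Tok}
    (hpp : s .pp = encUnaryType π) (hc : s .c = q.enc ++ v) (ht : s .t = []) (hy : s .y = [])
    (hj : s .j = []) (hk : s .k = []) (hm : s .m = []) (hkk : s .kk = []) (hfl : s .fl = [])
    (hact : s .act = []) (hN : (encUnaryType π).length ≤ N) (hN' : q.enc.length ≤ N) :
    Exec N atomTest s s⟦.c ↦ v⟧⟦.act ↦ if q.Mem π then [.top] else []⟧ := by
  have hN1 : 1 ≤ N := by
    refine le_trans ?_ hN'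
    cases q <;> simp [UAtom.enc]
  -- Common end of both cases. The relevant set is on top of `y`: the first set of the type for
  -- `P(x)`, and the second one, after the first has been discarded, for `R(x,x)`.
  have aux : ∀ (tk : Tok) (n : ℕ) (A : Finset ℕ) (w : List Tok), s .c = tk :: (encNat n ++ v) →
      (encSet A ++ w).length ≤ N → (encNat n).length ≤ N →
      Exec N (.pop .c ;; .mvUntil .endNum .c .k ;; memTest .y ;; .clear .y ;; .clear .k ;;
        .mvAll .fl .act) s⟦.y ↦ encSet A ++ w⟧
        s⟦.c ↦ v⟧⟦.act ↦ if n ∈ A then [.top] else []⟧ := by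
    intro tk n A w hc hA hn
    rw [List.length_append] at hA
    refine Exec.seq (m := s⟦.y ↦ encSet A ++ w⟧⟦.c ↦ encNat n ++ v⟧)
      ((Exec.pop _ _).to (by simp [hc])) ?_
    refine Exec.seq (m := s⟦.y ↦ encSet A ++ w⟧⟦.c ↦ v⟧⟦.k ↦ revBits n⟧)
      ((exec_mvUntil (by simp) (u := n.bits.map Tok.bit) (v := v)
        (by simp [encNat]) (endNum_notMem_bits n) (by simp [encNat] at hn ⊢; omega)).to ?_) ?_
    · simp [hk, revBits]
    refine Exec.seq ((exec_memTest (T := A) (n := n) (v := w) (.inl rfl) (by simp) (by simp)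
      (by simp [hm]) (by simp [hkk]) (by simp [ht]) (by omega) hn).to rfl) ?_
    refine ((exec_clear ?_).seq ((exec_clear ?_).seq (exec_mvAll (by simp) ?_))).to ?_
    · simp; omega
    · simpa using (length_revBits_le n).trans hn
    · by_cases h : n ∈ A
      · simpa [h, hfl] using hN1
      · simp [h, hfl]
    · funext r
      simp only [Function.update_apply]
      by_cases h : n ∈ A <;> simp only [h, if_true, if_false] <;> grind
  refine Exec.seq (m := s⟦.y ↦ encUnaryType π⟧)
    ((exec_copy (by simp) (by simp) (by simp) ht (by rwa [hpp])).to (by rw [hpp, hy]; simp)) ?_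
  cases q with
  | pred i =>
    have h := aux .un i π.1.1 (encSet π.2.1) (by simpa [UAtom.enc] using hc)
      (by simpa [encUnaryType] using hN) (by simp [UAtom.enc] at hN'; omega)
    exact Exec.seq (Exec.ite_pos (by simp [testVal, tokTest, hc, UAtom.enc]) (Exec.skip _)) h
  | loop i =>
    have hN2 := hN
    simp only [encUnaryType, List.length_append] at hN2
    have h := aux .bin i π.2.1 [] (by simpa [UAtom.enc] using hc)
      (by simp; omega) (by simp [UAtom.enc] at hN'; omega)
    rw [List.append_nil] at h
    refine Exec.seq (Exec.ite_neg (by simp [testVal, tokTest, hc, UAtom.enc]) ?_) h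
    refine ((Moves.set (by simp) π.1.1 (by omega) _ (encSet π.2.1)
      (by simp [encUnaryType])).seq (exec_clear ?_)).to ?_
    · simp [hj]; omega
    · funext r
      simp only [Function.update_apply]
      grind

/-- The string of a list of sets. -/
def wordStr (w : List (Finset ℕ)) : List Tok := w.flatMap encSet

theorem length_encSet_pos (A : Finset ℕ) : 0 < (encSet A).length := by simp [encSet, encList]

theorem length_le_wordStr (w : List (Finset ℕ)) : w.length ≤ (wordStr w).length := by
  induction w with
  | nil => simp
  | cons A w ih =>
    have := length_encSet_pos A
    simp only [wordStr, List.flatMap_cons, List.length_append, List.length_cons] at ih ⊢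
    omega

theorem length_encSet_le_wordStr {w : List (Finset ℕ)} {A : Finset ℕ} (h : A ∈ w) :
    (encSet A).length ≤ (wordStr w).length := by
  induction w with
  | nil => simp at h
  | cons B w ih =>
    simp only [wordStr, List.flatMap_cons, List.length_append] at ih ⊢
    rcases List.mem_cons.1 h with rfl | h
    · omega
    · have := ih h; omega

/-- Take `λ` and `R` off `c`, and for each set in `x` that contains `R` add `λ` to `pos - neg`. -/
def termProg : Prog Reg :=
  .mv .c .sg ;; toUnary .u ;; .mvUntil .endNum .c .k ;; .copy .x .xx .t ;;
  .loop .xx .xx isSomeTest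
    (memTest .xx ;;
      .ite .fl .fl isSomeTest
        (.pop .fl ;; .ite .sg .sg (tokTest .neg) (.copy .u .neg .t) (.copy .u .pos .t)) .skip) ;;
  .clear .u ;; .clear .k ;; .pop .sg

/-- The registers that are empty between the parts of the evaluation of a constraint. -/
structure EvalIdle (s : Store Reg) : Prop where
  t : s .t = []
  t1 : s .t1 = []
  pw : s .pw = []
  u : s .u = []
  k : s .k = []
  m : s .m = []
  kk : s .kk = []
  fl : s .fl = []
  xx : s .xx = []
  sg : s .sg = []
  y : s .y = []
  j : s .j = []

theorem exec_termProg {a : ℤ} {n : ℕ} {w : List (Finset ℕ)} {s : Store Reg} {v : List Tok}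
    (hs : EvalIdle s) (hx : s .x = wordStr w) (hc : s .c = encInt a ++ encNat n ++ v)
    (hN : 2 * a.natAbs + 1 ≤ N) (hN₁ : (encInt a ++ encNat n).length ≤ N)
    (hN₂ : (wordStr w).length ≤ N) :
    Exec N termProg s s⟦.c ↦ v⟧⟦.pos ↦
      List.replicate (w.countP (n ∈ ·) * a.toNat) .top ++ s .pos⟧⟦.neg ↦
      List.replicate (w.countP (n ∈ ·) * (-a).toNat) .top ++ s .neg⟧ := by
  obtain ⟨sgn, hsgn⟩ : ∃ sgn : Tok, sgn = if a < 0 then .neg else .pos := ⟨_, rfl⟩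
  rw [encInt, ← hsgn] at hc hN₁
  simp only [List.length_append, List.length_cons] at hN₁
  refine Exec.seq (m := s⟦.c ↦ encNat a.natAbs ++ (encNat n ++ v)⟧⟦.sg ↦ [sgn]⟧)
    ((exec_mv (by simp) (t := sgn) (v := encNat a.natAbs ++ (encNat n ++ v))
      (by simpa using hc)).to (by simp [hs.sg])) ?_
  refine Exec.seq (m := s⟦.c ↦ encNat n ++ v⟧⟦.sg ↦ [sgn]⟧⟦.u ↦
      List.replicate a.natAbs .top⟧)
    ((exec_toUnary (by simp) (n := a.natAbs) (v := encNat n ++ v) (by simp) (by simp [hs.pw])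
      (by simp [hs.t]) (by simp [hs.t1]) hN (by omega)).to ?_) ?_
  · have := hs.u
    funext r
    simp only [Function.update_apply]
    grind
  refine Exec.seq (m := s⟦.c ↦ v⟧⟦.sg ↦ [sgn]⟧⟦.u ↦ List.replicate a.natAbs .top⟧⟦.k ↦ revBits n⟧)
      ((exec_mvUntil (by simp) (u := n.bits.map Tok.bit) (v := v)
        (by simp [encNat]) (endNum_notMem_bits n) (by simp [encNat] at hN₁ ⊢; omega)).to ?_) ?_
  · have := hs.k
    funext r
    simp only [Function.update_apply, revBits]
    grind
  set s0 := s⟦.c ↦ v⟧⟦.sg ↦ [sgn]⟧⟦.u ↦ List.replicate a.natAbs .top⟧⟦.k ↦ revBits n⟧ with hs0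
  refine Exec.seq (m := s0⟦.xx ↦ wordStr w⟧) ((exec_copy (by simp) (by simp) (by simp) ?_ ?_).to ?_) ?_
  · simp [hs0, hs.t]
  · simpa [hs0, hx] using hN₂
  · simp [hs0, hx, hs.xx]
  -- Unary counters cannot be negative, so positive and negative coefficients are accumulated
  -- separately. For a given `a` one of `a.toNat` and `(-a).toNat` is `0`, and the formula covers
  -- both signs.
  have key := Exec.loop_of_list (N := N) (a := Reg.xx) (b := .xx) (f := isSomeTest)
    (p := memTest .xx ;; .ite .fl .fl isSomeTest
        (.pop .fl ;; .ite .sg .sg (tokTest .neg) (.copy .u .neg .t) (.copy .u .pos .t)) .skip)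
    w (fun pre suf => s0⟦.xx ↦ wordStr suf⟧⟦.pos ↦
      List.replicate (pre.countP (n ∈ ·) * a.toNat) .top ++ s .pos⟧⟦.neg ↦
      List.replicate (pre.countP (n ∈ ·) * (-a).toNat) .top ++ s .neg⟧)
    ((length_le_wordStr w).trans hN₂) ?_ ?_
  · have e : s0⟦.xx ↦ wordStr w⟧⟦.pos ↦
        List.replicate (([] : List (Finset ℕ)).countP (n ∈ ·) * a.toNat) .top ++ s .pos⟧⟦.neg ↦
        List.replicate (([] : List (Finset ℕ)).countP (n ∈ ·) * (-a).toNat) .top ++ s .neg⟧ =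
        s0⟦.xx ↦ wordStr w⟧ := by
      funext r
      simp only [Function.update_apply, hs0, List.countP_nil, zero_mul, List.replicate_zero,
        List.nil_append]
      grind
    rw [e] at key
    refine (key.seq ((exec_clear ?_).seq ((exec_clear ?_).seq (Exec.pop _ _)))).to ?_
    · simp [hs0]; omega
    · simpa [hs0] using (length_revBits_le n).trans (by omega)
    · obtain ⟨h1, h2, h3, h4, h5, h6, h7, h8, h9, h10⟩ := hs
      funext r
      simp only [Function.update_apply, hs0, wordStr, List.flatMap_nil]
      grind
  · intro pre A suf e
    have hA : A ∈ w := by simp [e]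
    have hp := length_encSet_pos A
    have hd : wordStr (A :: suf) = encSet A ++ wordStr suf := rfl
    refine ⟨?_, ?_⟩
    · simp only [testVal, isSomeTest, ne_eq, reduceCtorEq, not_false_eq_true,
        Function.update_of_ne, Function.update_self, List.isSome_head?]
      rw [hd]
      cases h : encSet A with
      | nil => simp [h] at hp
      | cons => simp
    · set s1 := s0⟦.xx ↦ wordStr (A :: suf)⟧⟦.pos ↦
        List.replicate (pre.countP (n ∈ ·) * a.toNat) .top ++ s .pos⟧⟦.neg ↦
        List.replicate (pre.countP (n ∈ ·) * (-a).toNat) .top ++ s .neg⟧ with hs1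
      have hfl : s1 .fl = [] := by simp [hs1, hs0, hs.fl]
      have hsg : s1 .sg = [sgn] := by simp [hs1, hs0]
      have hu : s1 .u = List.replicate a.natAbs .top := by simp [hs1, hs0]
      have ht : s1 .t = [] := by simp [hs1, hs0, hs.t]
      have hpos : s1 .pos = List.replicate (pre.countP (n ∈ ·) * a.toNat) .top ++ s .pos := by
        simp [hs1]
      have hneg : s1 .neg = List.replicate (pre.countP (n ∈ ·) * (-a).toNat) .top ++ s .neg := by
        simp [hs1]
      refine Exec.seq ((exec_memTest (T := A) (n := n) (v := wordStr suf) (.inr rfl)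
        (by simp [hs1, wordStr]) (by simp [hs1, hs0]) (by simp [hs1, hs0, hs.m])
        (by simp [hs1, hs0, hs.kk]) ht
        ((length_encSet_le_wordStr hA).trans hN₂) (by omega)).to rfl) ?_
      by_cases hn : n ∈ A
      · refine Exec.ite_pos (by simp [testVal, isSomeTest, hn]) ?_
        refine Exec.seq (m := s1⟦.xx ↦ wordStr suf⟧) ((Exec.pop _ _).to ?_) ?_
        · funext r
          simp only [Function.update_apply, if_pos hn]
          grind
        · by_cases ha : a < 0
          · rw [if_pos ha] at hsgn
            refine Exec.ite_pos (by simp [testVal, tokTest, hsg, hsgn]) ((exec_copy ?_ ?_ ?_ ?_ ?_).to ?_)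
            · simp
            · simp
            · simp
            · simpa using ht
            · simp [hu]; omega
            · have h1 : a.toNat = 0 := by omega
              have h2 : (-a).toNat = a.natAbs := by omega
              have h3 : (pre ++ [A]).countP (n ∈ ·) * a.natAbs =
                a.natAbs + pre.countP (n ∈ ·) * a.natAbs := by simp [hn]; ring
              rw [h1, h2] at hs1
              rw [h1, h2, h3, ← List.replicate_append_replicate, hs1]
              rw [hs1] at hu
              funext r
              simp only [Function.update_apply] at hu ⊢
              grind
          · rw [if_neg ha] at hsgn
            refine Exec.ite_neg (by simp [testVal, tokTest, hsg, hsgn]) ((exec_copy ?_ ?_ ?_ ?_ ?_).to ?_)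
            · simp
            · simp
            · simp
            · simpa using ht
            · simp [hu]; omega
            · have h1 : a.toNat = a.natAbs := by omega
              have h2 : (-a).toNat = 0 := by omega
              have h3 : (pre ++ [A]).countP (n ∈ ·) * a.natAbs =
                a.natAbs + pre.countP (n ∈ ·) * a.natAbs := by simp [hn]; ring
              rw [h1, h2] at hs1
              rw [h1, h2, h3, ← List.replicate_append_replicate, hs1]
              rw [hs1] at hu
              funext r
              simp only [Function.update_apply] at hu ⊢
              grind
      · refine Exec.ite_neg (by simp [testVal, isSomeTest, hn, hfl]) ((Exec.skip _).to ?_)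
        have h3 : (pre ++ [A]).countP (n ∈ ·) = pre.countP (n ∈ ·) := by simp [hn]
        rw [h3, hs1]
        rw [hs1] at hfl
        funext r
        simp only [Function.update_apply, if_neg hn] at hfl ⊢
        grind
  · simp [testVal, isSomeTest, wordStr]

end

section

variable {N : ℕ}

def termsProg : Prog Reg :=
  .loop .c .c (tokTest .item) (.pop .c ;; termProg) ;; .pop .c

/-- The sum of the positive coefficients, each as often as it occurs. -/
def posSum (w : List (Finset ℕ)) (l : List (ℤ × ℕ)) : ℕ :=
  (l.map fun t => w.countP (t.2 ∈ ·) * t.1.toNat).sum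

/-- The sum of the absolute values of the negative coefficients, each as often as it occurs. -/
def negSum (w : List (Finset ℕ)) (l : List (ℤ × ℕ)) : ℕ :=
  (l.map fun t => w.countP (t.2 ∈ ·) * (-t.1).toNat).sum

theorem exec_termsProg {l : List (ℤ × ℕ)} {w : List (Finset ℕ)} {s : Store Reg} {v : List Tok}
    (hs : EvalIdle s) (hx : s .x = wordStr w)
    (hc : s .c = encList (fun t => encInt t.1 ++ encNat t.2) l ++ v)
    (hN : ∀ t ∈ l, 2 * t.1.natAbs + 1 ≤ N)
    (hN₁ : (encList (fun t : ℤ × ℕ => encInt t.1 ++ encNat t.2) l).length ≤ N)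
    (hN₂ : (wordStr w).length ≤ N) :
    Exec N termsProg s s⟦.c ↦ v⟧⟦.pos ↦ List.replicate (posSum w l) .top ++ s .pos⟧⟦.neg ↦
      List.replicate (negSum w l) .top ++ s .neg⟧ := by
  have key := Exec.loop_of_list (N := N) (a := Reg.c) (b := .c) (f := tokTest .item)
    (p := .pop .c ;; termProg) l
    (fun pre suf => s⟦.c ↦ encList (fun t => encInt t.1 ++ encNat t.2) suf ++ v⟧⟦.pos ↦
      List.replicate (posSum w pre) .top ++ s .pos⟧⟦.neg ↦
      List.replicate (negSum w pre) .top ++ s .neg⟧)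
    ((length_le_encList _ l).trans hN₁) ?_ ?_
  · have e : s⟦.c ↦ encList (fun t => encInt t.1 ++ encNat t.2) l ++ v⟧⟦.pos ↦
      List.replicate (posSum w []) .top ++ s .pos⟧⟦.neg ↦
      List.replicate (negSum w []) .top ++ s .neg⟧ = s := by
      rw [← hc]
      simp [posSum, negSum]
    rw [e] at key
    refine (key.seq (Exec.pop _ _)).to ?_
    funext r
    simp only [Function.update_apply, encList]
    grind
  · intro pre t suf e
    refine ⟨by simp [testVal, tokTest, encList], ?_⟩
    refine (Exec.seq ((Exec.pop _ _).to rfl) (exec_termProg (a := t.1) (n := t.2) (w := w)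
      (v := encList (fun t => encInt t.1 ++ encNat t.2) suf ++ v) ?_ ?_ ?_ ?_ ?_ hN₂)).to ?_
    · obtain ⟨h1, h2, h3, h4, h5, h6, h7, h8, h9, h10, h11, h12⟩ := hs
      constructor <;> simpa
    · simpa using hx
    · simp [encList]
    · exact hN t (by simp [e])
    · exact (length_le_encList_of_mem (fun t : ℤ × ℕ => encInt t.1 ++ encNat t.2) (l := l)
        (by simp [e])).trans hN₁
    · have h1 : posSum w (pre ++ [t]) = w.countP (t.2 ∈ ·) * t.1.toNat + posSum w pre := by
        simp [posSum, add_comm]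
      have h2 : negSum w (pre ++ [t]) = w.countP (t.2 ∈ ·) * (-t.1).toNat + negSum w pre := by
        simp [negSum, add_comm]
      rw [h1, h2, ← List.replicate_append_replicate, ← List.replicate_append_replicate]
      funext r
      simp only [Function.update_apply]
      grind
  · simp [testVal, tokTest, encList]

/-- The first token of the code of a comparison. -/
def Cmp.tok : Cmp → Tok
  | .eq => .eq
  | .ne => .ne
  | .le => .le
  | .ge => .ge
  | .lt => .lt
  | .gt => .gt
  | .modEq _ => .modEq
  | .notModEq _ => .notModEq

/-- Take the comparison and the right-hand side off `c`. -/
def rhsProg : Prog Reg :=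
  .mv .c .cm ;;
  .ite .cm .cm (fun o _ => o == some .modEq || o == some .notModEq) (toUnary .dd) .skip ;;
  .mv .c .sg ;; .ite .sg .sg (tokTest .neg) (toUnary .pos) (toUnary .neg) ;; .pop .sg

/-- The right-hand side goes to the accumulator of the opposite sign. From here on the question is
whether `pos ⊛ neg`. -/
theorem exec_rhsProg {r : Cmp} {a : ℤ} {s : Store Reg} {v : List Tok} (hs : EvalIdle s)
    (hc : s .c = r.enc ++ encInt a ++ v) (hcm : s .cm = []) (hdd : s .dd = [])
    (hN : 2 * a.natAbs + 1 ≤ N) (hN₁ : 2 * r.modulus + 1 ≤ N)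
    (hN₂ : (r.enc ++ encInt a).length ≤ N) :
    Exec N rhsProg s s⟦.c ↦ v⟧⟦.cm ↦ [r.tok]⟧⟦.dd ↦ List.replicate r.modulus .top⟧⟦.pos ↦
      List.replicate (-a).toNat .top ++ s .pos⟧⟦.neg ↦ List.replicate a.toNat .top ++ s .neg⟧ := by
  rw [List.length_append] at hN₂
  obtain ⟨h1, h2, h3, h4, h5, h6, h7, h8, h9, h10, h11, h12⟩ := hs
  have first : Exec N (.mv .c .cm ;;
      .ite .cm .cm (fun o _ => o == some .modEq || o == some .notModEq) (toUnary .dd) .skip) s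
      s⟦.c ↦ encInt a ++ v⟧⟦.cm ↦ [r.tok]⟧⟦.dd ↦ List.replicate r.modulus .top⟧ := by
    have hmod : ∀ (d : ℕ) (tk : Tok), (tk = .modEq ∨ tk = .notModEq) →
        s .c = tk :: (encNat d ++ (encInt a ++ v)) → 2 * d + 1 ≤ N → (encNat d).length ≤ N →
        Exec N (.mv .c .cm ;;
          .ite .cm .cm (fun o _ => o == some .modEq || o == some .notModEq) (toUnary .dd) .skip) s
          s⟦.c ↦ encInt a ++ v⟧⟦.cm ↦ [tk]⟧⟦.dd ↦ List.replicate d .top⟧ := by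
      intro d tk htk hc hd hd'
      refine Exec.seq (exec_mv (by simp) hc) (Exec.ite_pos ?_ ((exec_toUnary (by simp) (n := d)
        (v := encInt a ++ v) ?_ ?_ ?_ ?_ hd hd').to ?_))
      · rcases htk with rfl | rfl <;> simp [testVal]
      · simp
      · simpa
      · simpa
      · simpa
      · funext r
        simp only [Function.update_apply]
        grind
    have hsimple : ∀ tk : Tok, tk ≠ .modEq → tk ≠ .notModEq → s .c = tk :: (encInt a ++ v) →
        Exec N (.mv .c .cm ;;
          .ite .cm .cm (fun o _ => o == some .modEq || o == some .notModEq) (toUnary .dd) .skip) s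
          s⟦.c ↦ encInt a ++ v⟧⟦.cm ↦ [tk]⟧⟦.dd ↦ List.replicate 0 .top⟧ := by
      intro tk h h' hc
      refine Exec.seq (exec_mv (by simp) hc) (Exec.ite_neg ?_ ((Exec.skip _).to ?_))
      · simp [testVal, h, h']
      · funext r
        simp only [Function.update_apply]
        grind
    cases r with
    | modEq d =>
      exact hmod d _ (.inl rfl) (by simpa [Cmp.enc, Cmp.tok] using hc) hN₁
        (by simp [Cmp.enc] at hN₂; omega)
    | notModEq d =>
      exact hmod d _ (.inr rfl) (by simpa [Cmp.enc, Cmp.tok] using hc) hN₁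
        (by simp [Cmp.enc] at hN₂; omega)
    | _ =>
      exact hsimple _ (by simp [Cmp.tok]) (by simp [Cmp.tok])
        (by simpa [Cmp.enc, Cmp.tok] using hc)
  obtain ⟨m, e1, e2⟩ := first
  refine e1.seq (e2.seq ?_)
  obtain ⟨sgn, hsgn⟩ : ∃ sgn : Tok, sgn = if a < 0 then .neg else .pos := ⟨_, rfl⟩
  rw [encInt, List.length_cons] at hN₂
  refine Exec.seq (m := s⟦.c ↦ encNat a.natAbs ++ v⟧⟦.cm ↦ [r.tok]⟧⟦.dd ↦
    List.replicate r.modulus .top⟧⟦.sg ↦ [sgn]⟧) ((exec_mv (by simp) (t := sgn)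
      (v := encNat a.natAbs ++ v) (by simp [encInt, hsgn])).to ?_) ?_
  · funext r
    simp only [Function.update_apply]
    grind
  by_cases ha : a < 0
  · rw [if_pos ha] at hsgn
    refine (Exec.seq (Exec.ite_pos (by simp [testVal, tokTest, hsgn]) (exec_toUnary (by simp)
      (n := a.natAbs) (v := v) ?_ ?_ ?_ ?_ hN (by omega))) (Exec.pop _ _)).to ?_
    · simp
    · simpa
    · simpa
    · simpa
    · have e1 : a.toNat = 0 := by omega
      have e2 : (-a).toNat = a.natAbs := by omega
      rw [e1, e2]
      funext r
      simp only [Function.update_apply]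
      grind
  · rw [if_neg ha] at hsgn
    refine (Exec.seq (Exec.ite_neg (by simp [testVal, tokTest, hsgn]) (exec_toUnary (by simp)
      (n := a.natAbs) (v := v) ?_ ?_ ?_ ?_ hN (by omega))) (Exec.pop _ _)).to ?_
    · simp
    · simpa
    · simpa
    · simpa
    · have e1 : (-a).toNat = 0 := by omega
      have e2 : a.toNat = a.natAbs := by omega
      rw [e1, e2]
      funext r
      simp only [Function.update_apply]
      grind

/-- Subtract the unary numbers in `pos` and `neg` from each other. -/
def cancelProg : Prog Reg := .loop .pos .neg bothSomeTest (.pop .pos ;; .pop .neg)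

theorem exec_cancelProg {s : Store Reg} {p q : ℕ} (hp : s .pos = List.replicate p .top)
    (hq : s .neg = List.replicate q .top) (hN : p ≤ N) :
    Exec N cancelProg s s⟦.pos ↦ List.replicate (p - q) .top⟧⟦.neg ↦
      List.replicate (q - p) .top⟧ := by
  -- No list is being read here; the `min p q` passes are counted by a list of units.
  have key := Exec.loop_of_list (N := N) (a := Reg.pos) (b := .neg) (f := bothSomeTest)
    (p := .pop .pos ;; .pop .neg) (List.replicate (min p q) ())
    (fun pre suf => s⟦.pos ↦ List.replicate (p - min p q + suf.length) .top⟧⟦.neg ↦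
      List.replicate (q - min p q + suf.length) .top⟧) (by simp; omega) ?_ ?_
  · have e1 : p - min p q + min p q = p := by omega
    have e2 : q - min p q + min p q = q := by omega
    have e3 : p - min p q = p - q := by omega
    have e4 : q - min p q = q - p := by omega
    simp only [List.length_replicate, List.length_nil, add_zero] at key
    rw [e1, e2, e3, e4] at key
    exact key.of_eq (by rw [← hp, ← hq]; simp)
  · intro pre x suf e
    refine ⟨?_, ((Exec.pop _ _).seq (Exec.pop _ _)).to ?_⟩
    · simp [testVal, bothSomeTest, List.length_cons, ← add_assoc, List.replicate_succ]
    · funext r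
      simp only [Function.update_apply, List.length_cons, ← add_assoc, List.replicate_succ]
      grind
  · rcases le_total p q with h | h
    · simp [testVal, bothSomeTest, h]
    · simp [testVal, bothSomeTest, h]

/-- Leave a token in `ee` unless the unary number in `pos` is divisible by the one in `dd`. -/
def divProg : Prog Reg :=
  .ite .dd .dd isSomeTest
    (.loop .pos .pos isSomeTest
      (.pop .pos ;; .mv .dd .ee ;; .ite .dd .dd isSomeTest .skip (.mvAll .ee .dd)))
    (.mvAll .pos .ee)

/-- For `d > 0`, `dd` and `ee` together always hold `d` tokens, and `ee` holds the number of tokens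
consumed so far modulo `d`: when `dd` runs empty, it is refilled from `ee`. For `d = 0` everything
is moved to `ee`, in agreement with `0 ∣ n` meaning `n = 0`. -/
theorem exec_divProg {s : Store Reg} {n d : ℕ} (hp : s .pos = List.replicate n .top)
    (hd : s .dd = List.replicate d .top) (he : s .ee = []) (hN : n ≤ N) (hN' : d ≤ N) :
    ∃ D E : List Tok, D.length ≤ N ∧ E.length ≤ N ∧ (E = [] ↔ d ∣ n) ∧
      Exec N divProg s s⟦.pos ↦ []⟧⟦.dd ↦ D⟧⟦.ee ↦ E⟧ := by
  rcases Nat.eq_zero_or_pos d with rfl | h0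
  · refine ⟨[], List.replicate n .top, by simp, by simpa using hN, by simp,
      Exec.ite_neg (by simp [testVal, isSomeTest, hd]) ((exec_mvAll (by simp) ?_).to ?_)⟩
    · simpa [hp] using hN
    · simp only [hp, he, List.reverse_replicate, List.append_nil]
      funext r
      simp only [Function.update_apply]
      grind
  · refine ⟨List.replicate (d - n % d) .top, List.replicate (n % d) .top, by simp; omega,
      by simp; exact (Nat.mod_le _ _).trans hN, by simp [Nat.dvd_iff_mod_eq_zero], ?_⟩
    refine Exec.ite_pos (by simp [testVal, isSomeTest, hd, List.head?_replicate]; omega) ?_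
    have key := Exec.loop_of_list (N := N) (a := Reg.pos) (b := .pos) (f := isSomeTest)
      (p := .pop .pos ;; .mv .dd .ee ;; .ite .dd .dd isSomeTest .skip (.mvAll .ee .dd))
      (List.replicate n ())
      (fun pre suf => s⟦.pos ↦ List.replicate suf.length .top⟧⟦.dd ↦
        List.replicate (d - pre.length % d) .top⟧⟦.ee ↦
        List.replicate (pre.length % d) .top⟧) (by simpa using hN) ?_ ?_
    · simp only [List.length_replicate, List.length_nil, Nat.zero_mod, List.replicate_zero,
        Nat.sub_zero] at key
      exact key.of_eq (by rw [← hp, ← hd, ← he]; simp)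
    · intro pre x suf e
      have hlt := Nat.mod_lt pre.length h0
      refine ⟨by simp [testVal, isSomeTest, List.replicate_succ], ?_⟩
      refine Exec.seq (m := s⟦.pos ↦ List.replicate suf.length .top⟧⟦.dd ↦
        List.replicate (d - pre.length % d) .top⟧⟦.ee ↦ List.replicate (pre.length % d) .top⟧)
        ((Exec.pop _ _).to ?_) ?_
      · funext r
        simp only [Function.update_apply, List.length_cons, List.replicate_succ]
        grind
      refine Exec.seq (m := s⟦.pos ↦ List.replicate suf.length .top⟧⟦.dd ↦
        List.replicate (d - pre.length % d - 1) .top⟧⟦.ee ↦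
        List.replicate (pre.length % d + 1) .top⟧) ((exec_mv (by simp) (t := .top)
          (v := List.replicate (d - pre.length % d - 1) .top) ?_).to ?_) ?_
      · have h1 : d - pre.length % d = (d - pre.length % d - 1) + 1 := by omega
        simp only [ne_eq, reduceCtorEq, not_false_eq_true, Function.update_of_ne,
          Function.update_self]
        conv_lhs => rw [h1, List.replicate_succ]
      · funext r
        simp only [Function.update_apply, List.replicate_succ]
        grind
      simp only [List.length_append, List.length_singleton]
      by_cases hw : pre.length % d + 1 = d
      · have h2 : (pre.length + 1) % d = 0 := by
          rw [← Nat.mod_add_mod, hw, Nat.mod_self]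
        have h3 : d - pre.length % d - 1 = 0 := by omega
        rw [h2, h3, hw]
        refine Exec.ite_neg (by simp [testVal, isSomeTest]) ((exec_mvAll (by simp) ?_).to ?_)
        · simpa using hN'
        · simp only [List.replicate_zero, Nat.sub_zero]
          funext r
          simp only [Function.update_apply]
          grind
      · have h2 : (pre.length + 1) % d = pre.length % d + 1 := by
          rw [← Nat.mod_add_mod, Nat.mod_eq_of_lt (by omega)]
        rw [h2]
        refine Exec.ite_pos ?_ ((Exec.skip _).to ?_)
        · simp [testVal, isSomeTest, List.head?_replicate]; omega
        · rw [Nat.sub_sub]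
    · simp [testVal, isSomeTest]

end

/-! ### The verdict on a comparison, on a conjunct, and on all conjuncts -/

section

variable {N : ℕ}

/-- Put a token on `no` if the comparison in `cm` fails. -/
def verdictProg : Prog Reg :=
  .ite .cm .cm (tokTest .eq) (.ite .pos .neg bothNoneTest .skip (.push .no .top)) <|
  .ite .cm .cm (tokTest .ne) (.ite .pos .neg bothNoneTest (.push .no .top) .skip) <|
  .ite .cm .cm (tokTest .le) (.ite .pos .pos isSomeTest (.push .no .top) .skip) <|
  .ite .cm .cm (tokTest .ge) (.ite .neg .neg isSomeTest (.push .no .top) .skip) <|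
  .ite .cm .cm (tokTest .lt) (.ite .neg .neg isSomeTest .skip (.push .no .top)) <|
  .ite .cm .cm (tokTest .gt) (.ite .pos .pos isSomeTest .skip (.push .no .top)) <|
  .mvAll .neg .pos ;; divProg ;;
    .ite .cm .cm (tokTest .modEq) (.ite .ee .ee isSomeTest (.push .no .top) .skip)
      (.ite .ee .ee isSomeTest .skip (.push .no .top))

theorem exec_ite_push {ρ : Type} [DecidableEq ρ] {a b r : ρ} {f : Option Tok → Option Tok → Bool}
    {s : Store ρ} {p : Prop} [Decidable p] (hr : s r = [])
    (h : testVal a b f s = true ↔ p) :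
    Exec N (.ite a b f .skip (.push r .top)) s s⟦r ↦ if p then [] else [.top]⟧ := by
  by_cases hp : p
  · exact Exec.ite_pos (h.2 hp) ((Exec.skip _).to (by simp [hp, ← hr]))
  · exact Exec.ite_neg (by simpa using mt h.1 hp) ((Exec.push _ _ _).to (by simp [hp, hr]))

theorem exec_ite_push' {ρ : Type} [DecidableEq ρ] {a b r : ρ} {f : Option Tok → Option Tok → Bool}
    {s : Store ρ} {p : Prop} [Decidable p] (hr : s r = [])
    (h : testVal a b f s = true ↔ ¬ p) :
    Exec N (.ite a b f (.push r .top) .skip) s s⟦r ↦ if p then [] else [.top]⟧ := by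
  by_cases hp : p
  · exact Exec.ite_neg (by simpa using (not_congr h).2 (not_not.2 hp))
      ((Exec.skip _).to (by simp [hp, ← hr]))
  · exact Exec.ite_pos (h.2 hp) ((Exec.push _ _ _).to (by simp [hp, hr]))

-- After cancellation one of the two truncated differences is zero. The order comparisons and `=`,
-- `≠` are then tests for emptiness. For congruences the two are added, which gives the absolute
-- value of the difference, to be tested for divisibility. What is left in the counters is
-- irrelevant apart from its length, as it is cleared afterwards.
open Classical in
theorem exec_verdictProg {r : Cmp} {p q : ℕ} {s : Store Reg}
    (hp : s .pos = List.replicate (p - q) .top) (hq : s .neg = List.replicate (q - p) .top)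
    (hcm : s .cm = [r.tok]) (hdd : s .dd = List.replicate r.modulus .top) (hee : s .ee = [])
    (hno : s .no = []) (hN : p ≤ N) (hN' : q ≤ N) (hN₁ : r.modulus ≤ N) :
    ∃ P Q D E : List Tok, P.length ≤ N ∧ Q.length ≤ N ∧ D.length ≤ N ∧ E.length ≤ N ∧
      Exec N verdictProg s s⟦.pos ↦ P⟧⟦.neg ↦ Q⟧⟦.dd ↦ D⟧⟦.ee ↦ E⟧⟦.no ↦
        if r.Holds p q then [] else [.top]⟧ := by
  have plain : ∀ {f : Prog Reg} {b : Prop} [Decidable b],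
      Exec N f s s⟦.no ↦ if b then [] else [.top]⟧ →
      ∃ P Q D E : List Tok, P.length ≤ N ∧ Q.length ≤ N ∧ D.length ≤ N ∧ E.length ≤ N ∧
        Exec N f s s⟦.pos ↦ P⟧⟦.neg ↦ Q⟧⟦.dd ↦ D⟧⟦.ee ↦ E⟧⟦.no ↦ if b then [] else [.top]⟧ := by
    intro f b _ h
    refine ⟨s .pos, s .neg, s .dd, s .ee, by simp [hp]; omega, by simp [hq]; omega,
      by simpa [hdd] using hN₁, by simp [hee], ?_⟩
    simpa using h
  have ht : ∀ t, testVal .cm .cm (tokTest t) s = decide (r.tok = t) := by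
    intro t
    simp only [testVal, hcm, tokTest, List.head?_cons]
    by_cases h : r.tok = t <;> simp [h]
  have hmod : ∀ d : ℕ, r.modulus = d → ∀ tk, r.tok = tk → (tk = .modEq ∨ tk = .notModEq) →
      ∃ P Q D E : List Tok, P.length ≤ N ∧ Q.length ≤ N ∧ D.length ≤ N ∧ E.length ≤ N ∧
        Exec N (.mvAll .neg .pos ;; divProg ;;
          .ite .cm .cm (tokTest .modEq) (.ite .ee .ee isSomeTest (.push .no .top) .skip)
          (.ite .ee .ee isSomeTest .skip (.push .no .top))) s
          s⟦.pos ↦ P⟧⟦.neg ↦ Q⟧⟦.dd ↦ D⟧⟦.ee ↦ E⟧⟦.no ↦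
            if ((tk = .modEq ∧ d ∣ (p - q) + (q - p)) ∨
              (tk = .notModEq ∧ ¬ d ∣ (p - q) + (q - p))) then [] else [.top]⟧ := by
    intro d hd tk htk hor
    obtain ⟨D, E, hD, hE, hdiv, hex⟩ := exec_divProg (N := N)
      (s := s⟦.neg ↦ []⟧⟦.pos ↦ List.replicate ((p - q) + (q - p)) .top⟧) (n := (p - q) + (q - p))
      (d := d) (by simp) (by simp [hdd, hd]) (by simp [hee]) (by omega) (by omega)
    refine ⟨[], [], D, E, by simp, by simp, hD, hE, ?_⟩
    refine Exec.seq ((exec_mvAll (by simp) (by simp [hq]; omega)).to ?_) (hex.seq ?_)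
    · simp only [hp, hq, List.reverse_replicate, List.replicate_append_replicate, add_comm]
    · have hE' : E ≠ [] → ¬ d ∣ (p - q) + (q - p) := mt hdiv.2
      have fin : s⟦.neg ↦ []⟧⟦.pos ↦ List.replicate ((p - q) + (q - p)) .top⟧⟦.pos ↦ []⟧⟦.dd ↦
          D⟧⟦.ee ↦ E⟧ = s⟦.pos ↦ []⟧⟦.neg ↦ []⟧⟦.dd ↦ D⟧⟦.ee ↦ E⟧ := by
        funext r
        simp only [Function.update_apply]
        grind
      rw [fin]
      have hEs : E.head?.isSome = true ↔ ¬ d ∣ (p - q) + (q - p) := by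
        rw [← hdiv]; cases E <;> simp
      rcases hor with rfl | rfl
      · refine Exec.ite_pos (by simp [testVal, tokTest, hcm, htk]) (exec_ite_push' (by simp [hno]) ?_)
        simpa [testVal, isSomeTest] using hEs
      · refine Exec.ite_neg (by simp [testVal, tokTest, hcm, htk]) (exec_ite_push (by simp [hno]) ?_)
        simpa [testVal, isSomeTest] using hEs
  have hdvd : ∀ d : ℕ, (p : ℤ) ≡ q [ZMOD d] ↔ d ∣ (p - q) + (q - p) := by
    intro d
    rw [Int.modEq_iff_dvd, Int.natCast_dvd]
    have : ((q : ℤ) - p).natAbs = (p - q) + (q - p) := by omega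
    rw [this]
  unfold verdictProg
  cases r with
  | eq =>
    refine plain (Exec.ite_pos (by simp [ht, Cmp.tok]) (exec_ite_push hno ?_))
    simp [testVal, bothNoneTest, hp, hq, Cmp.Holds]; omega
  | ne =>
    refine plain (Exec.ite_neg (by simp [ht, Cmp.tok]) (Exec.ite_pos (by simp [ht, Cmp.tok])
      (exec_ite_push' hno ?_)))
    simp [testVal, bothNoneTest, hp, hq, Cmp.Holds]; omega
  | le =>
    refine plain (Exec.ite_neg (by simp [ht, Cmp.tok]) (Exec.ite_neg (by simp [ht, Cmp.tok])
      (Exec.ite_pos (by simp [ht, Cmp.tok]) (exec_ite_push' hno ?_))))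
    simp [testVal, isSomeTest, hp, Cmp.Holds, List.head?_replicate]; omega
  | ge =>
    refine plain (Exec.ite_neg (by simp [ht, Cmp.tok]) (Exec.ite_neg (by simp [ht, Cmp.tok])
      (Exec.ite_neg (by simp [ht, Cmp.tok]) (Exec.ite_pos (by simp [ht, Cmp.tok])
      (exec_ite_push' hno ?_)))))
    simp [testVal, isSomeTest, hq, Cmp.Holds, List.head?_replicate]; omega
  | lt =>
    refine plain (Exec.ite_neg (by simp [ht, Cmp.tok]) (Exec.ite_neg (by simp [ht, Cmp.tok])
      (Exec.ite_neg (by simp [ht, Cmp.tok]) (Exec.ite_neg (by simp [ht, Cmp.tok])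
      (Exec.ite_pos (by simp [ht, Cmp.tok]) (exec_ite_push hno ?_))))))
    simp [testVal, isSomeTest, hq, Cmp.Holds, List.head?_replicate]; omega
  | gt =>
    refine plain (Exec.ite_neg (by simp [ht, Cmp.tok]) (Exec.ite_neg (by simp [ht, Cmp.tok])
      (Exec.ite_neg (by simp [ht, Cmp.tok]) (Exec.ite_neg (by simp [ht, Cmp.tok])
      (Exec.ite_neg (by simp [ht, Cmp.tok]) (Exec.ite_pos (by simp [ht, Cmp.tok])
      (exec_ite_push hno ?_)))))))
    simp [testVal, isSomeTest, hp, Cmp.Holds, List.head?_replicate]; omega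
  | modEq d =>
    obtain ⟨P, Q, D, E, h1, h2, h3, h4, h⟩ := hmod d rfl .modEq rfl (.inl rfl)
    refine ⟨P, Q, D, E, h1, h2, h3, h4, Exec.ite_neg (by simp [ht, Cmp.tok])
      (Exec.ite_neg (by simp [ht, Cmp.tok]) (Exec.ite_neg (by simp [ht, Cmp.tok])
      (Exec.ite_neg (by simp [ht, Cmp.tok]) (Exec.ite_neg (by simp [ht, Cmp.tok])
      (Exec.ite_neg (by simp [ht, Cmp.tok]) (h.to ?_))))))⟩
    simp [Cmp.Holds, hdvd]
  | notModEq d =>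
    obtain ⟨P, Q, D, E, h1, h2, h3, h4, h⟩ := hmod d rfl .notModEq rfl (.inr rfl)
    refine ⟨P, Q, D, E, h1, h2, h3, h4, Exec.ite_neg (by simp [ht, Cmp.tok])
      (Exec.ite_neg (by simp [ht, Cmp.tok]) (Exec.ite_neg (by simp [ht, Cmp.tok])
      (Exec.ite_neg (by simp [ht, Cmp.tok]) (Exec.ite_neg (by simp [ht, Cmp.tok])
      (Exec.ite_neg (by simp [ht, Cmp.tok]) (h.to ?_))))))⟩
    simp [Cmp.Holds, hdvd]

/-- All comparisons depend on the difference of the two sides only; this justifies moving the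
negative terms and the right-hand side across. -/
theorem Cmp.holds_iff_of_sub_eq (r : Cmp) {a b a' b' : ℤ} (h : a - b = a' - b') :
    r.Holds a b ↔ r.Holds a' b' := by
  cases r <;> simp only [Cmp.Holds] <;> try omega
  all_goals
    rw [Int.modEq_iff_dvd, Int.modEq_iff_dvd]
    have : b - a = b' - a' := by omega
    rw [this]

/-- The value of the left-hand side of a local Presburger quantifier on a list of sets. -/
def LP.valOn (P : LP) (w : List (Finset ℕ)) : ℤ :=
  (P.terms.map fun t => t.1 * (w.countP (t.2 ∈ ·) : ℤ)).sum

theorem posSum_sub_negSum (w : List (Finset ℕ)) (l : List (ℤ × ℕ)) :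
    (posSum w l : ℤ) - negSum w l = (l.map fun t => t.1 * (w.countP (t.2 ∈ ·) : ℤ)).sum := by
  induction l with
  | nil => simp [posSum, negSum]
  | cons t l ih =>
    have h : (t.1.toNat : ℤ) - (-t.1).toNat = t.1 := by omega
    simp only [posSum, negSum, List.map_cons, List.sum_cons, Nat.cast_add, Nat.cast_mul] at ih ⊢
    rw [← ih]
    nth_rewrite 3 [← h]
    ring

theorem posSum_le (w : List (Finset ℕ)) (l : List (ℤ × ℕ)) :
    posSum w l ≤ w.length * (l.map fun t => t.1.natAbs).sum := by
  induction l with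
  | nil => simp [posSum]
  | cons t l ih =>
    simp only [posSum, List.map_cons, List.sum_cons, mul_add] at ih ⊢
    have h1 : t.1.toNat ≤ t.1.natAbs := by omega
    exact add_le_add (Nat.mul_le_mul List.countP_le_length h1) ih

theorem negSum_le (w : List (Finset ℕ)) (l : List (ℤ × ℕ)) :
    negSum w l ≤ w.length * (l.map fun t => t.1.natAbs).sum := by
  induction l with
  | nil => simp [negSum]
  | cons t l ih =>
    simp only [negSum, List.map_cons, List.sum_cons, mul_add] at ih ⊢
    have h1 : (-t.1).toNat ≤ t.1.natAbs := by omega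
    exact add_le_add (Nat.mul_le_mul List.countP_le_length h1) ih

/-- Take a conjunct off `c` and put a token on `bad` if the word in `x` violates it. -/
def constraintProg : Prog Reg :=
  atomTest ;; termsProg ;; rhsProg ;; cancelProg ;; verdictProg ;;
  .clear .pos ;; .clear .neg ;; .clear .dd ;; .clear .ee ;; .clear .cm ;;
  .ite .act .no bothSomeTest (.push .bad .top) .skip ;; .clear .act ;; .clear .no

/-- The registers that are empty between the evaluations of constraints. -/
structure CheckIdle (s : Store Reg) : Prop extends EvalIdle s where
  pos : s .pos = []
  neg : s .neg = []
  dd : s .dd = []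
  ee : s .ee = []
  cm : s .cm = []
  act : s .act = []
  no : s .no = []

/-- The word `w` violates the conjunct `c` at a vertex of type `π`. -/
def Violates {Ψ : Sentence} (π : UnaryType Ψ) (w : List (Finset ℕ)) (c : UAtom × LP) : Prop :=
  c.1.Mem π ∧ ¬ c.2.cmp.Holds (c.2.valOn w) c.2.rhs

open Classical in
theorem exec_constraintProg {Ψ : Sentence} {π : UnaryType Ψ} {w : List (Finset ℕ)}
    {d : UAtom × LP} {s : Store Reg} {v : List Tok} (hs : CheckIdle s) (hx : s .x = wordStr w)
    (hpp : s .pp = encUnaryType π) (hc : s .c = d.1.enc ++ d.2.enc ++ v)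
    (hN : (encUnaryType π).length ≤ N) (hN₁ : (d.1.enc ++ d.2.enc).length ≤ N)
    (hN₂ : (wordStr w).length ≤ N) (hN₃ : (w.length + 1) * (2 * d.2.weight + 1) ≤ N) :
    Exec N constraintProg s
      s⟦.c ↦ v⟧⟦.bad ↦ (if Violates π w d then [.top] else []) ++ s .bad⟧ := by
  obtain ⟨q, P⟩ := d
  simp only [LP.enc, List.length_append] at hN₁ hc hN₃
  -- A term adds at most `|λ|` for each letter of `w` and the right-hand side adds at most the
  -- weight, so both accumulators stay within `(|w| + 1) * weight`. The doubled weight leaves room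
  -- for the conversion to unary.
  have hw : 2 * P.weight + 1 ≤ N := le_trans (Nat.le_mul_of_pos_left _ (by omega)) hN₃
  have hw' := hw
  simp only [LP.weight] at hw'
  have hposN : posSum w P.terms + (-P.rhs).toNat ≤ N := by
    have h1 := posSum_le w P.terms
    have h2 : (-P.rhs).toNat ≤ P.weight := by simp only [LP.weight]; omega
    have h3 : w.length * (P.terms.map fun t => t.1.natAbs).sum ≤ w.length * P.weight :=
      Nat.mul_le_mul_left _ (by simp only [LP.weight]; omega)
    nlinarith
  have hnegN : negSum w P.terms + P.rhs.toNat ≤ N := by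
    have h1 := negSum_le w P.terms
    have h2 : P.rhs.toNat ≤ P.weight := by simp only [LP.weight]; omega
    have h3 : w.length * (P.terms.map fun t => t.1.natAbs).sum ≤ w.length * P.weight :=
      Nat.mul_le_mul_left _ (by simp only [LP.weight]; omega)
    nlinarith
  obtain ⟨⟨h1, h2, h3, h4, h5, h6, h7, h8, h9, h10, h11, h12⟩, g1, g2, g3, g4, g5, g6, g7⟩ := hs
  refine Exec.seq (exec_atomTest (π := π) (q := q) (v := encList (fun t => encInt t.1 ++ encNat t.2)
    P.terms ++ (P.cmp.enc ++ encInt P.rhs ++ v)) hpp (by simpa using hc) h1 h11 h12 h5 h6 h7 h8 g6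
    hN (by omega)) ?_
  refine Exec.seq (exec_termsProg (l := P.terms) (w := w) (v := P.cmp.enc ++ encInt P.rhs ++ v)
    (by constructor <;> simpa) (by simpa) (by simp) ?_ (by omega) hN₂) ?_
  · intro t ht
    have := List.single_le_sum (l := P.terms.map fun t => t.1.natAbs) (by simp) _
      (List.mem_map_of_mem ht)
    omega
  refine Exec.seq (exec_rhsProg (r := P.cmp) (a := P.rhs) (v := v) (by constructor <;> simpa)
    (by simp) (by simpa) (by simpa) (by omega) (by omega) (by simp; omega)) ?_
  refine Exec.seq (m := s⟦.c ↦ v⟧⟦.act ↦ if q.Mem π then [.top] else []⟧⟦.cm ↦ [P.cmp.tok]⟧⟦.dd ↦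
    List.replicate P.cmp.modulus .top⟧⟦.pos ↦
    List.replicate ((posSum w P.terms + (-P.rhs).toNat) - (negSum w P.terms + P.rhs.toNat)) .top⟧⟦.neg ↦
    List.replicate ((negSum w P.terms + P.rhs.toNat) - (posSum w P.terms + (-P.rhs).toNat)) .top⟧)
    ((exec_cancelProg (p := posSum w P.terms + (-P.rhs).toNat)
      (q := negSum w P.terms + P.rhs.toNat) ?_ ?_ hposN).to ?_) ?_
  · simp [g1, List.replicate_append_replicate, add_comm]
  · simp [g2, List.replicate_append_replicate, add_comm]
  · funext r
    simp only [Function.update_apply]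
    grind
  obtain ⟨A, B, D, E, k1, k2, k3, k4, k5⟩ := exec_verdictProg (N := N) (r := P.cmp)
    (p := posSum w P.terms + (-P.rhs).toNat) (q := negSum w P.terms + P.rhs.toNat)
    (s := s⟦.c ↦ v⟧⟦.act ↦ if q.Mem π then [.top] else []⟧⟦.cm ↦ [P.cmp.tok]⟧⟦.dd ↦
    List.replicate P.cmp.modulus .top⟧⟦.pos ↦
    List.replicate ((posSum w P.terms + (-P.rhs).toNat) - (negSum w P.terms + P.rhs.toNat)) .top⟧⟦.neg ↦
    List.replicate ((negSum w P.terms + P.rhs.toNat) - (posSum w P.terms + (-P.rhs).toNat)) .top⟧)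
    (by simp) (by simp) (by simp) (by simp) (by simpa) (by simpa) hposN hnegN (by omega)
  refine k5.seq ?_
  have hN0 : 1 ≤ N := by omega
  -- The difference of the accumulators is the value of the left-hand side minus `P.rhs`.
  have hh : P.cmp.Holds ((posSum w P.terms + (-P.rhs).toNat : ℕ) : ℤ)
      ((negSum w P.terms + P.rhs.toNat : ℕ) : ℤ) ↔ P.cmp.Holds (P.valOn w) P.rhs := by
    refine P.cmp.holds_iff_of_sub_eq ?_
    have := posSum_sub_negSum w P.terms
    simp only [LP.valOn, ← this]
    push_cast
    omega
  set noL : List Tok := if P.cmp.Holds ((posSum w P.terms + (-P.rhs).toNat : ℕ) : ℤ)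
      ((negSum w P.terms + P.rhs.toNat : ℕ) : ℤ) then [] else [.top] with hnoL
  set actL : List Tok := if q.Mem π then [.top] else [] with hactL
  refine Exec.seq (exec_clear (by simpa)) (Exec.seq (exec_clear (by simpa)) (Exec.seq
    (exec_clear (by simpa)) (Exec.seq (exec_clear (by simpa)) (Exec.seq
      (m := s⟦.c ↦ v⟧⟦.act ↦ actL⟧⟦.no ↦ noL⟧) ((exec_clear (by simpa)).to ?_) ?_))))
  · funext r
    simp only [Function.update_apply]
    grind
  refine Exec.seq (m := s⟦.c ↦ v⟧⟦.act ↦ actL⟧⟦.no ↦ noL⟧⟦.bad ↦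
    (if Violates π w (q, P) then [.top] else []) ++ s .bad⟧) ?_ ?_
  · by_cases hv : Violates π w (q, P)
    · have e1 : actL = [.top] := by rw [hactL, if_pos hv.1]
      have e2 : noL = [.top] := by rw [hnoL, if_neg (mt hh.1 hv.2)]
      refine Exec.ite_pos (by simp [testVal, bothSomeTest, e1, e2]) ((Exec.push _ _ _).to ?_)
      simp [hv]
    · refine Exec.ite_neg ?_ ((Exec.skip _).to ?_)
      · simp only [Violates, not_and_or, not_not] at hv
        rcases hv with hv | hv
        · simp [testVal, bothSomeTest, hactL, hv]
        · simp only [hnoL, hh.2 hv, if_true]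
          simp [testVal, bothSomeTest]
      · simp only [hv, if_false, List.nil_append]
        funext r
        simp only [Function.update_apply]
        grind
  · refine ((exec_clear ?_).seq (exec_clear ?_)).to ?_
    · by_cases h : q.Mem π <;> simp [hactL, h, hN0]
    · simp only [ne_eq, reduceCtorEq, not_false_eq_true, Function.update_of_ne,
        Function.update_self, hnoL]
      split_ifs <;> simp [hN0]
    · funext r
      simp only [Function.update_apply]
      grind

/-- Put a token on `bad` for each conjunct that the word in `x` violates. -/
def checkProg : Prog Reg :=
  .copy .cn .c .t ;; .loop .c .c (tokTest .item) (.pop .c ;; constraintProg) ;; .pop .c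

open Classical in
theorem exec_checkProg {Ψ : Sentence} {π : UnaryType Ψ} {w : List (Finset ℕ)}
    {s : Store Reg} (hs : CheckIdle s) (hx : s .x = wordStr w)
    (hpp : s .pp = encUnaryType π) (hcn : s .cn = encList (fun c => c.1.enc ++ c.2.enc) Ψ.counting)
    (hc : s .c = []) (hN : (encUnaryType π).length ≤ N)
    (hN₁ : (encList (fun c => c.1.enc ++ c.2.enc) Ψ.counting).length ≤ N)
    (hN₂ : (wordStr w).length ≤ N)
    (hN₃ : ∀ d ∈ Ψ.counting, (w.length + 1) * (2 * d.2.weight + 1) ≤ N) :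
    Exec N checkProg s
      s⟦.bad ↦ List.replicate (Ψ.counting.countP fun d => Violates π w d) .top ++ s .bad⟧ := by
  refine Exec.seq (exec_copy (by simp) (by simp) (by simp) hs.t (by rwa [hcn])) ?_
  have key := Exec.loop_of_list (N := N) (a := Reg.c) (b := .c) (f := tokTest .item)
    (p := .pop .c ;; constraintProg) Ψ.counting
    (fun pre suf => s⟦.c ↦ encList (fun c => c.1.enc ++ c.2.enc) suf⟧⟦.bad ↦
      List.replicate (pre.countP fun d => Violates π w d) .top ++ s .bad⟧)
    ((length_le_encList _ _).trans hN₁) ?_ ?_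
  · rw [hcn, hc]
    refine ((key.of_eq ?_).seq (Exec.pop _ _)).to ?_
    · simp
    · funext r
      simp only [Function.update_apply, encList]
      grind
  · intro pre d suf e
    refine ⟨by simp [testVal, tokTest, encList], ?_⟩
    refine (Exec.seq (Exec.pop _ _) (exec_constraintProg (π := π) (w := w) (d := d)
      (v := encList (fun c => c.1.enc ++ c.2.enc) suf) ?_ (by simpa) (by simpa) ?_ hN ?_ hN₂
      (hN₃ d (by simp [e])))).to ?_
    · obtain ⟨⟨h1, h2, h3, h4, h5, h6, h7, h8, h9, h10, h11, h12⟩, g1, g2, g3, g4, g5, g6, g7⟩ := hs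
      constructor
      · constructor <;> simpa
      all_goals simpa
    · simp [encList]
    · exact (length_le_encList_of_mem (fun c : UAtom × LP => c.1.enc ++ c.2.enc) (l := Ψ.counting)
        (by simp [e])).trans hN₁
    · have e1 : List.replicate ((pre ++ [d]).countP fun d => Violates π w d) Tok.top =
          (if Violates π w d then [.top] else []) ++
            List.replicate (pre.countP fun d => Violates π w d) .top := by
        by_cases h : Violates π w d
        · simp [h, List.replicate_succ]
        · simp [h]
      rw [e1]
      funext r
      simp only [Function.update_apply]
      grind
  · simp [testVal, tokTest, encList]

end

section

variable {N : ℕ}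

/-! ### Enumerating and checking words -/

theorem or_notMem_encSet (A : Finset ℕ) : Tok.or ∉ encSet A := by
  simp [encSet, encList, encNat]

theorem or_notMem_wordStr (w : List (Finset ℕ)) : Tok.or ∉ wordStr w := by
  simp [wordStr, or_notMem_encSet]

theorem exists_encSet_eq (A : Finset ℕ) : ∃ u : List Tok, encSet A = u ++ [.endList] ∧ .endList ∉ u :=
  ⟨_, rfl, by simp [encNat]⟩

/-- The string of a list of words. -/
def wordsStr (ws : List (List (Finset ℕ))) : List Tok := ws.flatMap fun w => wordStr w ++ [.or]

theorem wordsStr_cons (w : List (Finset ℕ)) (ws : List (List (Finset ℕ))) :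
    wordsStr (w :: ws) = wordStr w ++ .or :: wordsStr ws := by simp [wordsStr]

theorem length_le_wordsStr (ws : List (List (Finset ℕ))) : ws.length ≤ (wordsStr ws).length := by
  induction ws with
  | nil => simp
  | cons w ws ih =>
    rw [wordsStr_cons]
    simp only [List.length_append, List.length_cons]
    omega

theorem length_wordStr_lt {ws : List (List (Finset ℕ))} {w : List (Finset ℕ)} (h : w ∈ ws) :
    (wordStr w).length < (wordsStr ws).length := by
  induction ws with
  | nil => simp at h
  | cons w' ws ih =>
    rw [wordsStr_cons]
    simp only [List.length_append, List.length_cons]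
    rcases List.mem_cons.1 h with rfl | h
    · omega
    · have := ih h; omega

/-- Take a word off `wds` and put it into `x`. -/
def nextWord : Prog Reg := .mvUntil .or .wds .t1 ;; .mvAll .t1 .x

theorem exec_nextWord {s : Store Reg} {w : List (Finset ℕ)} {v : List Tok}
    (hs : s .wds = wordStr w ++ .or :: v) (ht1 : s .t1 = []) (hx : s .x = [])
    (hN : (wordStr w).length ≤ N) :
    Exec N nextWord s s⟦.wds ↦ v⟧⟦.x ↦ wordStr w⟧ := by
  refine ((exec_mvUntil (by simp) hs (or_notMem_wordStr w) hN).seq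
    (exec_mvAll (by simp) (by simpa [ht1] using hN))).to ?_
  simp only [Function.update_self, ht1, List.append_nil, List.reverse_reverse]
  funext r
  simp only [Function.update_apply]
  grind

/-- Check all words, and put a token on `res` if one of them passes. -/
def checkAllProg : Prog Reg :=
  .loop .wds .wds isSomeTest
    (nextWord ;; .copy .he .x .t ;; checkProg ;;
      .ite .bad .bad isSomeTest .skip (.clear .res ;; .push .res .top) ;; .clear .bad ;; .clear .x)

-- The letter `A` of the distinguished edge is put in front of each word before the check. The
-- constraint `z_{η,π₂} ≥ 1` thus need not be tested.
open Classical in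
theorem exec_checkAllProg {Ψ : Sentence} {π : UnaryType Ψ} {A : Finset ℕ}
    {ws : List (List (Finset ℕ))} {s : Store Reg} (hs : CheckIdle s) (hw : s .wds = wordsStr ws)
    (hpp : s .pp = encUnaryType π) (hcn : s .cn = encList (fun c => c.1.enc ++ c.2.enc) Ψ.counting)
    (hhe : s .he = encSet A) (hc : s .c = []) (hx : s .x = []) (hbad : s .bad = [])
    (hres : s .res = []) (hN : (encUnaryType π).length ≤ N)
    (hN₁ : (encList (fun c => c.1.enc ++ c.2.enc) Ψ.counting).length ≤ N)
    (hN₂ : (encSet A).length + (wordsStr ws).length ≤ N)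
    (hN₃ : ∀ d ∈ Ψ.counting, ((wordsStr ws).length + 2) * (2 * d.2.weight + 1) ≤ N) :
    Exec N checkAllProg s s⟦.wds ↦ []⟧⟦.res ↦
      if ∃ w ∈ ws, ∀ d ∈ Ψ.counting, ¬ Violates π (A :: w) d then [.top] else []⟧ := by
  have key := Exec.loop_of_list (N := N) (a := Reg.wds) (b := .wds) (f := isSomeTest)
    (p := nextWord ;; .copy .he .x .t ;; checkProg ;;
      .ite .bad .bad isSomeTest .skip (.clear .res ;; .push .res .top) ;; .clear .bad ;; .clear .x)
    ws (fun pre suf => s⟦.wds ↦ wordsStr suf⟧⟦.res ↦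
      if ∃ w ∈ pre, ∀ d ∈ Ψ.counting, ¬ Violates π (A :: w) d then [.top] else []⟧)
    ((length_le_wordsStr ws).trans (by omega)) ?_ ?_
  · refine (key.of_eq ?_)
    rw [← hw]
    simp [← hres]
  · intro pre w suf e
    refine ⟨by simp [testVal, isSomeTest, wordsStr_cons], ?_⟩
    have hwm : w ∈ ws := by simp [e]
    have hwl := length_wordStr_lt hwm
    have hww := length_le_wordStr w
    obtain ⟨R, hR⟩ : ∃ R : List Tok, R =
      if ∃ w ∈ pre, ∀ d ∈ Ψ.counting, ¬ Violates π (A :: w) d then [.top] else [] := ⟨_, rfl⟩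
    have hRl : R.length ≤ N := by
      have : 1 ≤ N := by have := length_encSet_pos A; omega
      rw [hR]; split_ifs <;> simp [this]
    obtain ⟨R', hR'⟩ : ∃ R' : List Tok, R' =
      if ∃ w' ∈ pre ++ [w], ∀ d ∈ Ψ.counting, ¬ Violates π (A :: w') d then [.top] else [] :=
        ⟨_, rfl⟩
    rw [← hR, ← hR']
    obtain ⟨⟨h1, h2, h3, h4, h5, h6, h7, h8, h9, h10, h11, h12⟩, g1, g2, g3, g4, g5, g6, g7⟩ := hs
    refine Exec.seq (exec_nextWord (w := w) (v := wordsStr suf) (by simp [wordsStr_cons])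
      (by simpa) (by simpa) (by omega)) ?_
    -- Words have no opening mark, so copying `he` on top of `x` prepends the letter.
    refine Exec.seq (m := s⟦.wds ↦ wordsStr suf⟧⟦.res ↦ R⟧⟦.x ↦ wordStr (A :: w)⟧)
      ((exec_copy (by simp) (by simp) (by simp) (by simpa) ?_).to ?_) ?_
    · simp [hhe]; omega
    · have e1 : wordStr (A :: w) = encSet A ++ wordStr w := rfl
      rw [e1]
      funext r
      simp only [Function.update_apply]
      grind
    have hl1 : (wordStr (A :: w)).length ≤ N := by
      have e1 : wordStr (A :: w) = encSet A ++ wordStr w := rfl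
      rw [e1, List.length_append]; omega
    refine Exec.seq (exec_checkProg (π := π) (w := A :: w) ?_ (by simp) (by simpa) (by simpa)
      (by simpa) hN hN₁ hl1 ?_) ?_
    · constructor
      · constructor <;> simpa
      all_goals simpa
    · intro d hd
      refine le_trans (Nat.mul_le_mul_right _ ?_) (hN₃ d hd)
      simp only [List.length_cons]; omega
    set B := Ψ.counting.countP fun d => Violates π (A :: w) d with hB
    have hBN : B ≤ N := List.countP_le_length.trans ((length_le_encList _ _).trans hN₁)
    refine Exec.seq (m := s⟦.wds ↦ wordsStr suf⟧⟦.res ↦ R'⟧⟦.x ↦ wordStr (A :: w)⟧⟦.bad ↦ List.replicate B .top⟧) ?_ ?_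
    · by_cases hg : ∀ d ∈ Ψ.counting, ¬ Violates π (A :: w) d
      · have hB0 : B = 0 := by
          rw [hB, List.countP_eq_zero]; simpa using hg
        refine Exec.ite_neg (by simp [testVal, isSomeTest, hB0, hbad])
          ((Exec.seq (exec_clear ?_) (Exec.push _ _ _)).to ?_)
        · simpa using hRl
        · rw [if_pos ⟨w, by simp, hg⟩] at hR'
          rw [hR', hB0]
          funext r
          simp only [Function.update_apply]
          grind
      · have hB0 : B ≠ 0 := by
          rw [hB, ne_eq, List.countP_eq_zero]; simpa using hg
        refine Exec.ite_pos ?_ ((Exec.skip _).to ?_)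
        · obtain ⟨b, hb⟩ := Nat.exists_eq_succ_of_ne_zero hB0
          simp [testVal, isSomeTest, hb, List.replicate_succ]
        · have e2 : (∃ w' ∈ pre ++ [w], ∀ d ∈ Ψ.counting, ¬ Violates π (A :: w') d) ↔
              ∃ w' ∈ pre, ∀ d ∈ Ψ.counting, ¬ Violates π (A :: w') d := by
            simp only [List.mem_append, List.mem_singleton]
            constructor
            · rintro ⟨w', h | rfl, h'⟩
              · exact ⟨w', h, h'⟩
              · exact absurd h' hg
            · rintro ⟨w', h, h'⟩
              exact ⟨w', .inl h, h'⟩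
          simp only [e2, ← hR] at hR'
          rw [hR']
          funext r
          simp only [Function.update_apply]
          grind
    · refine ((exec_clear ?_).seq (exec_clear ?_)).to ?_
      · simpa using hBN
      · simpa using hl1
      · funext r
        simp only [Function.update_apply]
        grind
  · simp [testVal, isSomeTest, wordsStr]

/-- The words made from `x`: `x` itself, `xx`, and `x` with one more letter. -/
def extendWord (O : List (Finset ℕ)) (x : List (Finset ℕ)) (acc : List (List (Finset ℕ))) :
    List (List (Finset ℕ)) :=
  (O.map fun A => A :: x).reverse ++ (x ++ x) :: x :: acc

/-- Keeping each word makes the rounds monotone, and doubling lets polynomially many rounds reach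
words of exponential length. The left fold matches the order in which the program pushes new words
on a stack. -/
def extendWords (O : List (Finset ℕ)) (ws : List (List (Finset ℕ))) : List (List (Finset ℕ)) :=
  ws.foldl (fun acc x => extendWord O x acc) []

theorem mem_extendWords {O : List (Finset ℕ)} {ws : List (List (Finset ℕ))}
    {y : List (Finset ℕ)} : y ∈ extendWords O ws ↔
      ∃ x ∈ ws, y = x ∨ y = x ++ x ∨ ∃ A ∈ O, y = A :: x := by
  have key : ∀ acc, y ∈ ws.foldl (fun acc x => extendWord O x acc) acc ↔
      y ∈ acc ∨ ∃ x ∈ ws, y = x ∨ y = x ++ x ∨ ∃ A ∈ O, y = A :: x := by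
    induction ws with
    | nil => simp
    | cons x ws ih =>
      intro acc
      rw [List.foldl_cons, ih]
      simp only [extendWord, List.mem_append, List.mem_reverse, List.mem_map, List.mem_cons,
        exists_eq_or_imp]
      grind
  simpa [extendWords] using key []

/-- Together `x` and `xx` cost at most three times the length of `x` with its end mark; each
one-letter extension costs one such length plus its letter, and there are at most as many letters as
tokens in `O`. -/
theorem length_wordsStr_extendWord (O : List (Finset ℕ)) (x : List (Finset ℕ))
    (acc : List (List (Finset ℕ))) : (wordsStr (extendWord O x acc)).length ≤
      (wordsStr acc).length + ((wordStr x).length + 1) * (3 + 2 * (wordStr O).length) := by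
  have h : ∀ l : List (Finset ℕ), ∀ acc', (wordsStr ((l.map fun A => A :: x).reverse ++ acc')).length
      = (wordsStr acc').length + l.length * ((wordStr x).length + 1) + (wordStr l).length := by
    intro l
    induction l with
    | nil => simp [wordStr]
    | cons A l ih =>
      intro acc'
      have e : wordStr (A :: x) = encSet A ++ wordStr x := rfl
      have e' : wordStr (A :: l) = encSet A ++ wordStr l := rfl
      simp only [List.map_cons, List.reverse_cons, List.append_assoc, List.singleton_append, ih,
        wordsStr_cons, e, e', List.length_append, List.length_cons]
      ring
  have hO := length_le_wordStr O
  have e : wordStr (x ++ x) = wordStr x ++ wordStr x := by simp [wordStr]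
  rw [extendWord, h]
  simp only [wordsStr_cons, e, List.length_append, List.length_cons]
  have h1 : O.length * ((wordStr x).length + 1) ≤ (wordStr O).length * ((wordStr x).length + 1) :=
    Nat.mul_le_mul_right _ hO
  have h2 : (wordStr O).length ≤ (wordStr O).length * ((wordStr x).length + 1) :=
    Nat.le_mul_of_pos_right _ (by omega)
  nlinarith

theorem length_wordsStr_extendWords (O : List (Finset ℕ)) (ws : List (List (Finset ℕ))) :
    (wordsStr (extendWords O ws)).length ≤
      (wordsStr ws).length * (3 + 2 * (wordStr O).length) := by
  have key : ∀ acc, (wordsStr (ws.foldl (fun acc x => extendWord O x acc) acc)).length ≤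
      (wordsStr acc).length + (wordsStr ws).length * (3 + 2 * (wordStr O).length) := by
    induction ws with
    | nil => simp
    | cons x ws ih =>
      intro acc
      rw [List.foldl_cons]
      refine (ih _).trans ?_
      have := length_wordsStr_extendWord O x acc
      rw [wordsStr_cons]
      simp only [List.length_append, List.length_cons]
      nlinarith
  simpa [extendWords, wordsStr] using key []

/-- Replace each word in `wds` by the words made from it. -/
def extendProg : Prog Reg :=
  .loop .wds .wds isSomeTest
    (nextWord ;;
      .push .wds2 .or ;; .copy .x .wds2 .t ;;
      .push .wds2 .or ;; .copy .x .wds2 .t ;; .copy .x .wds2 .t ;;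
      .copy .opt .oo .t ;;
      .loop .oo .oo isSomeTest
        (.mvThru .endList .oo .t1 ;; .push .wds2 .or ;; .copy .x .wds2 .t ;; .mvAll .t1 .wds2) ;;
      .clear .x) ;;
  .mvAll .wds2 .t1 ;; .mvAll .t1 .wds

/-- On a stack a word is written from its end: first the mark `or`, then the copies of `x`, then the
new letter. The two final moves through `t1` leave the order as it was built in `wds2`. -/
theorem exec_extendProg {O : List (Finset ℕ)} {ws : List (List (Finset ℕ))} {s : Store Reg}
    (hw : s .wds = wordsStr ws) (ho : s .opt = wordStr O) (hoo : s .oo = []) (ht : s .t = [])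
    (ht1 : s .t1 = []) (hx : s .x = []) (hw2 : s .wds2 = []) (hN : (wordsStr ws).length ≤ N)
    (hN₁ : (wordStr O).length ≤ N) (hN₂ : (wordsStr (extendWords O ws)).length ≤ N) :
    Exec N extendProg s s⟦.wds ↦ wordsStr (extendWords O ws)⟧ := by
  have key := Exec.loop_of_list (N := N) (a := Reg.wds) (b := .wds) (f := isSomeTest)
    (p := nextWord ;;
      .push .wds2 .or ;; .copy .x .wds2 .t ;;
      .push .wds2 .or ;; .copy .x .wds2 .t ;; .copy .x .wds2 .t ;;
      .copy .opt .oo .t ;;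
      .loop .oo .oo isSomeTest
        (.mvThru .endList .oo .t1 ;; .push .wds2 .or ;; .copy .x .wds2 .t ;; .mvAll .t1 .wds2) ;;
      .clear .x)
    ws (fun pre suf => s⟦.wds ↦ wordsStr suf⟧⟦.wds2 ↦ wordsStr (extendWords O pre)⟧)
    ((length_le_wordsStr ws).trans hN) ?_ ?_
  · refine Exec.seq (key.of_eq ?_) (((exec_mvAll (by simp) ?_).seq (exec_mvAll (by simp) ?_)).to ?_)
    · rw [← hw]
      simp [extendWords, wordsStr, ← hw2]
    · simpa using hN₂
    · simpa [ht1] using hN₂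
    · simp only [wordsStr, List.flatMap_nil]
      funext r
      simp only [Function.update_apply]
      grind
  · intro pre w suf e
    refine ⟨by simp [testVal, isSomeTest, wordsStr_cons], ?_⟩
    have hwm : w ∈ ws := by simp [e]
    have hwl := length_wordStr_lt hwm
    set acc := extendWords O pre with hacc
    have hfin : extendWords O (pre ++ [w]) = extendWord O w acc := by
      simp [extendWords, hacc]
    rw [hfin]
    refine Exec.seq (exec_nextWord (w := w) (v := wordsStr suf) (by simp [wordsStr_cons])
      (by simpa) (by simpa) (by omega)) ?_
    set s1 := s⟦.wds ↦ wordsStr suf⟧⟦.x ↦ wordStr w⟧ with hs1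
    have hs1t : s1 .t = [] := by simpa [hs1]
    have hs1x : s1 .x = wordStr w := by simp [hs1]
    refine Exec.seq (m := s1⟦.wds2 ↦ .or :: wordsStr acc⟧) ((Exec.push _ _ _).to ?_) ?_
    · funext r
      simp only [Function.update_apply, hs1]
      grind
    have hcopy : ∀ z : List Tok, Exec N (.copy .x .wds2 .t) s1⟦.wds2 ↦ z⟧ s1⟦.wds2 ↦ wordStr w ++ z⟧ := by
      intro z
      refine (exec_copy (by simp) (by simp) (by simp) (by simpa) ?_).to ?_
      · simp [hs1x]; omega
      · simp [hs1x]
    refine Exec.seq (hcopy _) (Exec.seq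
      (m := s1⟦.wds2 ↦ .or :: (wordStr w ++ .or :: wordsStr acc)⟧) ((Exec.push _ _ _).to (by simp))
      (Exec.seq (hcopy _) (Exec.seq (hcopy _) ?_)))
    have e1 : wordStr w ++ (wordStr w ++ Tok.or :: (wordStr w ++ Tok.or :: wordsStr acc)) =
        wordsStr ((w ++ w) :: w :: acc) := by
      simp [wordsStr_cons, wordStr]
    rw [e1]
    refine Exec.seq (m := s1⟦.wds2 ↦ wordsStr ((w ++ w) :: w :: acc)⟧⟦.oo ↦ wordStr O⟧)
      ((exec_copy (by simp) (by simp) (by simp) (by simpa) ?_).to ?_) ?_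
    · simpa [hs1, ho] using hN₁
    · simp [hs1, ho, hoo]
    have key2 := Exec.loop_of_list (N := N) (a := Reg.oo) (b := .oo) (f := isSomeTest)
      (p := .mvThru .endList .oo .t1 ;; .push .wds2 .or ;; .copy .x .wds2 .t ;; .mvAll .t1 .wds2)
      O (fun pre suf => s1⟦.wds2 ↦
        wordsStr ((pre.map fun A => A :: w).reverse ++ (w ++ w) :: w :: acc)⟧⟦.oo ↦ wordStr suf⟧)
      ((length_le_wordStr O).trans hN₁) ?_ ?_
    · refine Exec.seq (key2.of_eq (by simp)) ((exec_clear ?_).to ?_)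
      · simp [hs1x]; omega
      · simp only [extendWord, hs1, wordStr, List.flatMap_nil]
        funext r
        simp only [Function.update_apply]
        grind
    · intro pre' A suf' e'
      have hA : A ∈ O := by simp [e']
      have hAN := (length_encSet_le_wordStr hA).trans hN₁
      obtain ⟨u, hu, hun⟩ := exists_encSet_eq A
      have e2 : wordStr (A :: suf') = u ++ .endList :: wordStr suf' := by
        change encSet A ++ wordStr suf' = _
        simp [hu]
      have hun' : u.length + 1 ≤ N := by simpa [hu] using hAN
      refine ⟨?_, ?_⟩
      · simp only [testVal, Function.update_self, e2, isSomeTest]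
        cases u <;> simp
      rw [e2]
      set Z := wordsStr ((pre'.map fun A => A :: w).reverse ++ (w ++ w) :: w :: acc) with hZ
      have e3 : wordsStr (((pre' ++ [A]).map fun A => A :: w).reverse ++ (w ++ w) :: w :: acc) =
          (u ++ [.endList]) ++ (wordStr w ++ .or :: Z) := by
        rw [← hu, List.map_append, List.reverse_append]
        simp only [List.map_cons, List.map_nil, List.reverse_singleton, List.nil_append,
          List.cons_append]
        rw [wordsStr_cons, ← hZ]
        change encSet A ++ wordStr w ++ _ = _
        simp
      rw [e3]
      refine Exec.seq (m := s1⟦.wds2 ↦ Z⟧⟦.oo ↦ wordStr suf'⟧⟦.t1 ↦ (u ++ [Tok.endList]).reverse⟧)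
        ((exec_mvThru (by simp) (t := .endList) (u := u) (v := wordStr suf') (by simp) hun
          (by omega)).to ?_) ?_
      · simp [hs1, ht1]
      refine Exec.seq (m := s1⟦.wds2 ↦ .or :: Z⟧⟦.oo ↦ wordStr suf'⟧⟦.t1 ↦
        (u ++ [Tok.endList]).reverse⟧) ((Exec.push _ _ _).to ?_) ?_
      · funext r
        simp only [Function.update_apply]
        grind
      refine Exec.seq (m := s1⟦.wds2 ↦ wordStr w ++ .or :: Z⟧⟦.oo ↦ wordStr suf'⟧⟦.t1 ↦
        (u ++ [Tok.endList]).reverse⟧) ((exec_copy (by simp) (by simp) (by simp) (by simpa) ?_).to ?_) ?_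
      · simp [hs1x]; omega
      · funext r
        simp only [Function.update_apply]
        grind
      refine (exec_mvAll (by simp) ?_).to ?_
      · simpa using hun'
      · have : s1 .t1 = [] := by simpa [hs1]
        funext r
        simp only [Function.update_apply]
        grind
    · simp [testVal, isSomeTest, wordStr]
  · simp [testVal, isSomeTest, wordsStr]

/-- As many rounds of extension as there are tokens in `fuel`. -/
def roundsProg : Prog Reg := .loop .fuel .fuel isSomeTest (.pop .fuel ;; extendProg)

theorem exec_roundsProg {O : List (Finset ℕ)} {F : List Tok} {s : Store Reg}
    (hf : s .fuel = F) (hw : s .wds = wordsStr [[]]) (ho : s .opt = wordStr O) (hoo : s .oo = [])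
    (ht : s .t = []) (ht1 : s .t1 = []) (hx : s .x = []) (hw2 : s .wds2 = [])
    (hN : F.length ≤ N) (hN₁ : (wordStr O).length ≤ N)
    (hN₂ : ∀ i ≤ F.length, (wordsStr ((extendWords O)^[i] [[]])).length ≤ N) :
    Exec N roundsProg s s⟦.fuel ↦ []⟧⟦.wds ↦ wordsStr ((extendWords O)^[F.length] [[]])⟧ := by
  have key := Exec.loop_of_list (N := N) (a := Reg.fuel) (b := .fuel) (f := isSomeTest)
    (p := .pop .fuel ;; extendProg) F
    (fun pre suf => s⟦.fuel ↦ suf⟧⟦.wds ↦ wordsStr ((extendWords O)^[pre.length] [[]])⟧) hN ?_ ?_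
  · refine key.of_eq ?_
    rw [← hf]
    simp [← hw]
  · intro pre a suf e
    refine ⟨by simp [testVal, isSomeTest], ?_⟩
    refine Exec.seq (m := s⟦.fuel ↦ suf⟧⟦.wds ↦ wordsStr ((extendWords O)^[pre.length] [[]])⟧)
      ((Exec.pop _ _).to ?_) ((exec_extendProg (O := O) (ws := (extendWords O)^[pre.length] [[]])
        (by simp) (by simpa) (by simpa) (by simpa) (by simpa) (by simpa) (by simpa)
        (hN₂ _ (by simp [e])) hN₁ ?_).to ?_)
    · funext r
      simp only [Function.update_apply]
      grind
    · rw [← Function.iterate_succ_apply' (extendWords O)]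
      exact hN₂ _ (by simp [e])
    · simp [← Function.iterate_succ_apply' (extendWords O)]
  · simp [testVal, isSomeTest]

/-- Square the number of tokens in `fuel`. -/
def squareProg : Prog Reg :=
  .copy .fuel .oo .t ;; .loop .oo .oo isSomeTest (.pop .oo ;; .copy .fuel .fuel2 .t) ;;
  .clear .fuel ;; .mvAll .fuel2 .fuel

/-- Three applications turn `|Ψ|` tokens into the `|Ψ| ^ 8` that count the rounds. Only the number
of tokens matters, not which ones they are. -/
theorem exec_squareProg {s : Store Reg} (ht : s .t = []) (hoo : s .oo = []) (hf : s .fuel2 = [])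
    (hN : (s .fuel).length ^ 2 ≤ N) : ∃ F : List Tok, F.length = (s .fuel).length ^ 2 ∧
      Exec N squareProg s s⟦.fuel ↦ F⟧ := by
  set F := s .fuel with hF
  have hFN : F.length ≤ N := (Nat.le_self_pow (by omega) _).trans hN
  have hsq : (List.replicate F.length F).flatten.length = F.length ^ 2 := by
    simp [sq]
  refine ⟨(List.replicate F.length F).flatten.reverse, by simpa using hsq, ?_⟩
  refine Exec.seq (exec_copy (by simp) (by simp) (by simp) ht hFN) ?_
  have key := Exec.loop_of_list (N := N) (a := Reg.oo) (b := .oo) (f := isSomeTest)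
    (p := .pop .oo ;; .copy .fuel .fuel2 .t) F
    (fun pre suf => s⟦.oo ↦ suf⟧⟦.fuel2 ↦ (List.replicate pre.length F).flatten⟧) hFN ?_ ?_
  · refine Exec.seq (key.of_eq ?_) (((exec_clear ?_).seq (exec_mvAll (by simp) ?_)).to ?_)
    · rw [hoo, List.append_nil]
      rw [Function.update_eq_self_iff]
      simp [hf]
    · simpa [← hF] using hFN
    · rw [Function.update_of_ne (by simp), Function.update_self, hsq]
      exact hN
    · funext r
      simp only [Function.update_apply]
      grind
  · intro pre a suf e
    refine ⟨by simp [testVal, isSomeTest], ((Exec.pop _ _).seq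
      (exec_copy (by simp) (by simp) (by simp) (by simpa) (by simpa))).to ?_⟩
    rw [List.length_append, List.length_singleton, List.replicate_succ, List.flatten_cons]
    funext r
    simp only [Function.update_apply]
    grind
  · simp [testVal, isSomeTest]

end

section

variable {N : ℕ}

/-! ### Reading the input -/

theorem bits_injective : Function.Injective Nat.bits := by
  intro n m h
  rw [← Nat.ofDigits_digits 2 n, ← Nat.ofDigits_digits 2 m, Nat.digits_two_eq_bits,
    Nat.digits_two_eq_bits, h]

theorem append_cons_inj {a : Tok} : ∀ {x z u v : List Tok}, a ∉ x → a ∉ z →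
    x ++ a :: u = z ++ a :: v → x = z ∧ u = v
  | [], [], _, _, _, _, h => by simpa using h
  | [], b :: z, _, _, _, hz, h => by simp_all
  | b :: x, [], _, _, hx, _, h => by simp_all
  | b :: x, c :: z, u, v, hx, hz, h => by
    simp only [List.mem_cons, not_or, List.cons_append, List.cons.injEq] at hx hz h ⊢
    have := append_cons_inj hx.2 hz.2 h.2
    exact ⟨⟨h.1, this.1⟩, this.2⟩

/-- The codes are self-delimiting. Concatenated codes can therefore be told apart, and comparing the
strings of two unary types compares the types. -/
theorem encNat_append_inj {n m : ℕ} {u v : List Tok} (h : encNat n ++ u = encNat m ++ v) :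
    n = m ∧ u = v := by
  simp only [encNat, List.append_assoc, List.singleton_append] at h
  replace h := append_cons_inj (by simp) (by simp) h
  refine ⟨bits_injective (List.map_injective_iff.2 (fun a b e => by simpa using e) h.1), h.2⟩

theorem encList_append_inj {α : Type} {f : α → List Tok}
    (hf : ∀ a b u v, f a ++ u = f b ++ v → a = b ∧ u = v) :
    ∀ {l l' : List α} {u v : List Tok}, encList f l ++ u = encList f l' ++ v → l = l' ∧ u = v
  | [], [], u, v, h => by simpa [encList] using h
  | [], b :: l', u, v, h => by simp [encList] at h
  | a :: l, [], u, v, h => by simp [encList] at h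
  | a :: l, b :: l', u, v, h => by
    simp only [encList, List.flatMap_cons, List.cons_append, List.append_assoc, List.cons.injEq,
      true_and] at h
    obtain ⟨rfl, h⟩ := hf _ _ _ _ h
    have := encList_append_inj hf (l := l) (l' := l') (u := u) (v := v)
      (by simpa [encList] using h)
    simpa using this

theorem encSet_append_inj {A B : Finset ℕ} {u v : List Tok} (h : encSet A ++ u = encSet B ++ v) :
    A = B ∧ u = v := by
  obtain ⟨h, h'⟩ := encList_append_inj (fun _ _ _ _ => encNat_append_inj) h
  exact ⟨by rw [← A.sort_toFinset (· ≤ ·), h, Finset.sort_toFinset], h'⟩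

theorem encUnaryType_injective (Ψ : Sentence) :
    Function.Injective (encUnaryType (Ψ := Ψ)) := by
  rintro ⟨⟨a, ha⟩, ⟨b, hb⟩⟩ ⟨⟨a', ha'⟩, ⟨b', hb'⟩⟩ h
  obtain ⟨h1, h2⟩ := encSet_append_inj h
  replace h2 := (encSet_append_inj (u := []) (v := []) (by simpa using h2)).1
  simp only at h1 h2
  subst h1 h2
  rfl

/-- The sets of symbols `R` with `R(x,y)` in the label, for the listed edges from `π`. -/
def optionsList {Ψ : Sentence} (π : UnaryType Ψ) (es : List (Edge Ψ)) : List (Finset ℕ) :=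
  ((es.filter fun e => e.1 = π).map fun e => e.2.1.1.1.1).reverse

/-- Collect in `opt` the labels of the edges in `es` that start from the type in `pp`. -/
def filterProg : Prog Reg :=
  .loop .es .es (tokTest .item)
    (.pop .es ;; .mvUnaryType .es .t1 ;; .mvAll .t1 .y ;; .mvSet .es .t1 ;; .mvSet .es .j ;;
      .mvUnaryType .es .j ;; .copy .pp .kk .t ;; .loop .y .kk sameTest (.pop .y ;; .pop .kk) ;;
      .ite .y .kk bothNoneTest (.mvAll .t1 .opt) (.clear .t1) ;;
      .clear .y ;; .clear .kk ;; .clear .j) ;;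
  .pop .es

theorem exec_filterProg {Ψ : Sentence} {π : UnaryType Ψ} {es : List (Edge Ψ)} {s : Store Reg}
    (hes : s .es = encList encEdge es) (hpp : s .pp = encUnaryType π) (hopt : s .opt = [])
    (hy : s .y = []) (hkk : s .kk = []) (ht : s .t = []) (ht1 : s .t1 = []) (hj : s .j = [])
    (hN : (encList encEdge es).length ≤ N) (hN₁ : (encUnaryType π).length ≤ N) :
    Exec N filterProg s s⟦.es ↦ []⟧⟦.opt ↦ wordStr (optionsList π es)⟧ := by
  have key := Exec.loop_of_list (N := N) (a := Reg.es) (b := .es) (f := tokTest .item)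
    (p := .pop .es ;; .mvUnaryType .es .t1 ;; .mvAll .t1 .y ;; .mvSet .es .t1 ;; .mvSet .es .j ;;
      .mvUnaryType .es .j ;; .copy .pp .kk .t ;; .loop .y .kk sameTest (.pop .y ;; .pop .kk) ;;
      .ite .y .kk bothNoneTest (.mvAll .t1 .opt) (.clear .t1) ;;
      .clear .y ;; .clear .kk ;; .clear .j) es
    (fun pre suf => s⟦.es ↦ encList encEdge suf⟧⟦.opt ↦ wordStr (optionsList π pre)⟧)
    ((length_le_encList _ _).trans hN) ?_ ?_
  · refine (key.of_eq ?_).seq ((Exec.pop _ _).to ?_)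
    · rw [← hes]
      simp [optionsList, wordStr, ← hopt]
    · simp only [encList, List.flatMap_nil]
      funext r
      simp only [Function.update_apply]
      grind
  · intro pre e suf he
    refine ⟨by simp [testVal, tokTest, encList], ?_⟩
    have hel := (length_le_encList_of_mem encEdge (show e ∈ es by simp [he])).trans hN
    simp only [encEdge, List.length_append, encUnaryType] at hel
    have e1 : encList encEdge (e :: suf) = .item :: (encUnaryType e.1 ++ (encSet e.2.1.1.1.1 ++
        (encSet e.2.1.1.2.1 ++ (encUnaryType e.2.2 ++ encList encEdge suf)))) := by
      simp [encList, encEdge]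
    set S := encList encEdge suf with hS
    obtain ⟨O, hO⟩ : ∃ O, O = wordStr (optionsList π pre) := ⟨_, rfl⟩
    have hO' : wordStr (optionsList π (pre ++ [e])) =
        if e.1 = π then encSet e.2.1.1.1.1 ++ O else O := by
      rw [hO]
      split_ifs with h
      · simp [optionsList, wordStr, h]
      · simp [optionsList, h]
    rw [hO', e1, ← hO]
    have hu1 : (encUnaryType e.1).length ≤ N := by
      simp only [encUnaryType, List.length_append]; omega
    have hu2 : (encUnaryType e.2.2).length ≤ N := by
      simp only [encUnaryType, List.length_append]; omega
    have hlA : (encSet e.2.1.1.1.1).length ≤ N := by omega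
    have hlB : (encSet e.2.1.1.2.1).length ≤ N := by omega
    have hlBU : (encUnaryType e.2.2).length + (encSet e.2.1.1.2.1).length ≤ N := by
      simp only [encUnaryType, List.length_append]; omega
    set U := encUnaryType e.1 with hU
    set U' := encUnaryType e.2.2
    set A := encSet e.2.1.1.1.1
    set B := encSet e.2.1.1.2.1
    refine Exec.seq (m := s⟦.es ↦ U ++ (A ++ (B ++ (U' ++ S)))⟧⟦.opt ↦ O⟧)
      ((Exec.pop _ _).to ?_) ?_
    · funext r
      simp only [Function.update_apply]
      grind
    refine Exec.seq (m := s⟦.es ↦ A ++ (B ++ (U' ++ S))⟧⟦.opt ↦ O⟧⟦.t1 ↦ U.reverse⟧)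
      ((Moves.unaryType (by simp) e.1 hu1 _ (A ++ (B ++ (U' ++ S))) (by simp [hU])).to ?_) ?_
    · funext r
      simp only [Function.update_apply]
      grind
    refine Exec.seq (m := s⟦.es ↦ A ++ (B ++ (U' ++ S))⟧⟦.opt ↦ O⟧⟦.y ↦ U⟧)
      ((exec_mvAll (by simp) (by simpa using hu1)).to ?_) ?_
    · funext r
      simp only [Function.update_apply]
      grind
    -- The set stays reversed in `t1`, so that moving it to `opt` restores it. The rest of the edge
    -- goes to `j` and is dropped: the symbols `R` with `R(y,x)` in the label and the target do not
    -- enter the sums.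
    refine Exec.seq (m := s⟦.es ↦ B ++ (U' ++ S)⟧⟦.opt ↦ O⟧⟦.y ↦ U⟧⟦.t1 ↦ A.reverse⟧)
      ((Moves.set (by simp) e.2.1.1.1.1 hlA _ (B ++ (U' ++ S)) (by simp [A])).to ?_) ?_
    · funext r
      simp only [Function.update_apply]
      grind
    refine Exec.seq (m := s⟦.es ↦ U' ++ S⟧⟦.opt ↦ O⟧⟦.y ↦ U⟧⟦.t1 ↦ A.reverse⟧⟦.j ↦ B.reverse⟧)
      ((Moves.set (by simp) e.2.1.1.2.1 hlB _ (U' ++ S) (by simp [B])).to ?_) ?_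
    · funext r
      simp only [Function.update_apply]
      grind
    refine Exec.seq (m := s⟦.es ↦ S⟧⟦.opt ↦ O⟧⟦.y ↦ U⟧⟦.t1 ↦ A.reverse⟧⟦.j ↦
        U'.reverse ++ B.reverse⟧)
      ((Moves.unaryType (by simp) e.2.2 hu2 _ S (by simp [U'])).to ?_) ?_
    · funext r
      simp only [Function.update_apply]
      grind
    refine Exec.seq (exec_copy (by simp) (by simp) (by simp) (by simpa) (by simpa [hpp])) ?_
    obtain ⟨u, v, huv, hul, hvl, hex⟩ := exec_stripCommon (N := N) (a := Reg.y) (b := Reg.kk)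
      (by simp) (s⟦.es ↦ S⟧⟦.opt ↦ O⟧⟦.y ↦ U⟧⟦.t1 ↦ A.reverse⟧⟦.j ↦ U'.reverse ++ B.reverse⟧⟦.kk ↦
        s⟦.es ↦ S⟧⟦.opt ↦ O⟧⟦.y ↦ U⟧⟦.t1 ↦ A.reverse⟧⟦.j ↦ U'.reverse ++ B.reverse⟧ .pp ++
        s⟦.es ↦ S⟧⟦.opt ↦ O⟧⟦.y ↦ U⟧⟦.t1 ↦ A.reverse⟧⟦.j ↦ U'.reverse ++ B.reverse⟧ .kk⟧)
      (by simpa using hu1)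
    refine Exec.seq hex ?_
    simp only [ne_eq, reduceCtorEq, not_false_eq_true, Function.update_of_ne, Function.update_self,
      hpp, hkk, List.append_nil] at huv hul hvl
    -- Equality of strings is equality of types, because the code is injective.
    have hiff : (u = [] ∧ v = []) ↔ e.1 = π := by
      rw [huv, hU]
      exact (encUnaryType_injective Ψ).eq_iff
    refine Exec.seq (m := s⟦.es ↦ S⟧⟦.opt ↦ if e.1 = π then A ++ O else O⟧⟦.y ↦ u⟧⟦.kk ↦ v⟧⟦.j ↦
      U'.reverse ++ B.reverse⟧) ?_ ?_
    · by_cases hπ : e.1 = π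
      · obtain ⟨rfl, rfl⟩ := hiff.2 hπ
        refine Exec.ite_pos (by simp [testVal, bothNoneTest]) ((exec_mvAll (by simp) ?_).to ?_)
        · simpa using hlA
        · rw [if_pos hπ]
          funext r
          simp only [Function.update_apply]
          grind
      · refine Exec.ite_neg ?_ ((exec_clear ?_).to ?_)
        · rw [← hiff] at hπ
          cases u <;> cases v <;> simp_all [testVal, bothNoneTest]
        · simpa using hlA
        · rw [if_neg hπ]
          funext r
          simp only [Function.update_apply]
          grind
    · refine ((exec_clear ?_).seq ((exec_clear ?_).seq (exec_clear ?_))).to ?_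
      · simp; omega
      · simp; omega
      · simpa using hlBU
      · funext r
        simp only [Function.update_apply]
        grind
  · simp [testVal, tokTest, encList]

/-- Distribute the input over the registers, and put as many tokens into `fuel` as the sentence
has. -/
def parseProg : Prog Reg :=
  .mvQF .inp .fuel .pend ;; .mvGuarded .inp .fuel .pend ;; .mvCounting .inp .t1 ;;
  .copy .t1 .fuel .t ;; .mvAll .t1 .cn ;; .mvList (.mvUnaryType .inp .j) .inp .j ;; .clear .j ;;
  .mvList (.mvEdge .inp .t1) .inp .t1 ;; .mvAll .t1 .es ;; .mvUnaryType .inp .t1 ;;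
  .mvAll .t1 .pp ;; .mvSet .inp .t1 ;; .mvAll .t1 .he ;; .clear .inp

set_option maxHeartbeats 1000000 in
theorem exec_parseProg (Ψ : Sentence) (vs : List (UnaryType Ψ)) (es : List (Edge Ψ)) (e : Edge Ψ)
    (hN : (Ψ.enc ++ encList encUnaryType vs ++ encList encEdge es ++ encEdge e).length ≤ N) :
    ∃ F : List Tok, F.length = Ψ.length ∧
      Exec N parseProg
        (fun r => if r = .inp then
          Ψ.enc ++ encList encUnaryType vs ++ encList encEdge es ++ encEdge e else [])
        (fun _ => [])⟦.fuel ↦ F⟧⟦.cn ↦ encList (fun c => c.1.enc ++ c.2.enc) Ψ.counting⟧⟦.es ↦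
          encList encEdge es⟧⟦.pp ↦ encUnaryType e.1⟧⟦.he ↦ encSet e.2.1.1.1.1⟧ := by
  have hlen : Ψ.gamma.enc.length ≤ N ∧
      (encList (fun c => encNat c.1 ++ c.2.enc) Ψ.guarded).length ≤ N ∧
      (encList (fun c => c.1.enc ++ c.2.enc) Ψ.counting).length ≤ N ∧
      (encList encUnaryType vs).length ≤ N ∧ (encList encEdge es).length ≤ N ∧
      (encUnaryType e.1).length ≤ N ∧ (encSet e.2.1.1.1.1).length ≤ N := by
    simp only [Sentence.enc, encEdge, List.length_append] at hN
    omega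
  obtain ⟨hlΓ, hlΓ', hlC, hlV, hlE, hlP, hlA⟩ := hlen
  have hL : Ψ.length = (encList (fun c => c.1.enc ++ c.2.enc) Ψ.counting).length +
      ((encList (fun c => encNat c.1 ++ c.2.enc) Ψ.guarded).length + Ψ.gamma.enc.length) := by
    simp only [Sentence.length, Sentence.enc, List.length_append]
    omega
  set W := Ψ.enc ++ encList encUnaryType vs ++ encList encEdge es ++ encEdge e with hW
  set Γ := Ψ.gamma.enc with hΓ
  set Γ' := encList (fun c => encNat c.1 ++ c.2.enc) Ψ.guarded with hΓ'
  set C := encList (fun c => c.1.enc ++ c.2.enc) Ψ.counting with hC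
  set V := encList encUnaryType vs with hV
  set E := encList encEdge es with hE
  set P := encUnaryType e.1 with hP
  set A := encSet e.2.1.1.1.1 with hA
  set R := encSet e.2.1.1.2.1 ++ encUnaryType e.2.2 with hR
  have hW' : W = Γ ++ (Γ' ++ (C ++ (V ++ (E ++ (P ++ (A ++ R)))))) := by
    simp [hW, Sentence.enc, encEdge, hR, ← hΓ, ← hΓ', ← hC, ← hP, ← hA]
  have hl : Γ.length + (Γ'.length + (C.length + (V.length + (E.length + (P.length +
      (A.length + R.length)))))) ≤ N := by
    simpa [hW'] using hN
  set s : Store Reg := fun _ => [] with hs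
  have hs0 : ∀ r, s r = [] := fun _ => rfl
  -- All tokens of the sentence end up in `fuel`; their order there is immaterial.
  refine ⟨C.reverse ++ (Γ'.reverse ++ Γ.reverse), ?_, ?_⟩
  · simp only [List.length_append, List.length_reverse, hL]
  have hinit : (fun r : Reg => if r = .inp then W else []) = s⟦.inp ↦ W⟧ := by
    funext r
    simp only [Function.update_apply, hs]
  rw [hinit, hW']
  refine Exec.seq (m := s⟦.inp ↦ Γ' ++ (C ++ (V ++ (E ++ (P ++ (A ++ R)))))⟧⟦.fuel ↦ Γ.reverse⟧)
    ((Moves.qf (by simp) (by simp) (by simp) Ψ.gamma hlΓ _ _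
      (by simp only [Function.update_self]; rfl)).to ?_) ?_
  · simp [hs, ← hΓ]
  refine Exec.seq (m := s⟦.inp ↦ C ++ (V ++ (E ++ (P ++ (A ++ R))))⟧⟦.fuel ↦
      Γ'.reverse ++ Γ.reverse⟧)
    ((Moves.guarded (by simp) (by simp) (by simp) Ψ.guarded hlΓ' _
      (C ++ (V ++ (E ++ (P ++ (A ++ R))))) (by simp [hΓ'])).to ?_) ?_
  · funext r
    simp only [Function.update_apply]
    grind
  refine Exec.seq (m := s⟦.inp ↦ V ++ (E ++ (P ++ (A ++ R)))⟧⟦.fuel ↦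
      Γ'.reverse ++ Γ.reverse⟧⟦.t1 ↦ C.reverse⟧)
    ((Moves.counting (by simp) Ψ.counting hlC _
      (V ++ (E ++ (P ++ (A ++ R)))) (by simp [hC])).to ?_) ?_
  · funext r
    simp only [Function.update_apply]
    grind
  refine Exec.seq (m := s⟦.inp ↦ V ++ (E ++ (P ++ (A ++ R)))⟧⟦.fuel ↦
      C.reverse ++ (Γ'.reverse ++ Γ.reverse)⟧⟦.t1 ↦ C.reverse⟧)
    ((exec_copy (by simp) (by simp) (by simp) (by simp [hs0]) (by simp; omega)).to ?_) ?_
  · funext r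
    simp only [Function.update_apply]
    grind
  set F := C.reverse ++ (Γ'.reverse ++ Γ.reverse)
  refine Exec.seq (m := s⟦.inp ↦ V ++ (E ++ (P ++ (A ++ R)))⟧⟦.fuel ↦ F⟧⟦.cn ↦ C⟧)
    ((exec_mvAll (by simp) (by simp; omega)).to ?_) ?_
  · funext r
    simp only [Function.update_apply]
    grind
  -- The vertex list is read only to be discarded: the system depends on the edges alone.
  refine Exec.seq (m := s⟦.inp ↦ E ++ (P ++ (A ++ R))⟧⟦.fuel ↦ F⟧⟦.cn ↦ C⟧⟦.j ↦ V.reverse⟧)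
    ((Moves.list' (by simp) (l := vs) (f := encUnaryType) hlV
      (fun x hx => Moves.unaryType (by simp) x hx) _ (E ++ (P ++ (A ++ R))) (by simp [hV])).to ?_) ?_
  · funext r
    simp only [Function.update_apply]
    grind
  refine Exec.seq (m := s⟦.inp ↦ E ++ (P ++ (A ++ R))⟧⟦.fuel ↦ F⟧⟦.cn ↦ C⟧)
    ((exec_clear (by simp; omega)).to ?_) ?_
  · funext r
    simp only [Function.update_apply]
    grind
  refine Exec.seq (m := s⟦.inp ↦ P ++ (A ++ R)⟧⟦.fuel ↦ F⟧⟦.cn ↦ C⟧⟦.t1 ↦ E.reverse⟧)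
    ((Moves.list' (by simp) (l := es) (f := encEdge) hlE
      (fun x hx => Moves.edge (by simp) x hx) _ (P ++ (A ++ R)) (by simp [hE])).to ?_) ?_
  · funext r
    simp only [Function.update_apply]
    grind
  refine Exec.seq (m := s⟦.inp ↦ P ++ (A ++ R)⟧⟦.fuel ↦ F⟧⟦.cn ↦ C⟧⟦.es ↦ E⟧)
    ((exec_mvAll (by simp) (by simp; omega)).to ?_) ?_
  · funext r
    simp only [Function.update_apply]
    grind
  refine Exec.seq (m := s⟦.inp ↦ A ++ R⟧⟦.fuel ↦ F⟧⟦.cn ↦ C⟧⟦.es ↦ E⟧⟦.t1 ↦ P.reverse⟧)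
    ((Moves.unaryType (by simp) e.1 hlP _ (A ++ R) (by simp [hP])).to ?_) ?_
  · funext r
    simp only [Function.update_apply]
    grind
  refine Exec.seq (m := s⟦.inp ↦ A ++ R⟧⟦.fuel ↦ F⟧⟦.cn ↦ C⟧⟦.es ↦ E⟧⟦.pp ↦ P⟧)
    ((exec_mvAll (by simp) (by simp; omega)).to ?_) ?_
  · funext r
    simp only [Function.update_apply]
    grind
  refine Exec.seq (m := s⟦.inp ↦ R⟧⟦.fuel ↦ F⟧⟦.cn ↦ C⟧⟦.es ↦ E⟧⟦.pp ↦ P⟧⟦.t1 ↦ A.reverse⟧)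
    ((Moves.set (by simp) e.2.1.1.1.1 hlA _ R (by simp [hA])).to ?_) ?_
  · funext r
    simp only [Function.update_apply]
    grind
  refine Exec.seq (m := s⟦.inp ↦ R⟧⟦.fuel ↦ F⟧⟦.cn ↦ C⟧⟦.es ↦ E⟧⟦.pp ↦ P⟧⟦.he ↦ A⟧)
    ((exec_mvAll (by simp) (by simp; omega)).to ?_) ?_
  · funext r
    simp only [Function.update_apply]
    grind
  refine (exec_clear (by simp; omega)).to ?_
  funext r
  simp only [Function.update_apply]
  grind

/-! ### The whole program -/

/-- Decide whether the system of the given edge is solvable. -/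
def decideProg : Prog Reg :=
  parseProg ;; filterProg ;; squareProg ;; squareProg ;; squareProg ;; .push .wds .or ;;
  roundsProg ;; checkAllProg ;; .clear .cn ;; .clear .pp ;; .clear .he ;; .clear .opt

theorem exec_decideProg (Ψ : Sentence) (vs : List (UnaryType Ψ)) (es : List (Edge Ψ)) (e : Edge Ψ)
    (hN : (Ψ.enc ++ encList encUnaryType vs ++ encList encEdge es ++ encEdge e).length ≤ N)
    (hN₁ : (wordStr (optionsList e.1 es)).length ≤ N) (hN₂ : Ψ.length ^ 8 ≤ N)
    (hN₃ : ∀ i ≤ Ψ.length ^ 8, (encSet e.2.1.1.1.1).length +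
      (wordsStr ((extendWords (optionsList e.1 es))^[i] [[]])).length ≤ N)
    (hN₄ : ∀ d ∈ Ψ.counting,
      ((wordsStr ((extendWords (optionsList e.1 es))^[Ψ.length ^ 8] [[]])).length + 2) *
        (2 * d.2.weight + 1) ≤ N) {b : Bool}
    (hb : b = true ↔ ∃ w ∈ (extendWords (optionsList e.1 es))^[Ψ.length ^ 8] [[]],
      ∀ d ∈ Ψ.counting, ¬ Violates e.1 (e.2.1.1.1.1 :: w) d) :
    Exec N decideProg
      (fun r => if r = .inp then
        Ψ.enc ++ encList encUnaryType vs ++ encList encEdge es ++ encEdge e else [])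
      (fun r => if r = .res ∧ b = true then [.top] else []) := by
  obtain ⟨F, hF, hparse⟩ := exec_parseProg Ψ vs es e hN
  refine Exec.seq hparse ?_
  have hl : (encList (fun c => c.1.enc ++ c.2.enc) Ψ.counting).length ≤ N ∧
      (encList encEdge es).length ≤ N ∧ (encUnaryType e.1).length ≤ N ∧
      (encSet e.2.1.1.1.1).length ≤ N := by
    simp only [Sentence.enc, encEdge, List.length_append] at hN
    omega
  obtain ⟨hl1, hl2, hl3, hl4⟩ := hl
  have hL : 1 ≤ Ψ.length := by
    simp only [Sentence.length, Sentence.enc, encList, List.length_append, List.length_singleton]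
    omega
  set O := optionsList e.1 es with hO
  set L := Ψ.length
  set C := encList (fun c => c.1.enc ++ c.2.enc) Ψ.counting
  set P := encUnaryType e.1
  set A := encSet e.2.1.1.1.1 with hA
  set s : Store Reg := (fun _ => [])⟦.cn ↦ C⟧⟦.pp ↦ P⟧⟦.he ↦ A⟧⟦.opt ↦ wordStr O⟧ with hs
  refine Exec.seq (m := s⟦.fuel ↦ F⟧) ((exec_filterProg (π := e.1) (es := es) (by simp) (by simp [P])
    (by simp) (by simp) (by simp) (by simp) (by simp) (by simp) hl2 hl3).to ?_) ?_
  · rw [hs]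
    funext r
    simp only [Function.update_apply]
    grind
  -- The three squarings take `fuel` from `L` to `L ^ 2`, `L ^ 4` and `L ^ 8` tokens.
  have hL2 : (L ^ 1) ^ 2 ≤ N := by
    refine le_trans ?_ hN₂
    rw [← pow_mul]
    exact Nat.pow_le_pow_right hL (by omega)
  have hL4 : (L ^ 2) ^ 2 ≤ N := by
    refine le_trans ?_ hN₂
    rw [← pow_mul]
    exact Nat.pow_le_pow_right hL (by omega)
  have hL8 : (L ^ 4) ^ 2 ≤ N := by
    rwa [← pow_mul]
  obtain ⟨F1, hF1, h1⟩ := exec_squareProg (N := N) (s := s⟦.fuel ↦ F⟧) (by simp [hs]) (by simp [hs])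
    (by simp [hs]) (by simpa [hF] using hL2)
  refine Exec.seq h1 ?_
  simp only [Function.update_self, hF, Function.update_idem] at hF1 ⊢
  obtain ⟨F2, hF2, h2⟩ := exec_squareProg (N := N) (s := s⟦.fuel ↦ F1⟧) (by simp [hs])
    (by simp [hs]) (by simp [hs]) (by simpa [hF1] using hL4)
  refine Exec.seq h2 ?_
  simp only [Function.update_self, hF1, Function.update_idem, ← pow_mul] at hF2 ⊢
  obtain ⟨F3, hF3, h3⟩ := exec_squareProg (N := N) (s := s⟦.fuel ↦ F2⟧) (by simp [hs])
    (by simp [hs]) (by simp [hs]) (by simpa [hF2] using hL8)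
  refine Exec.seq h3 ?_
  simp only [Function.update_self, hF2, Function.update_idem, ← pow_mul] at hF3 ⊢
  norm_num at hF3
  refine Exec.seq (m := s⟦.fuel ↦ F3⟧⟦.wds ↦ wordsStr [[]]⟧) ((Exec.push _ _ _).to ?_) ?_
  · simp [hs, wordsStr, wordStr]
  refine Exec.seq (m := s⟦.wds ↦ wordsStr ((extendWords O)^[L ^ 8] [[]])⟧)
    ((exec_roundsProg (O := O) (F := F3) (by simp) (by simp) (by simp [hs]) (by simp [hs])
      (by simp [hs]) (by simp [hs]) (by simp [hs]) (by simp [hs]) (by omega) hN₁ ?_).to ?_) ?_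
  · intro i hi
    have := hN₃ i (by omega)
    omega
  · rw [hF3]
    funext r
    simp only [Function.update_apply, hs]
    grind
  refine Exec.seq (exec_checkAllProg (π := e.1) (A := e.2.1.1.1.1)
    (ws := (extendWords O)^[L ^ 8] [[]]) ?_ (by simp) (by simp [hs, P]) (by simp [hs, C])
    (by simp [hs, A]) (by simp [hs]) (by simp [hs]) (by simp [hs]) (by simp [hs]) hl3 hl1
    (hN₃ _ le_rfl) hN₄) ?_
  · constructor
    · constructor <;> simp [hs]
    all_goals simp [hs]
  refine ((exec_clear ?_).seq ((exec_clear ?_).seq ((exec_clear ?_).seq (exec_clear ?_)))).to ?_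
  · simpa [hs] using hl1
  · simpa [hs] using hl3
  · simpa [hs] using hl4
  · simpa [hs] using hN₁
  · simp only [← hb]
    funext r
    simp only [Function.update_apply, hs]
    grind

end

/-! ### Small solutions of linear systems over the natural numbers -/

section

variable {ι : Type} [Fintype ι] {m : Type} {A : Matrix m ι ℤ} {b : m → ℤ}

open Matrix in
/-- `x` solves `A x = b`. -/
def Solves (A : Matrix m ι ℤ) (b : m → ℤ) (x : ι → ℕ) : Prop := A *ᵥ (fun j => (x j : ℤ)) = b

/-- There is a solution that has no short kernel vector supported on its entries above `D`. -/
theorem exists_reduced_solution (S : Finset ι) (D : ℕ) {x₀ : ι → ℕ} (h₀ : Solves A b x₀)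
    (hS₀ : ∀ j, x₀ j ≠ 0 → j ∈ S) :
    ∃ x, Solves A b x ∧ (∀ j, x j ≠ 0 → j ∈ S) ∧
      ∀ g : ι → ℤ, A.mulVec g = 0 → (∀ j, g j ≠ 0 → D < x j) → (∀ j, |g j| ≤ D + 1) → g = 0 := by
  classical
  set J : (ι → ℕ) → Finset ι := fun x => Finset.univ.filter fun j => D < x j with hJ
  have hJm : ∀ x j, j ∈ J x ↔ D < x j := by simp [hJ]
  -- First minimisation: as few entries above `D` as possible, among the solutions supported in `S`.
  obtain ⟨x, ⟨hx, hxS⟩, hmin⟩ := (measure fun x => (J x).card).wf.has_min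
    {x | Solves A b x ∧ ∀ j, x j ≠ 0 → j ∈ S} ⟨x₀, h₀, hS₀⟩
  refine ⟨x, hx, hxS, ?_⟩
  have key : ∀ g : ι → ℤ, A.mulVec g = 0 → (∀ j, g j ≠ 0 → D < x j) → (∀ j, |g j| ≤ D + 1) →
      ∀ j, ¬ g j < 0 := by
    intro g hg hgJ hgD j hj
    -- Second minimisation: given a kernel vector with `g j < 0`, take the smallest possible entry
    -- at `j` among the solutions with the same set of large entries. Adding `g` once more will
    -- contradict this choice.
    obtain ⟨y, ⟨hy, hyS, hyJ⟩, hymin⟩ := (measure fun y : ι → ℕ => y j).wf.has_min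
      {y | Solves A b y ∧ (∀ j, y j ≠ 0 → j ∈ S) ∧ J y = J x} ⟨x, hx, hxS, rfl⟩
    have hyg : ∀ k, g k ≠ 0 → D < y k := fun k hk => by
      rw [← hJm, hyJ, hJm]; exact hgJ k hk
    -- Where `g` is nonzero, `y` is at least `D + 1`, which is also the bound on `|g|`.
    have hpos : ∀ k, 0 ≤ (y k : ℤ) + g k := by
      intro k
      by_cases hk : g k = 0
      · simp [hk]
      · have h1 := hyg k hk
        have h2 := neg_le_of_abs_le (hgD k)
        omega
    have hz : ∀ k, ((((y k : ℤ) + g k).toNat : ℕ) : ℤ) = y k + g k :=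
      fun k => Int.toNat_of_nonneg (hpos k)
    set z : ι → ℕ := fun k => ((y k : ℤ) + g k).toNat with hzdef
    have hzs : Solves A b z := by
      have : (fun k => (z k : ℤ)) = (fun k => (y k : ℤ)) + g := by
        funext k; exact hz k
      rw [Solves, this, Matrix.mulVec_add, hg, add_zero]
      exact hy
    have hzS : ∀ k, z k ≠ 0 → k ∈ S := by
      intro k hk
      by_cases hgk : g k = 0
      · refine hyS k ?_
        have := hz k
        rw [hgk] at this
        intro h0
        apply hk
        simp only [hzdef]
        omega
      · exact hyS k (by have := hyg k hgk; omega)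
    -- Entries that `g` changes were already large, so no new large entry appears. By the first
    -- minimisation none disappears either.
    have hzJ : J z ⊆ J x := by
      intro k hk
      rw [hJm] at hk
      rw [← hyJ, hJm]
      by_cases hgk : g k = 0
      · have := hz k
        rw [hgk] at this
        simp only [hzdef] at hk
        omega
      · exact hyg k hgk
    have hzJ' : J z = J x := by
      refine Finset.eq_of_subset_of_card_le hzJ ?_
      by_contra hlt
      exact hmin z ⟨hzs, hzS⟩ (not_le.1 hlt)
    refine hymin z ⟨hzs, hzS, hzJ'⟩ ?_
    change z j < y j
    have := hz j
    simp only [hzdef]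
    omega
  intro g hg hgJ hgD
  funext j
  have h1 := key g hg hgJ hgD j
  -- The hypotheses on `g` are symmetric under a change of sign, so `g` has no positive entry
  -- either.
  have h2 := key (-g) (by rw [Matrix.mulVec_neg, hg, neg_zero]) (fun j hj => hgJ j (by simpa using hj))
    (fun j => by simpa using hgD j) j
  simp only [Pi.neg_apply] at h2
  simp only [Pi.zero_apply]
  omega

/-- If no kernel vector with entries in `{-1, 0, 1}` is supported on `T`, then `T` is small. -/
theorem two_pow_card_le_of_no_short_kernel {d M : ℕ} {A : Matrix (Fin d) ι ℤ}
    (hA : ∀ i j, (A i j).natAbs ≤ M) (T : Finset ι)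
    (h : ∀ g : ι → ℤ, A.mulVec g = 0 → (∀ j, g j ≠ 0 → j ∈ T) → (∀ j, |g j| ≤ 1) → g = 0) :
    2 ^ T.card ≤ (2 * T.card * M + 1) ^ d := by
  classical
  -- Pigeonhole on subset sums: all sums of columns over subsets of `T` lie in a box with `(2 |T| M
  -- + 1) ^ d` integer points.
  have hsum : ∀ U ⊆ T, ∀ i, ∑ j ∈ U, A i j ∈ Finset.Icc (-(T.card * M : ℤ)) (T.card * M) := by
    intro U hU i
    have h1 : |∑ j ∈ U, A i j| ≤ T.card * M := by
      calc |∑ j ∈ U, A i j| ≤ ∑ j ∈ U, |A i j| := Finset.abs_sum_le_sum_abs _ _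
        _ ≤ ∑ j ∈ U, (M : ℤ) := Finset.sum_le_sum fun j _ => by
            have := hA i j; rw [Int.abs_eq_natAbs]; exact_mod_cast this
        _ = U.card * M := by simp
        _ ≤ T.card * M := by
            have := Finset.card_le_card hU
            gcongr
    rw [Finset.mem_Icc]
    exact abs_le.1 h1
  have hcard : (Fintype.piFinset fun _ : Fin d =>
      Finset.Icc (-(T.card * M : ℤ)) (T.card * M)).card = (2 * T.card * M + 1) ^ d := by
    rw [Fintype.card_piFinset]
    simp only [Int.card_Icc, Finset.prod_const, Finset.card_univ, Fintype.card_fin]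
    congr 1
    have : (T.card * M : ℤ) + 1 - -(T.card * M) = ((2 * T.card * M + 1 : ℕ) : ℤ) := by
      push_cast; ring
    rw [this, Int.toNat_natCast]
  rw [← hcard, ← Finset.card_powerset]
  refine Finset.card_le_card_of_injOn (fun U i => ∑ j ∈ U, A i j) ?_ ?_
  · intro U hU
    have hU' : U ⊆ T := by simpa using hU
    simpa only [Finset.mem_coe, Fintype.mem_piFinset] using hsum U hU'
  · intro U hU V hV hUV
    have hU' : U ⊆ T := by simpa using hU
    have hV' : V ⊆ T := by simpa using hV
    -- If two subsets have the same sum, the difference of their indicators is a kernel vector with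
    -- entries in `{-1, 0, 1}`.
    have := h (fun j => (if j ∈ U then 1 else 0) - (if j ∈ V then 1 else 0)) ?_ ?_ ?_
    · ext j
      have := congrFun this j
      simp only [Pi.zero_apply] at this
      by_cases h1 : j ∈ U <;> by_cases h2 : j ∈ V <;> simp_all
    · funext i
      have := congrFun hUV i
      simp only [Matrix.mulVec, dotProduct, mul_sub, Finset.sum_sub_distrib, mul_ite, mul_one,
        mul_zero, Finset.sum_ite_mem, Finset.univ_inter, Pi.zero_apply]
      simpa [sub_eq_zero] using this
    · intro j hj
      by_cases h1 : j ∈ U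
      · exact hU' h1
      · by_cases h2 : j ∈ V
        · exact hV' h2
        · simp [h1, h2] at hj
    · intro j
      by_cases h1 : j ∈ U <;> by_cases h2 : j ∈ V <;> simp [h1, h2]

/-- The convex function `2 ^ x` lies above its tangent at `2`, where it has value `4` and slope `4
log 2 > 2`. -/
theorem two_mul_le_two_rpow {x : ℝ} (hx : 2 ≤ x) : 2 * x ≤ (2 : ℝ) ^ x := by
  have h1 : (2 : ℝ) ^ x = 4 * (2 : ℝ) ^ (x - 2) := by
    rw [Real.rpow_sub (by norm_num)]
    norm_num
    ring
  have h2 : (x - 2) * Real.log 2 + 1 ≤ (2 : ℝ) ^ (x - 2) := by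
    rw [Real.rpow_def_of_pos (by norm_num), mul_comm (Real.log 2)]
    exact Real.add_one_le_exp _
  have h3 := Real.log_two_gt_d9
  nlinarith

/-- Write `k = 2 d x` and `w = 2 ^ x`, so that `2 ^ k = (w ^ 2) ^ d`. If `k` exceeded the bound,
then `4 d M < w`, and with `2 x ≤ w` it would follow that `2 k M + 1 = 4 d M x + 1 < w ^ 2`,
contrary to the hypothesis. -/
theorem le_of_two_pow_le {d M k : ℕ} (hd : 1 ≤ d) (hM : 1 ≤ M)
    (h : 2 ^ k ≤ (2 * k * M + 1) ^ d) : (k : ℝ) ≤ 2 * d * Real.logb 2 (4 * d * M) := by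
  by_contra hlt
  rw [not_le] at hlt
  have hd' : (1 : ℝ) ≤ d := by exact_mod_cast hd
  have hM' : (1 : ℝ) ≤ M := by exact_mod_cast hM
  have hu : (4 : ℝ) ≤ 4 * d * M := by nlinarith
  set x : ℝ := k / (2 * d) with hx
  have hk : (k : ℝ) = 2 * d * x := by rw [hx]; field_simp
  have hlx : Real.logb 2 (4 * d * M) < x := by
    rw [hk] at hlt
    exact lt_of_mul_lt_mul_left hlt (by positivity)
  set w : ℝ := (2 : ℝ) ^ x with hw
  have huw : 4 * d * M < w := by
    rw [hw]
    exact (Real.logb_lt_iff_lt_rpow (by norm_num) (by linarith)).1 hlx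
  have hx2 : 2 ≤ x := by
    have : Real.logb 2 4 = 2 := by
      rw [show (4 : ℝ) = 2 ^ (2 : ℝ) by norm_num, Real.logb_rpow (by norm_num) (by norm_num)]
    have h2 : Real.logb 2 4 ≤ Real.logb 2 (4 * d * M) :=
      Real.logb_le_logb_of_le (by norm_num) (by norm_num) hu
    linarith
  have hxw := two_mul_le_two_rpow hx2
  rw [← hw] at hxw
  have hlt2 : (2 * k * M + 1 : ℝ) < w ^ 2 := by
    rw [hk]
    have : 4 * d * M * x ≤ w * (w / 2) :=
      mul_le_mul huw.le (by linarith) (by linarith) (by linarith)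
    nlinarith
  have hpow : ((2 : ℝ) ^ k) = (w ^ 2) ^ d := by
    rw [← Real.rpow_natCast, hk, hw, ← Real.rpow_natCast, ← Real.rpow_natCast,
      ← Real.rpow_mul (by positivity), ← Real.rpow_mul (by norm_num)]
    congr 1
    push_cast
    ring
  have hh : ((2 : ℝ) ^ k) ≤ (2 * k * M + 1) ^ d := by exact_mod_cast h
  rw [hpow] at hh
  exact absurd hh (not_le.2 (pow_lt_pow_left₀ hlt2 (by positivity) (by omega)))

end

/-! ### Nonsingular minors, determinant bounds and Cramer's rule -/

section

variable {κ : Type} [Fintype κ] [DecidableEq κ]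

/-- Row rank equals column rank, so as many independent rows as there are columns can be selected;
they form a nonsingular square matrix over the rationals, and the determinant is the same over the
integers. -/
theorem exists_minor {m : Type} [Fintype m] (C : Matrix m κ ℤ)
    (h : LinearIndependent ℚ (C.map (Int.cast : ℤ → ℚ)).col) :
    ∃ f : κ → m, Function.Injective f ∧ (C.submatrix f id).det ≠ 0 := by
  set Q := C.map (Int.cast : ℤ → ℚ) with hQ
  have hrank : Module.finrank ℚ (Submodule.span ℚ (Set.range Q.row)) = Fintype.card κ := by
    rw [← Matrix.rank_eq_finrank_span_row, ← Matrix.rank_transpose]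
    exact LinearIndependent.rank_matrix (M := Q.transpose) h
  obtain ⟨f, hf, -, hind⟩ := Submodule.exists_fun_fin_finrank_span_eq ℚ (Set.range Q.row)
  choose r hr using hf
  let e : κ ≃ Fin (Module.finrank ℚ (Submodule.span ℚ (Set.range Q.row))) :=
    (Fintype.equivFin κ).trans (finCongr hrank.symm)
  have hrow : (Q.submatrix (r ∘ e) id).row = f ∘ e := by
    funext k
    simp only [Function.comp_apply, ← hr]
    rfl
  have hind' : LinearIndependent ℚ (Q.submatrix (r ∘ e) id).row := by
    rw [hrow]
    exact hind.comp _ e.injective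
  refine ⟨r ∘ e, ?_, ?_⟩
  · intro a b hab
    have := hind'.injective (a₁ := a) (a₂ := b) (by
      funext j
      change Q (r (e a)) j = Q (r (e b)) j
      rw [show r (e a) = r (e b) from hab])
    exact this
  · have hu := Matrix.linearIndependent_rows_iff_isUnit.1 hind'
    rw [Matrix.isUnit_iff_isUnit_det, isUnit_iff_ne_zero] at hu
    intro h0
    apply hu
    have : Q.submatrix (r ∘ e) id = (C.submatrix (r ∘ e) id).map (Int.castRingHom ℚ) := rfl
    rw [this, ← RingHom.mapMatrix_apply, ← RingHom.map_det, h0, map_zero]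

/-- The Leibniz expansion has `|κ|!` terms of size at most `M ^ |κ|`, and `|κ|! ≤ |κ| ^ |κ|`. -/
theorem natAbs_det_le {d M : ℕ} (hM : 1 ≤ M) (hκ : Fintype.card κ ≤ d) (hd : 1 ≤ d)
    {B : Matrix κ κ ℤ} (hB : ∀ i j, (B i j).natAbs ≤ M) : B.det.natAbs ≤ (d * M) ^ d := by
  have h1 := Matrix.det_le (A := B) (abv := (AbsoluteValue.abs : AbsoluteValue ℤ ℤ)) (x := (M : ℤ))
    (fun i j => by
      rw [AbsoluteValue.abs_apply, Int.abs_eq_natAbs]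
      exact_mod_cast hB i j)
  rw [AbsoluteValue.abs_apply, Int.abs_eq_natAbs, nsmul_eq_mul] at h1
  have h2 : B.det.natAbs ≤ (Fintype.card κ).factorial * M ^ Fintype.card κ := by exact_mod_cast h1
  calc B.det.natAbs ≤ (Fintype.card κ).factorial * M ^ Fintype.card κ := h2
    _ ≤ (Fintype.card κ) ^ (Fintype.card κ) * M ^ Fintype.card κ :=
        Nat.mul_le_mul_right _ (Nat.factorial_le_pow _)
    _ = (Fintype.card κ * M) ^ Fintype.card κ := (mul_pow _ _ _).symm
    _ ≤ (d * M) ^ Fintype.card κ := Nat.pow_le_pow_left (Nat.mul_le_mul_right _ hκ) _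
    _ ≤ (d * M) ^ d := Nat.pow_le_pow_right (Nat.mul_pos hd hM) hκ

theorem natAbs_cramer_le {d M : ℕ} (hM : 1 ≤ M) (hκ : Fintype.card κ ≤ d) (hd : 1 ≤ d)
    {B : Matrix κ κ ℤ} (hB : ∀ i j, (B i j).natAbs ≤ M) {v : κ → ℤ} (hv : ∀ i, (v i).natAbs ≤ M)
    (k : κ) : (B.cramer v k).natAbs ≤ (d * M) ^ d := by
  rw [Matrix.cramer_apply]
  refine natAbs_det_le hM hκ hd fun i j => ?_
  rw [Matrix.updateCol_apply]
  split_ifs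
  · exact hv i
  · exact hB i j

/-- Cramer's rule without division, valid over the integers as well as the rationals. -/
theorem cramer_mulVec {R : Type} [CommRing R] (B : Matrix κ κ R) (c : κ → R) :
    B.cramer (B.mulVec c) = B.det • c := by
  rw [Matrix.cramer_eq_adjugate_mulVec, Matrix.mulVec_mulVec, Matrix.adjugate_mul,
    Matrix.smul_mulVec, Matrix.one_mulVec]

end

/-! ### Short kernel vectors and small solutions -/

section

variable {ι : Type} [Fintype ι]

/-- Linearly dependent columns admit a short kernel vector. -/
theorem linearIndependent_of_no_short_kernel {d M : ℕ} (hd : 1 ≤ d) (hM : 1 ≤ M)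
    {A : Matrix (Fin d) ι ℤ} (hA : ∀ i j, (A i j).natAbs ≤ M) (P : ι → Prop)
    (h : ∀ g : ι → ℤ, A.mulVec g = 0 → (∀ j, g j ≠ 0 → P j) →
      (∀ j, |g j| ≤ ((d * M) ^ d : ℕ)) → g = 0) :
    LinearIndependent ℚ ((A.submatrix id (Subtype.val : {j // P j} → ι)).map
      (Int.cast : ℤ → ℚ)).col := by
  classical
  set Q := (A.submatrix id (Subtype.val : {j // P j} → ι)).map (Int.cast : ℤ → ℚ) with hQ
  -- A maximal independent set of columns; a column `j` outside it would be a rational combination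
  -- of them with coefficients `c`.
  obtain ⟨s, hs, hmax⟩ := exists_maximal_linearIndepOn ℚ Q.col
  suffices hall : ∀ j, j ∈ s by
    have : s = Set.univ := Set.eq_univ_of_forall hall
    rw [this] at hs
    simpa using hs
  by_contra hne
  push Not at hne
  obtain ⟨j, hj⟩ := hne
  obtain ⟨a, ha, hspan⟩ := hmax j hj
  have hspan' : Q.col j ∈ Submodule.span ℚ (Set.range fun k : s => Q.col k) := by
    have := Submodule.smul_mem _ a⁻¹ hspan
    rw [smul_smul, inv_mul_cancel₀ ha, one_smul] at this
    rwa [Set.image_eq_range] at this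
  obtain ⟨c, hc⟩ := (Submodule.mem_span_range_iff_exists_fun ℚ).1 hspan'
  set C : Matrix (Fin d) s ℤ := A.submatrix id (fun k : s => k.1.1) with hC
  obtain ⟨f, hf, hdet⟩ := exists_minor C hs
  set B := C.submatrix f id with hB
  have hcard : Fintype.card s ≤ d := by
    simpa using Fintype.card_le_of_injective f hf
  have hci : ∀ i, ∑ k : s, c k * (A i k.1.1 : ℚ) = A i j.1 := by
    intro i
    have := congrFun hc i
    simpa [Finset.sum_apply, hQ, Matrix.col] using this
  set w : s → ℤ := fun k => A (f k) j.1 with hw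
  have hBc : (B.map (Int.cast : ℤ → ℚ)).mulVec c = fun k => (w k : ℚ) := by
    funext k
    rw [hw, ← hci (f k)]
    simp [Matrix.mulVec, dotProduct, hB, hC, mul_comm]
  -- The determinant of a minor `B` clears the denominators of `c`, and the resulting integers are
  -- determinants bounded by `(d * M) ^ d`.
  have hcr : ∀ k, ((B.cramer w k : ℤ) : ℚ) = B.det * c k := by
    intro k
    have h1 := congrFun (cramer_mulVec (B.map (Int.cast : ℤ → ℚ)) c) k
    rw [hBc] at h1
    have h2 : (B.map (Int.cast : ℤ → ℚ)).det = (B.det : ℚ) := by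
      have := (RingHom.map_det (Int.castRingHom ℚ) B).symm
      simpa using this
    have h3 : ((B.cramer w k : ℤ) : ℚ) =
        (B.map (Int.cast : ℤ → ℚ)).cramer (fun k => (w k : ℚ)) k := by
      rw [Matrix.cramer_apply, Matrix.cramer_apply]
      have := RingHom.map_det (Int.castRingHom ℚ) (B.updateCol k w)
      rw [eq_intCast] at this
      rw [this]
      congr 1
      ext p q
      simp only [RingHom.mapMatrix_apply, Matrix.map_apply, Matrix.updateCol_apply]
      split_ifs <;> simp
    rw [h3, h1, h2]
    simp
  have hAM : ∀ i j, (B i j).natAbs ≤ M := fun _ _ => hA _ _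
  -- The dependency of column `j` on the columns in `s`, multiplied by `det B`. The sum has at most
  -- one nonzero term, since distinct elements of `s` have distinct indices.
  set g : ι → ℤ := fun i => if i = j.1 then -B.det else
    ∑ k : s, if k.1.1 = i then B.cramer w k else 0 with hg
  have hgs : ∀ k : s, g k.1.1 = B.cramer w k := by
    intro k
    have hkj : k.1.1 ≠ j.1 := fun e => hj (by rw [← Subtype.ext e]; exact k.2)
    simp only [hg, if_neg hkj]
    rw [Finset.sum_eq_single k]
    · simp
    · intro k' _ hk'
      rw [if_neg]
      exact fun e => hk' (Subtype.ext (Subtype.ext e))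
    · simp
  have hgn : ∀ i, i ≠ j.1 → (∀ k : s, k.1.1 ≠ i) → g i = 0 := by
    intro i hi hk
    simp only [hg, if_neg hi]
    exact Finset.sum_eq_zero fun k _ => if_neg (hk k)
  have hcase : ∀ i, i = j.1 ∨ (∃ k : s, k.1.1 = i) ∨ g i = 0 := by
    intro i
    by_cases h1 : i = j.1
    · exact .inl h1
    · by_cases h2 : ∃ k : s, k.1.1 = i
      · exact .inr (.inl h2)
      · push Not at h2
        exact .inr (.inr (hgn i h1 h2))
  -- The entry at `j` is `-det B`, which is nonzero, so `g = 0` is absurd.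
  have := h g ?_ ?_ ?_
  · apply hdet
    have := congrFun this j.1
    simpa [hg] using this
  · funext i
    have hsplit : (A.mulVec g) i = A i j.1 * g j.1 + ∑ k : s, A i k.1.1 * g k.1.1 := by
      simp only [Matrix.mulVec, dotProduct]
      rw [← Finset.add_sum_erase _ _ (Finset.mem_univ j.1)]
      congr 1
      rw [← Finset.sum_image (f := fun i' => A i i' * g i') (s := Finset.univ)
        (g := fun k : s => k.1.1) (fun a _ b _ e => Subtype.ext (Subtype.ext e))]
      symm
      apply Finset.sum_subset
      · intro i' hi'
        obtain ⟨k, -, rfl⟩ := Finset.mem_image.1 hi'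
        refine Finset.mem_erase.2 ⟨fun e => hj (by rw [← Subtype.ext e]; exact k.2),
          Finset.mem_univ _⟩
      · intro i' hi' hi''
        rw [hgn i' (Finset.ne_of_mem_erase hi') fun k e =>
          hi'' (Finset.mem_image.2 ⟨k, Finset.mem_univ _, e⟩), mul_zero]
    rw [hsplit]
    have hgj : g j.1 = -B.det := by simp [hg]
    rw [hgj]
    have hq : ((A i j.1 * -B.det + ∑ k : s, A i k.1.1 * g k.1.1 : ℤ) : ℚ) = 0 := by
      rw [Int.cast_add, Int.cast_mul, Int.cast_neg, Int.cast_sum]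
      simp only [Int.cast_mul, hgs, hcr]
      rw [← hci i, Finset.sum_mul, ← Finset.sum_add_distrib]
      exact Finset.sum_eq_zero fun k _ => by ring
    exact_mod_cast hq
  · intro i hi
    rcases hcase i with rfl | ⟨k, rfl⟩ | h0
    · exact j.2
    · exact k.1.2
    · exact absurd h0 hi
  · intro i
    rcases hcase i with rfl | ⟨k, rfl⟩ | h0
    · have : g j.1 = -B.det := by simp [hg]
      rw [this, abs_neg, Int.abs_eq_natAbs]
      exact_mod_cast natAbs_det_le hM hcard hd hAM
    · rw [hgs, Int.abs_eq_natAbs]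
      exact_mod_cast natAbs_cramer_le hM hcard hd hAM (fun _ => hA _ _) k
    · rw [h0, abs_zero]
      positivity

/-- Entries whose columns are linearly independent are small if the others are. -/
theorem le_of_linearIndependent {d M : ℕ} (hd : 1 ≤ d) (hM : 1 ≤ M) {A : Matrix (Fin d) ι ℤ}
    (hA : ∀ i j, (A i j).natAbs ≤ M) {b : Fin d → ℤ} (hb : ∀ i, (b i).natAbs ≤ M) {x : ι → ℕ}
    (hx : Solves A b x)
    (h : LinearIndependent ℚ ((A.submatrix id (Subtype.val : {j // (d * M) ^ d < x j} → ι)).map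
      (Int.cast : ℤ → ℚ)).col) (j : ι) : x j ≤ Fintype.card ι * ((d * M) ^ d) ^ 2 := by
  classical
  set D := (d * M) ^ d with hD
  have hD1 : 1 ≤ D := Nat.one_le_pow _ _ (Nat.mul_pos hd hM)
  have hn : 1 ≤ Fintype.card ι := Fintype.card_pos_iff.2 ⟨j⟩
  by_cases hj : D < x j
  swap
  · nlinarith
  set C := A.submatrix id (Subtype.val : {j // D < x j} → ι) with hC
  obtain ⟨f, hf, hdet⟩ := exists_minor C h
  set B := C.submatrix f id with hB
  have hcard : Fintype.card {j // D < x j} ≤ d := by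
    simpa using Fintype.card_le_of_injective f hf
  have hAM : ∀ i j, (B i j).natAbs ≤ M := fun _ _ => hA _ _
  set K : Finset ι := Finset.univ.filter fun k => ¬ D < x k with hK
  -- The columns with small entries are moved to the right-hand side, in the rows of a nonsingular
  -- minor of the others. Cramer's rule then expresses `det B * x j` through determinants.
  have hBx : B.mulVec (fun k => (x k.1 : ℤ)) =
      (fun k => b (f k)) - ∑ k ∈ K, (x k : ℤ) • fun p => A (f p) k := by
    funext p
    have h1 := congrFun hx (f p)
    simp only [Matrix.mulVec, dotProduct] at h1
    simp only [Matrix.mulVec, dotProduct, Pi.sub_apply, ← h1, Finset.sum_apply, Pi.smul_apply,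
      smul_eq_mul]
    rw [eq_sub_iff_add_eq, ← Finset.sum_filter_add_sum_filter_not Finset.univ (fun k => D < x k)]
    congr 1
    · rw [Finset.sum_subtype (p := fun k => D < x k) _ (by simp)]
      rfl
    · exact Finset.sum_congr rfl fun k _ => mul_comm _ _
  have hcr := congrFun (cramer_mulVec B (fun k => (x k.1 : ℤ))) ⟨j, hj⟩
  rw [hBx, map_sub, map_sum] at hcr
  simp only [map_smul, Pi.sub_apply, Finset.sum_apply, Pi.smul_apply, smul_eq_mul] at hcr
  -- Since `j` itself is a large entry, at most `|ι| - 1` small ones remain, which makes room for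
  -- the summand `D` coming from `b`.
  have hKc : K.card + 1 ≤ Fintype.card ι := by
    have : K.card < (Finset.univ : Finset ι).card :=
      Finset.card_lt_card ⟨Finset.subset_univ _, fun hh => by
        have := hh (Finset.mem_univ j)
        simp only [hK, Finset.mem_filter, Finset.mem_univ, true_and] at this
        exact this hj⟩
    simpa using this
  have h2 : |(B.det * x j : ℤ)| ≤ D + K.card * (D * D) := by
    rw [← hcr]
    refine (abs_sub _ _).trans (add_le_add ?_ ?_)
    · rw [Int.abs_eq_natAbs]
      exact_mod_cast natAbs_cramer_le hM hcard hd hAM (fun _ => hb _) _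
    · refine (Finset.abs_sum_le_sum_abs _ _).trans ?_
      rw [← nsmul_eq_mul]
      refine Finset.sum_le_card_nsmul _ _ _ fun k hk => ?_
      rw [abs_mul, Nat.abs_cast, Int.abs_eq_natAbs]
      refine mul_le_mul ?_ ?_ (by positivity) (by positivity)
      · have : x k ≤ D := by simpa [hK] using hk
        exact_mod_cast this
      · exact_mod_cast natAbs_cramer_le hM hcard hd hAM (fun _ => hA _ _) _
  have h3 : (x j : ℤ) ≤ D + K.card * (D * D) := by
    refine le_trans ?_ h2
    rw [abs_mul, Nat.abs_cast]
    -- A nonzero integer determinant can only help when divided out.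
    have : 1 ≤ |B.det| := Int.one_le_abs hdet
    nlinarith
  have h4 : x j ≤ D + K.card * (D * D) := by exact_mod_cast h3
  nlinarith

/-- A solvable system has a solution with small support and small entries. -/
theorem exists_small_solution {d M : ℕ} (hd : 1 ≤ d) (hM : 1 ≤ M) {A : Matrix (Fin d) ι ℤ}
    (hA : ∀ i j, (A i j).natAbs ≤ M) {b : Fin d → ℤ} (hb : ∀ i, (b i).natAbs ≤ M) {x₀ : ι → ℕ}
    (h₀ : Solves A b x₀) : ∃ x, Solves A b x ∧
      ((Finset.univ.filter fun j => x j ≠ 0).card : ℝ) ≤ 2 * d * Real.logb 2 (4 * d * M) ∧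
      ∀ j, x j ≤ Fintype.card ι * (d * M) ^ (2 * d) := by
  -- With `D = 0` the large entries are the nonzero ones and the excluded kernel vectors have
  -- entries in `{-1, 0, 1}`.
  obtain ⟨y, hy, -, hyk⟩ := exists_reduced_solution Finset.univ 0 h₀ (by simp)
  set T := Finset.univ.filter fun j => y j ≠ 0 with hT
  have hTc := le_of_two_pow_le hd hM (two_pow_card_le_of_no_short_kernel hA T fun g hg hgT hg1 =>
    hyk g hg (fun j hj => by
      have := hgT j hj
      simp only [hT, Finset.mem_filter, Finset.mem_univ, true_and] at this
      omega) (by simpa using hg1))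
  -- The second reduction stays inside the support `T` of the first, so the support bound is not
  -- lost.
  obtain ⟨x, hx, hxT, hxk⟩ := exists_reduced_solution T ((d * M) ^ d) hy (by simp [hT])
  refine ⟨x, hx, le_trans ?_ hTc, ?_⟩
  · exact_mod_cast Finset.card_le_card fun j hj => hxT j (by simpa using hj)
  · intro j
    rw [mul_comm 2 d, pow_mul]
    exact le_of_linearIndependent hd hM hA hb hx (linearIndependent_of_no_short_kernel hd hM hA _
      fun g hg hg1 hg2 => hxk g hg hg1 fun j => by
        have := hg2 j
        omega) j

end

/-! ### Sizes -/

section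

/-- The length of the names of the symbols in `u` and `b`. -/
def symLength (u b : Finset ℕ) : ℕ := ∑ i ∈ u, (encNat i).length + ∑ i ∈ b, (encNat i).length

theorem symLength_union (u u' b b' : Finset ℕ) :
    symLength (u ∪ u') (b ∪ b') ≤ symLength u b + symLength u' b' := by
  have h1 := Finset.sum_union_inter (s₁ := u) (s₂ := u') (f := fun i => (encNat i).length)
  have h2 := Finset.sum_union_inter (s₁ := b) (s₂ := b') (f := fun i => (encNat i).length)
  simp only [symLength]
  omega

theorem symLength_foldr_le {α : Type} (l : List α) (f g : α → Finset ℕ) (h : α → List Tok)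
    (hl : ∀ a ∈ l, symLength (f a) (g a) ≤ (h a).length) :
    symLength ((l.map f).foldr (· ∪ ·) ∅) ((l.map g).foldr (· ∪ ·) ∅) ≤ (encList h l).length := by
  induction l with
  | nil => simp [symLength]
  | cons a l ih =>
    have h1 := ih fun b hb => hl b (List.mem_cons_of_mem _ hb)
    have h2 := hl a List.mem_cons_self
    have h3 := symLength_union (f a) ((l.map f).foldr (· ∪ ·) ∅) (g a)
      ((l.map g).foldr (· ∪ ·) ∅)
    simp only [List.map_cons, List.foldr_cons]
    refine h3.trans ?_
    simp only [encList, List.flatMap_cons, List.length_append, List.length_cons] at h1 ⊢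
    omega

theorem QF.symLength_le {k : ℕ} (f : QF k) :
    symLength f.unarySyms f.binarySyms ≤ f.enc.length := by
  induction f with
  | top | bot | un | bin | eq =>
    simp only [QF.unarySyms, QF.binarySyms, QF.enc, symLength, Finset.sum_empty,
      Finset.sum_singleton, List.length_cons, List.length_append, List.length_nil]
    omega
  | neg f ih =>
    simp only [QF.unarySyms, QF.binarySyms, QF.enc, List.length_cons]
    omega
  | and f g ihf ihg | or f g ihf ihg | imp f g ihf ihg =>
    have := symLength_union f.unarySyms g.unarySyms f.binarySyms g.binarySyms
    simp only [QF.unarySyms, QF.binarySyms, QF.enc, List.length_cons, List.length_append]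
    omega

theorem UAtom.symLength_le (q : UAtom) : symLength q.unarySyms q.binarySyms ≤ q.enc.length := by
  cases q <;> simp [UAtom.unarySyms, UAtom.binarySyms, UAtom.enc, symLength]

theorem symLength_toFinset_le (l : List (ℤ × ℕ)) :
    symLength ∅ (l.map Prod.snd).toFinset ≤
      (encList (fun t : ℤ × ℕ => encInt t.1 ++ encNat t.2) l).length := by
  induction l with
  | nil => simp [symLength]
  | cons t l ih =>
    have := symLength_union ∅ ∅ {t.2} (l.map Prod.snd).toFinset
    have h0 : symLength ∅ {t.2} = (encNat t.2).length := by simp [symLength]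
    rw [h0, Finset.union_empty] at this
    rw [List.map_cons, List.toFinset_cons, Finset.insert_eq]
    refine this.trans ?_
    simp only [encList, List.flatMap_cons, List.length_append, List.length_cons] at ih ⊢
    omega

theorem LP.symLength_le (P : LP) : symLength ∅ P.binarySyms ≤ P.enc.length := by
  have := symLength_toFinset_le P.terms
  simp only [LP.binarySyms, LP.enc, List.length_append]
  omega

/-- The names of the symbols of a sentence are not longer than the sentence. -/
theorem Sentence.symLength_le (Ψ : Sentence) :
    symLength Ψ.unarySyms Ψ.binarySyms ≤ Ψ.length := by
  have h1 := Ψ.gamma.symLength_le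
  have h2 := symLength_foldr_le Ψ.guarded (fun c => c.2.unarySyms)
    (fun c => insert c.1 c.2.binarySyms) (fun c => encNat c.1 ++ c.2.enc) (fun c _ => by
      have := symLength_union ∅ c.2.unarySyms {c.1} c.2.binarySyms
      have h0 : symLength ∅ {c.1} = (encNat c.1).length := by simp [symLength]
      have := c.2.symLength_le
      rw [Finset.insert_eq, List.length_append]
      rw [Finset.empty_union] at *
      omega)
  have h3 := symLength_foldr_le Ψ.counting (fun c => c.1.unarySyms)
    (fun c => c.1.binarySyms ∪ c.2.binarySyms) (fun c => c.1.enc ++ c.2.enc) (fun c _ => by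
      have := symLength_union c.1.unarySyms ∅ c.1.binarySyms c.2.binarySyms
      have := c.1.symLength_le
      have := c.2.symLength_le
      rw [List.length_append]
      rw [Finset.union_empty] at *
      omega)
  have h4 := symLength_union Ψ.gamma.unarySyms
    ((Ψ.guarded.map fun c => c.2.unarySyms).foldr (· ∪ ·) ∅) Ψ.gamma.binarySyms
    ((Ψ.guarded.map fun c => insert c.1 c.2.binarySyms).foldr (· ∪ ·) ∅)
  have h5 := symLength_union (Ψ.gamma.unarySyms ∪
    (Ψ.guarded.map fun c => c.2.unarySyms).foldr (· ∪ ·) ∅)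
    ((Ψ.counting.map fun c => c.1.unarySyms).foldr (· ∪ ·) ∅) (Ψ.gamma.binarySyms ∪
    (Ψ.guarded.map fun c => insert c.1 c.2.binarySyms).foldr (· ∪ ·) ∅)
    ((Ψ.counting.map fun c => c.1.binarySyms ∪ c.2.binarySyms).foldr (· ∪ ·) ∅)
  simp only [Sentence.unarySyms, Sentence.binarySyms, Sentence.length, Sentence.enc,
    List.length_append]
  omega

theorem length_encNat_pos (n : ℕ) : 1 ≤ (encNat n).length := by simp [encNat]

theorem card_le_sum_length_encNat (u : Finset ℕ) : u.card ≤ ∑ i ∈ u, (encNat i).length := by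
  rw [Finset.card_eq_sum_ones]
  exact Finset.sum_le_sum fun i _ => length_encNat_pos i

theorem Sentence.card_syms_le (Ψ : Sentence) :
    Ψ.unarySyms.card + Ψ.binarySyms.card ≤ Ψ.length :=
  (add_le_add (card_le_sum_length_encNat _) (card_le_sum_length_encNat _)).trans Ψ.symLength_le

theorem succ_le_two_pow_length_encNat (n : ℕ) : n + 1 ≤ 2 ^ (encNat n).length := by
  have h1 : n < 2 ^ n.size := Nat.lt_size_self n
  rw [← Nat.size_eq_bits_len] at h1
  have h2 : 2 ^ n.bits.length ≤ 2 ^ (encNat n).length :=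
    Nat.pow_le_pow_right (by norm_num) (by simp [encNat])
  omega

/-- From `(a + 1) (b + 1) ≥ a + b + 1`: values add up while the lengths of their codes add up, so
the form `value + 1 ≤ 2 ^ length` passes to concatenations. -/
theorem add_succ_le_two_pow {a b k l : ℕ} (ha : a + 1 ≤ 2 ^ k) (hb : b + 1 ≤ 2 ^ l) :
    a + b + 1 ≤ 2 ^ (k + l) := by
  have := Nat.mul_le_mul ha hb
  rw [pow_add]
  nlinarith

theorem LP.weight_succ_le (P : LP) : P.weight + 1 ≤ 2 ^ P.enc.length := by
  have habs : ∀ a : ℤ, a.natAbs + 1 ≤ 2 ^ (encInt a).length := fun a =>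
    (succ_le_two_pow_length_encNat _).trans
      (Nat.pow_le_pow_right (by norm_num) (by simp [encInt]))
  have h1 : ∀ l : List (ℤ × ℕ), (l.map fun t => t.1.natAbs).sum + 1 ≤
      2 ^ (encList (fun t : ℤ × ℕ => encInt t.1 ++ encNat t.2) l).length := by
    intro l
    induction l with
    | nil => simp [encList]
    | cons t l ih =>
      simp only [List.map_cons, List.sum_cons]
      refine (add_succ_le_two_pow (habs t.1) ih).trans (Nat.pow_le_pow_right (by norm_num) ?_)
      simp only [encList, List.flatMap_cons, List.length_append, List.length_cons]
      omega
  have h2 : P.cmp.modulus + 1 ≤ 2 ^ P.cmp.enc.length := by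
    cases P.cmp with
    | modEq d | notModEq d =>
      exact (succ_le_two_pow_length_encNat d).trans
        (Nat.pow_le_pow_right (by norm_num) (by simp [Cmp.enc]))
    | _ => simp [Cmp.enc, Cmp.modulus]
  have := add_succ_le_two_pow (add_succ_le_two_pow (h1 P.terms) (habs P.rhs)) h2
  refine this.trans (Nat.pow_le_pow_right (by norm_num) ?_)
  simp only [LP.enc, List.length_append]
  omega

theorem foldr_max_le {l : List ℕ} {K : ℕ} (h : ∀ a ∈ l, a ≤ K) : l.foldr max 0 ≤ K := by
  induction l with
  | nil => simp
  | cons a l ih =>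
    simp only [List.mem_cons, forall_eq_or_imp] at h
    exact max_le h.1 (ih h.2)

theorem le_foldr_max {l : List ℕ} {a : ℕ} (h : a ∈ l) : a ≤ l.foldr max 0 := by
  induction l with
  | nil => simp at h
  | cons b l ih =>
    rcases List.mem_cons.1 h with rfl | h
    · exact le_max_left _ _
    · exact (ih h).trans (le_max_right _ _)

theorem Sentence.length_counting_le (Ψ : Sentence) {c : UAtom × LP} (hc : c ∈ Ψ.counting) :
    c.2.enc.length ≤ Ψ.length := by
  have := length_le_encList_of_mem (fun c : UAtom × LP => c.1.enc ++ c.2.enc) hc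
  simp only [Sentence.length, Sentence.enc, List.length_append] at this ⊢
  omega

theorem Sentence.weight_succ_le_maxCoeff (Ψ : Sentence) {c : UAtom × LP} (hc : c ∈ Ψ.counting) :
    c.2.weight + 1 ≤ Ψ.maxCoeff := by
  rw [Sentence.maxCoeff, add_comm]
  have : c.2.weight ∈ Ψ.counting.map fun c => c.2.weight := List.mem_map.2 ⟨c, hc, rfl⟩
  exact Nat.add_le_add_left (le_foldr_max this) 1

theorem Sentence.maxCoeff_le (Ψ : Sentence) : Ψ.maxCoeff ≤ 2 ^ Ψ.length := by
  rw [Sentence.maxCoeff]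
  have : (Ψ.counting.map fun c => c.2.weight).foldr max 0 ≤ 2 ^ Ψ.length - 1 := by
    refine foldr_max_le fun a ha => ?_
    obtain ⟨c, hc, rfl⟩ := List.mem_map.1 ha
    have h1 := c.2.weight_succ_le
    have h2 : 2 ^ c.2.enc.length ≤ 2 ^ Ψ.length :=
      Nat.pow_le_pow_right (by norm_num) (Ψ.length_counting_le hc)
    omega
  have : 1 ≤ 2 ^ Ψ.length := Nat.one_le_two_pow
  omega

/-- The factor `2 ^ (2m)` counts the binary types, with the null type included, and `2 ^ (n + m)`
the unary ones. -/
theorem card_var_le (Ψ : Sentence) :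
    Fintype.card (Var Ψ) ≤ 2 ^ (Ψ.unarySyms.card + 3 * Ψ.binarySyms.card) := by
  have h1 : Fintype.card (NonNullType Ψ) ≤ Fintype.card (BinaryType Ψ) :=
    Fintype.card_subtype_le _
  have h2 : Fintype.card (Var Ψ) = Fintype.card (NonNullType Ψ) * Fintype.card (UnaryType Ψ) :=
    Fintype.card_prod _ _
  rw [h2]
  refine (Nat.mul_le_mul_right _ h1).trans (le_of_eq ?_)
  simp only [Fintype.card_prod, Fintype.card_coe, Finset.card_powerset]
  ring

theorem length_edgeSystem_le {Ψ : Sentence} (G : Graph Ψ) (e : Edge Ψ) :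
    (edgeSystem G e).length ≤ Ψ.ell + 1 := by
  simp only [edgeSystem, List.length_cons, List.length_map, Sentence.ell]
  exact Nat.add_le_add_right (List.length_filter_le _ _) 1

end

/-! ### The matrix form of the system of an edge -/

section

/-- Coefficients of the slack variables in the equation that replaces a comparison; the bit tells
which of the two ways to take for a comparison that says `≠`. -/
def Cmp.slack : Cmp → Bool → Fin 4 → ℤ
  | .eq, _ => ![0, 0, 0, 0]
  | .ne, true => ![-1, 0, 0, 0]
  | .ne, false => ![1, 0, 0, 0]
  | .le, _ => ![1, 0, 0, 0]
  | .ge, _ => ![-1, 0, 0, 0]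
  | .lt, _ => ![1, 0, 0, 0]
  | .gt, _ => ![-1, 0, 0, 0]
  | .modEq d, _ => ![-d, d, 0, 0]
  | .notModEq 0, true => ![-1, 0, 0, 0]
  | .notModEq 0, false => ![1, 0, 0, 0]
  | .notModEq (d + 1), _ => ![-(d + 1), d + 1, -1, 0]

/-- What is added to the right-hand side. -/
def Cmp.shift : Cmp → Bool → ℤ
  | .ne, true => 1
  | .ne, false => -1
  | .lt, _ => -1
  | .gt, _ => 1
  | .notModEq 0, true => 1
  | .notModEq 0, false => -1
  | .notModEq (_ + 1), _ => 1
  | _, _ => 0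

/-- Coefficients of the slack variables in the equation that bounds the remainder. -/
def Cmp.remCoeff : Cmp → Fin 4 → ℤ
  | .notModEq (_ + 1) => ![0, 0, 1, 1]
  | _ => 0

/-- The right-hand side of the equation that bounds the remainder. -/
def Cmp.remBound : Cmp → ℤ
  | .notModEq (d + 1) => d - 1
  | _ => 0

/-- A quotient of either sign is the difference `y 0 - y 1` of naturals. A non-congruence modulo `d
+ 1` says that the remainder is `y 2 + 1` with `y 2 + y 3 = d - 1`; for modulus `1` this bound is
`-1` and, rightly, cannot be met. The bit chooses a strict inequality for `≠` and is fixed to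
`false` otherwise, so that no more than `2 ^ u` systems arise. -/
theorem Cmp.holds_iff_exists_slack (c : Cmp) (a δ : ℤ) :
    c.Holds a δ ↔ ∃ β, (c.isNe = false → β = false) ∧ ∃ y : Fin 4 → ℕ,
      a + ∑ k, c.slack β k * (y k : ℤ) = δ + c.shift β ∧
        ∑ k, c.remCoeff k * (y k : ℤ) = c.remBound := by
  have hne : ∀ a δ : ℤ, a ≠ δ ↔ ∃ β : Bool, ∃ n : ℕ,
      a + (if β then -1 else 1) * n = δ + if β then 1 else -1 := by
    intro a δ
    constructor
    · intro h
      rcases lt_or_gt_of_ne h with h | h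
      · exact ⟨false, (δ - 1 - a).toNat, by simp; omega⟩
      · exact ⟨true, (a - 1 - δ).toNat, by simp; omega⟩
    · rintro ⟨β, n, h⟩
      cases β <;> simp at h <;> omega
  have hbit : ∀ {c : Cmp} {p : Bool → Prop}, c.isNe = false →
      ((∃ β : Bool, (c.isNe = false → β = false) ∧ p β) ↔ p false) := by
    intro c p h
    simp [h]
  cases c with
  | eq => simp [Cmp.Holds, Cmp.isNe, Cmp.slack, Cmp.shift, Cmp.remCoeff, Cmp.remBound,
      Fin.sum_univ_four]
  | ne =>
    simp only [Cmp.Holds, hne, Cmp.isNe, Bool.true_eq_false, IsEmpty.forall_iff, true_and]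
    refine exists_congr fun β => ?_
    constructor
    · rintro ⟨n, h⟩
      refine ⟨fun _ => n, ?_, by simp [Cmp.remCoeff, Cmp.remBound]⟩
      cases β <;> simpa [Cmp.slack, Cmp.shift, Fin.sum_univ_four] using h
    · rintro ⟨y, h, -⟩
      refine ⟨y 0, ?_⟩
      cases β <;> simpa [Cmp.slack, Cmp.shift, Fin.sum_univ_four] using h
  | le =>
    rw [hbit rfl]
    simp only [Cmp.Holds]
    constructor
    · intro h
      refine ⟨fun _ => (δ - a).toNat, ?_, by simp [Cmp.remCoeff, Cmp.remBound]⟩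
      simp [Cmp.slack, Cmp.shift, Fin.sum_univ_four]; omega
    · rintro ⟨y, h, -⟩
      simp [Cmp.slack, Cmp.shift, Fin.sum_univ_four] at h
      omega
  | ge =>
    rw [hbit rfl]
    simp only [Cmp.Holds]
    constructor
    · intro h
      refine ⟨fun _ => (a - δ).toNat, ?_, by simp [Cmp.remCoeff, Cmp.remBound]⟩
      simp [Cmp.slack, Cmp.shift, Fin.sum_univ_four]; omega
    · rintro ⟨y, h, -⟩
      simp [Cmp.slack, Cmp.shift, Fin.sum_univ_four] at h
      omega
  | lt =>
    rw [hbit rfl]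
    simp only [Cmp.Holds]
    constructor
    · intro h
      refine ⟨fun _ => (δ - 1 - a).toNat, ?_, by simp [Cmp.remCoeff, Cmp.remBound]⟩
      simp [Cmp.slack, Cmp.shift, Fin.sum_univ_four]; omega
    · rintro ⟨y, h, -⟩
      simp [Cmp.slack, Cmp.shift, Fin.sum_univ_four] at h
      omega
  | gt =>
    rw [hbit rfl]
    simp only [Cmp.Holds]
    constructor
    · intro h
      refine ⟨fun _ => (a - 1 - δ).toNat, ?_, by simp [Cmp.remCoeff, Cmp.remBound]⟩
      simp [Cmp.slack, Cmp.shift, Fin.sum_univ_four]; omega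
    · rintro ⟨y, h, -⟩
      simp [Cmp.slack, Cmp.shift, Fin.sum_univ_four] at h
      omega
  | modEq d =>
    rw [hbit rfl]
    simp only [Cmp.Holds]
    constructor
    · intro h
      obtain ⟨q, hq⟩ := h.symm.dvd
      refine ⟨![q.toNat, (-q).toNat, 0, 0], ?_, by simp [Cmp.remCoeff, Cmp.remBound]⟩
      have h1 : (q.toNat : ℤ) - ((-q).toNat : ℤ) = q := by omega
      simp only [Cmp.slack, Cmp.shift, Fin.sum_univ_four, Matrix.cons_val_zero,
        Matrix.cons_val_one, Matrix.cons_val]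
      rw [← h1] at hq
      linear_combination hq
    · rintro ⟨y, h, -⟩
      simp [Cmp.slack, Cmp.shift, Fin.sum_univ_four] at h
      refine (Int.modEq_iff_dvd.2 ⟨(y 0 : ℤ) - y 1, ?_⟩).symm
      linear_combination h
  | notModEq d =>
    cases d with
    | zero =>
      have h0 : ∀ a δ : ℤ, (¬ a ≡ δ [ZMOD ((0 : ℕ) : ℤ)]) ↔ a ≠ δ := by simp [Int.ModEq]
      simp only [Cmp.Holds, h0, hne, Cmp.isNe, Bool.true_eq_false, IsEmpty.forall_iff, true_and]
      refine exists_congr fun β => ?_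
      constructor
      · rintro ⟨n, h⟩
        refine ⟨fun _ => n, ?_, by simp [Cmp.remCoeff, Cmp.remBound]⟩
        cases β <;> simpa [Cmp.slack, Cmp.shift, Fin.sum_univ_four] using h
      · rintro ⟨y, h, -⟩
        refine ⟨y 0, ?_⟩
        cases β <;> simpa [Cmp.slack, Cmp.shift, Fin.sum_univ_four] using h
    | succ d =>
      rw [hbit rfl]
      simp only [Cmp.Holds]
      have hd : (0 : ℤ) < d + 1 := by positivity
      constructor
      · intro h
        set r := (a - δ) % (d + 1) with hr
        set q := (a - δ) / (d + 1) with hq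
        have hqr : (d + 1) * q + r = a - δ := Int.mul_ediv_add_emod _ _
        have hr0 : 0 ≤ r := Int.emod_nonneg _ hd.ne'
        have hr1 : r < d + 1 := Int.emod_lt_of_pos _ hd
        have hrne : r ≠ 0 := by
          intro h0
          apply h
          refine (Int.modEq_iff_dvd.2 ⟨q, ?_⟩).symm
          push_cast
          linarith
        -- Here `1 ≤ r ≤ d`, so the last two entries are honest differences with sum `d - 1`.
        refine ⟨![q.toNat, (-q).toNat, (r - 1).toNat, (d - r).toNat], ?_, ?_⟩
        · have h1 : (q.toNat : ℤ) - ((-q).toNat : ℤ) = q := by omega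
          have h2 : ((r - 1).toNat : ℤ) = r - 1 := by omega
          rw [← h1] at hqr
          simp only [Cmp.slack, Cmp.shift, Fin.sum_univ_four, Matrix.cons_val_zero,
            Matrix.cons_val_one, Matrix.cons_val, h2]
          linear_combination -hqr
        · simp only [Cmp.remCoeff, Cmp.remBound, Fin.sum_univ_four, Matrix.cons_val_zero,
            Matrix.cons_val_one, Matrix.cons_val]
          omega
      · rintro ⟨y, h, h'⟩ hm
        simp only [Cmp.remCoeff, Cmp.remBound, Fin.sum_univ_four, Matrix.cons_val_zero,
            Matrix.cons_val_one, Matrix.cons_val] at h'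
        simp only [Cmp.slack, Cmp.shift, Fin.sum_univ_four, Matrix.cons_val_zero,
            Matrix.cons_val_one, Matrix.cons_val] at h
        obtain ⟨q, hq⟩ := hm.symm.dvd
        push_cast at hq
        -- A multiple of `d + 1` would lie between `1` and `d`.
        have h3 : ((d : ℤ) + 1) * (q - y 0 + y 1) = y 2 + 1 := by linear_combination h - hq
        have h4 : 0 < q - y 0 + y 1 := by
          by_contra hle
          have : ((d : ℤ) + 1) * (q - y 0 + y 1) ≤ 0 := mul_nonpos_of_nonneg_of_nonpos hd.le
            (by omega)
          omega
        have h5 : ((d : ℤ) + 1) * 1 ≤ ((d : ℤ) + 1) * (q - y 0 + y 1) :=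
          mul_le_mul_of_nonneg_left (by omega) hd.le
        omega

theorem Cmp.natAbs_slack_le (c : Cmp) (β : Bool) (k : Fin 4) :
    (c.slack β k).natAbs ≤ c.modulus + 1 := by
  rcases c with _ | _ | _ | _ | _ | _ | d | (_ | d) <;> cases β <;> fin_cases k <;>
    simp [Cmp.slack, Cmp.modulus] <;> omega

theorem Cmp.natAbs_shift_le (c : Cmp) (β : Bool) : (c.shift β).natAbs ≤ 1 := by
  rcases c with _ | _ | _ | _ | _ | _ | d | (_ | d) <;> cases β <;> simp [Cmp.shift]

theorem Cmp.natAbs_remCoeff_le (c : Cmp) (k : Fin 4) : (c.remCoeff k).natAbs ≤ 1 := by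
  rcases c with _ | _ | _ | _ | _ | _ | d | (_ | d) <;> fin_cases k <;> simp [Cmp.remCoeff]

theorem Cmp.natAbs_remBound_le (c : Cmp) : c.remBound.natAbs ≤ c.modulus + 1 := by
  rcases c with _ | _ | _ | _ | _ | _ | d | (_ | d) <;> simp [Cmp.remBound, Cmp.modulus]; omega

variable {ι : Type} [DecidableEq ι]

/-- The coefficient of `z_v`. -/
def LinConstraint.coeff (C : LinConstraint ι) (v : ι) : ℤ :=
  (C.terms.map fun t => if v ∈ t.2 then t.1 else 0).sum

theorem LinConstraint.sum_coeff_mul [Fintype ι] (C : LinConstraint ι) (z : ι → ℕ) :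
    ∑ v, C.coeff v * (z v : ℤ) = (C.terms.map fun t => t.1 * ∑ v ∈ t.2, (z v : ℤ)).sum := by
  have key : ∀ l : List (ℤ × Finset ι),
      ∑ v, (l.map fun t => if v ∈ t.2 then t.1 else 0).sum * (z v : ℤ) =
        (l.map fun t => t.1 * ∑ v ∈ t.2, (z v : ℤ)).sum := by
    intro l
    induction l with
    | nil => simp
    | cons t l ih =>
      simp only [List.map_cons, List.sum_cons, add_mul, Finset.sum_add_distrib, ih]
      congr 1
      simp [ite_mul, Finset.mul_sum]
  exact key C.terms

theorem LinConstraint.natAbs_coeff_le (C : LinConstraint ι) (v : ι) :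
    (C.coeff v).natAbs ≤ (C.terms.map fun t => t.1.natAbs).sum := by
  have key : ∀ l : List (ℤ × Finset ι), ((l.map fun t : ℤ × Finset ι => if v ∈ t.2 then t.1 else 0).sum).natAbs ≤
      (l.map fun t => t.1.natAbs).sum := by
    intro l
    induction l with
    | nil => simp
    | cons t l ih =>
      simp only [List.map_cons, List.sum_cons]
      refine (Int.natAbs_add_le _ _).trans (add_le_add ?_ ih)
      split_ifs <;> simp
  exact key C.terms

end

section

variable {Ψ : Sentence} (G : Graph Ψ) (e : Edge Ψ)

theorem isSolution_edgeSystem_iff {z : Var Ψ → ℕ} : IsSolution (edgeSystem G e) z ↔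
    1 ≤ z e.2 ∧ ∀ i : Fin Ψ.ell, (Ψ.counting.get i).1.Mem e.1 →
      ((Ψ.counting.get i).2.constraint G e.1).Sat z := by
  simp only [IsSolution, edgeSystem, List.mem_cons, forall_eq_or_imp]
  refine and_congr ?_ ?_
  · simp only [LinConstraint.Sat, Cmp.Holds, List.map_cons, List.map_nil, List.sum_singleton,
      Finset.sum_singleton]
    omega
  · constructor
    · intro h i hi
      exact h _ (List.mem_map.2 ⟨_, List.mem_filter.2 ⟨List.get_mem _ _, by simpa using hi⟩, rfl⟩)
    · intro h C hC
      obtain ⟨c, hc, rfl⟩ := List.mem_map.1 hC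
      obtain ⟨hc, hm⟩ := List.mem_filter.1 hc
      obtain ⟨i, rfl⟩ := List.get_of_mem hc
      exact h i (by simpa using hm)

/-- The rows of the matrix form, before numbering: one for the edge, two for each conjunct. -/
abbrev RowIdx (Ψ : Sentence) : Type := Option (Fin Ψ.ell × Fin 2)

/-- The additional variables: one for the edge, four for each conjunct. -/
abbrev SlackIdx (Ψ : Sentence) : Type := Option (Fin Ψ.ell × Fin 4)

/-- The coefficient matrix, `β` resolving the disequalities. -/
def systemMatrix (β : Fin Ψ.ell → Bool) : Matrix (RowIdx Ψ) (Var Ψ ⊕ SlackIdx Ψ) ℤ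
  | none, .inl v => if v = e.2 then 1 else 0
  | none, .inr none => -1
  | none, .inr (some _) => 0
  -- A conjunct whose atom is not in the source type contributes the rows `0 = 0`, so the shape of
  -- the matrix does not depend on the edge.
  | some (i, r), .inl v =>
    if (Ψ.counting.get i).1.Mem e.1 ∧ r = 0 then ((Ψ.counting.get i).2.constraint G e.1).coeff v
    else 0
  | some _, .inr none => 0
  | some (i, r), .inr (some (i', k)) =>
    if (Ψ.counting.get i).1.Mem e.1 ∧ i' = i then
      if r = 0 then (Ψ.counting.get i).2.cmp.slack (β i) k else (Ψ.counting.get i).2.cmp.remCoeff k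
    else 0

/-- The right-hand side. -/
def systemRhs (β : Fin Ψ.ell → Bool) : RowIdx Ψ → ℤ
  | none => 1
  | some (i, r) =>
    if (Ψ.counting.get i).1.Mem e.1 then
      if r = 0 then (Ψ.counting.get i).2.rhs + (Ψ.counting.get i).2.cmp.shift (β i)
      else (Ψ.counting.get i).2.cmp.remBound
    else 0

theorem weight_get_succ_le (i : Fin Ψ.ell) : (Ψ.counting.get i).2.weight + 1 ≤ Ψ.maxCoeff :=
  Ψ.weight_succ_le_maxCoeff (List.get_mem _ _)

theorem one_le_maxCoeff (Ψ : Sentence) : 1 ≤ Ψ.maxCoeff := by simp [Sentence.maxCoeff]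

theorem natAbs_systemMatrix_le (β : Fin Ψ.ell → Bool) (r : RowIdx Ψ) (c : Var Ψ ⊕ SlackIdx Ψ) :
    (systemMatrix G e β r c).natAbs ≤ Ψ.maxCoeff := by
  have h1 := one_le_maxCoeff Ψ
  rcases r with _ | ⟨i, r⟩ <;> rcases c with v | _ | ⟨i', k⟩
  · simp only [systemMatrix]
    split_ifs <;> simp [h1]
  · simpa [systemMatrix] using h1
  · simp [systemMatrix]
  · have hw := weight_get_succ_le (Ψ := Ψ) i
    simp only [systemMatrix]
    split_ifs
    · refine (LinConstraint.natAbs_coeff_le _ _).trans (le_trans ?_ hw)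
      simp only [LP.constraint, LP.weight, List.map_map, Function.comp_def]
      omega
    · simp
  · simp [systemMatrix]
  · have hw := weight_get_succ_le (Ψ := Ψ) i
    simp only [systemMatrix]
    rw [LP.weight] at hw
    split_ifs
    · have := (Ψ.counting.get i).2.cmp.natAbs_slack_le (β i) k
      omega
    · have := (Ψ.counting.get i).2.cmp.natAbs_remCoeff_le k
      omega
    · simp

theorem natAbs_systemRhs_le (β : Fin Ψ.ell → Bool) (r : RowIdx Ψ) :
    (systemRhs e β r).natAbs ≤ Ψ.maxCoeff := by
  have h1 := one_le_maxCoeff Ψ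
  rcases r with _ | ⟨i, r⟩
  · simpa [systemRhs] using h1
  · have hw := weight_get_succ_le (Ψ := Ψ) i
    rw [LP.weight] at hw
    simp only [systemRhs]
    split_ifs
    · have := (Ψ.counting.get i).2.cmp.natAbs_shift_le (β i)
      omega
    · have := (Ψ.counting.get i).2.cmp.natAbs_remBound_le
      omega
    · simp

theorem systemMatrix_mulVec_none (β : Fin Ψ.ell → Bool) (z : Var Ψ → ℕ) (y : SlackIdx Ψ → ℕ) :
    (systemMatrix G e β).mulVec (fun j => ((Sum.elim z y j : ℕ) : ℤ)) none = z e.2 - y none := by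
  simp [Matrix.mulVec, dotProduct, systemMatrix, Fintype.sum_option]
  ring

theorem systemMatrix_mulVec_some (β : Fin Ψ.ell → Bool) (z : Var Ψ → ℕ) (y : SlackIdx Ψ → ℕ)
    (i : Fin Ψ.ell) (r : Fin 2) :
    (systemMatrix G e β).mulVec (fun j => ((Sum.elim z y j : ℕ) : ℤ)) (some (i, r)) =
      if (Ψ.counting.get i).1.Mem e.1 then
        if r = 0 then
          ((((Ψ.counting.get i).2.constraint G e.1).terms.map fun t =>
            t.1 * ∑ v ∈ t.2, (z v : ℤ)).sum +
            ∑ k, (Ψ.counting.get i).2.cmp.slack (β i) k * (y (some (i, k)) : ℤ))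
        else ∑ k, (Ψ.counting.get i).2.cmp.remCoeff k * (y (some (i, k)) : ℤ)
      else 0 := by
  simp only [Matrix.mulVec, dotProduct, Fintype.sum_sum_type, Sum.elim_inl, Sum.elim_inr,
    Fintype.sum_option, systemMatrix, zero_mul, zero_add]
  rw [Fintype.sum_prod_type (fun p : Fin Ψ.ell × Fin 4 => _)]
  have hsum : ∀ f : Fin 4 → ℤ, (∑ i' : Fin Ψ.ell, ∑ k, (if (Ψ.counting.get i).1.Mem e.1 ∧ i' = i
      then f k else 0) * (y (some (i', k)) : ℤ)) =
      if (Ψ.counting.get i).1.Mem e.1 then ∑ k, f k * (y (some (i, k)) : ℤ) else 0 := by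
    intro f
    rw [Finset.sum_eq_single i]
    · split_ifs with h1 h2 h2
      · rfl
      · exact absurd h1.1 h2
      · exact absurd ⟨h2, rfl⟩ h1
      · simp
    · intro i' _ hi'
      simp [hi']
    · simp
  refine (congrArg₂ (· + ·) rfl (hsum fun k => if r = 0 then
    (Ψ.counting.get i).2.cmp.slack (β i) k else (Ψ.counting.get i).2.cmp.remCoeff k)).trans ?_
  by_cases hm : (Ψ.counting.get i).1.Mem e.1
  · by_cases hr : r = 0
    · simp only [hm, hr, and_self, if_true]
      rw [LinConstraint.sum_coeff_mul]
    · simp only [hm, hr, and_false, if_false, if_true, zero_mul, Finset.sum_const_zero, zero_add]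
  · simp only [hm, false_and, if_false, zero_mul, Finset.sum_const_zero, zero_add]

/-- The system of the edge, resolved. -/
theorem isSolution_iff_exists_resolution (z : Var Ψ → ℕ) :
    IsSolution (edgeSystem G e) z ↔ ∃ β : Fin Ψ.ell → Bool,
      (∀ i, (Ψ.counting.get i).2.cmp.isNe = false → β i = false) ∧ ∃ y : SlackIdx Ψ → ℕ,
        (systemMatrix G e β).mulVec (fun j => ((Sum.elim z y j : ℕ) : ℤ)) = systemRhs e β := by
  rw [isSolution_edgeSystem_iff]
  constructor
  · rintro ⟨h1, h⟩
    have h' : ∀ i : Fin Ψ.ell, ∃ β, ((Ψ.counting.get i).2.cmp.isNe = false → β = false) ∧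
        ∃ y : Fin 4 → ℕ, (Ψ.counting.get i).1.Mem e.1 →
          ((((Ψ.counting.get i).2.constraint G e.1).terms.map fun t =>
            t.1 * ∑ v ∈ t.2, (z v : ℤ)).sum +
            ∑ k, (Ψ.counting.get i).2.cmp.slack β k * (y k : ℤ)) =
            (Ψ.counting.get i).2.rhs + (Ψ.counting.get i).2.cmp.shift β ∧
          ∑ k, (Ψ.counting.get i).2.cmp.remCoeff k * (y k : ℤ) =
            (Ψ.counting.get i).2.cmp.remBound := by
      intro i
      by_cases hm : (Ψ.counting.get i).1.Mem e.1
      · obtain ⟨β, hβ, y, hy⟩ := (Cmp.holds_iff_exists_slack _ _ _).1 (h i hm)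
        exact ⟨β, hβ, y, fun _ => hy⟩
      · exact ⟨false, fun _ => rfl, 0, fun hm' => absurd hm' hm⟩
    choose β hβ y hy using h'
    -- The slack of `z_{η,π₂} ≥ 1` is the surplus over `1`.
    refine ⟨β, hβ, fun r => r.elim (z e.2 - 1) fun p => y p.1 p.2, ?_⟩
    funext r
    rcases r with _ | ⟨i, r⟩
    · rw [systemMatrix_mulVec_none]
      simp only [Option.elim_none, systemRhs]
      omega
    · rw [systemMatrix_mulVec_some]
      simp only [Option.elim_some, systemRhs]
      split_ifs with hm hr
      · exact (hy i hm).1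
      · exact (hy i hm).2
      · rfl
  · rintro ⟨β, hβ, y, hy⟩
    constructor
    · have := congrFun hy none
      rw [systemMatrix_mulVec_none, systemRhs] at this
      omega
    · intro i hm
      have h0 := congrFun hy (some (i, 0))
      have h1 := congrFun hy (some (i, 1))
      rw [systemMatrix_mulVec_some, systemRhs, if_pos hm, if_pos hm] at h0 h1
      simp only [if_true, Fin.one_eq_zero_iff, OfNat.ofNat_ne_one, if_false] at h0 h1
      exact (Cmp.holds_iff_exists_slack _ _ _).2 ⟨β i, hβ i, fun k => y (some (i, k)), h0, h1⟩

theorem card_isNe (Ψ : Sentence) :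
    Fintype.card {i : Fin Ψ.ell // (Ψ.counting.get i).2.cmp.isNe = true} = Ψ.numNe := by
  have h : (Finset.univ.val.map Ψ.counting.get : Multiset (UAtom × LP)) = Ψ.counting := by
    rw [Fin.univ_val_map, List.ofFn_get]
  rw [Fintype.card_subtype, Sentence.numNe]
  have h2 : Multiset.countP (fun c : UAtom × LP => c.2.cmp.isNe = true)
      (Ψ.counting : Multiset (UAtom × LP)) = Ψ.counting.countP fun c => c.2.cmp.isNe := by
    rw [Multiset.coe_countP]
    simp
  rw [← h2, ← h, Multiset.countP_map]
  rfl

/-- The matrix form of the system of an edge. -/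
theorem exists_matrix_form :
    ∃ (A : Fin (2 ^ Ψ.numNe) → Matrix (Fin (2 * Ψ.ell + 1)) (Var Ψ ⊕ Fin (4 * Ψ.ell + 1)) ℤ)
      (b : Fin (2 ^ Ψ.numNe) → Fin (2 * Ψ.ell + 1) → ℤ),
      (∀ s i j, (A s i j).natAbs ≤ Ψ.maxCoeff) ∧ (∀ s i, (b s i).natAbs ≤ Ψ.maxCoeff) ∧
      ∀ z : Var Ψ → ℕ, IsSolution (edgeSystem G e) z ↔
        ∃ (s : Fin (2 ^ Ψ.numNe)) (y : Fin (4 * Ψ.ell + 1) → ℕ),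
          (A s).mulVec (fun j => ((Sum.elim z y j : ℕ) : ℤ)) = b s := by
  have eR : Fin (2 * Ψ.ell + 1) ≃ RowIdx Ψ := Fintype.equivOfCardEq (by simp [mul_comm])
  have eY : Fin (4 * Ψ.ell + 1) ≃ SlackIdx Ψ := Fintype.equivOfCardEq (by simp [mul_comm])
  have eS : Fin (2 ^ Ψ.numNe) ≃
      ({i : Fin Ψ.ell // (Ψ.counting.get i).2.cmp.isNe = true} → Bool) :=
    Fintype.equivOfCardEq (by rw [Fintype.card_fun, card_isNe]; simp)
  -- The index `s` encodes one bit per disequality; all other bits are `false`.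
  set σ : Fin (2 ^ Ψ.numNe) → Fin Ψ.ell → Bool := fun s i =>
    if h : (Ψ.counting.get i).2.cmp.isNe = true then eS s ⟨i, h⟩ else false with hσ
  set eC : Var Ψ ⊕ Fin (4 * Ψ.ell + 1) ≃ Var Ψ ⊕ SlackIdx Ψ :=
    Equiv.sumCongr (Equiv.refl _) eY with heC
  have hmul : ∀ (β : Fin Ψ.ell → Bool) (z : Var Ψ → ℕ) (y : Fin (4 * Ψ.ell + 1) → ℕ),
      ((systemMatrix G e β).submatrix eR eC).mulVec (fun j => ((Sum.elim z y j : ℕ) : ℤ)) =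
        systemRhs e β ∘ eR ↔ (systemMatrix G e β).mulVec
          (fun j => ((Sum.elim z (y ∘ eY.symm) j : ℕ) : ℤ)) = systemRhs e β := by
    intro β z y
    rw [Matrix.submatrix_mulVec_equiv]
    have : (fun j => ((Sum.elim z y j : ℕ) : ℤ)) ∘ eC.symm =
        fun j => ((Sum.elim z (y ∘ eY.symm) j : ℕ) : ℤ) := by
      funext j
      rcases j with v | k <;> simp [heC]
    rw [this]
    exact ⟨fun h => eR.surjective.injective_comp_right h, fun h => by rw [h]⟩
  refine ⟨fun s => (systemMatrix G e (σ s)).submatrix eR eC, fun s => systemRhs e (σ s) ∘ eR,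
    fun s i j => natAbs_systemMatrix_le G e _ _ _, fun s i => natAbs_systemRhs_le e _ _, ?_⟩
  intro z
  rw [isSolution_iff_exists_resolution]
  simp only [hmul]
  constructor
  · rintro ⟨β, hβ, y, h⟩
    refine ⟨eS.symm fun i => β i.1, y ∘ eY, ?_⟩
    have h1 : σ (eS.symm fun i => β i.1) = β := by
      funext i
      simp only [hσ, Equiv.apply_symm_apply]
      split_ifs with hi
      · rfl
      · exact (hβ i (by simpa using hi)).symm
    have h2 : (y ∘ eY) ∘ eY.symm = y := by funext k; simp
    rw [h1, h2, h]
  · rintro ⟨s, y, h⟩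
    exact ⟨σ s, fun i hi => dif_neg (by simp only [hi]; simp), _, h⟩

/-- A solvable system has a solution with small support and small entries. -/
theorem exists_small_solution_edgeSystem (h : ∃ z, IsSolution (edgeSystem G e) z) :
    ∃ z, IsSolution (edgeSystem G e) z ∧
      ((Finset.univ.filter fun v => z v ≠ 0).card : ℝ) ≤
        2 * (2 * Ψ.ell + 1) * Real.logb 2 (4 * (2 * Ψ.ell + 1) * Ψ.maxCoeff) ∧
      ∀ v, z v ≤ (2 ^ (Ψ.unarySyms.card + 3 * Ψ.binarySyms.card) + 4 * Ψ.ell + 1) *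
        ((2 * Ψ.ell + 1) * Ψ.maxCoeff) ^ (2 * (2 * Ψ.ell + 1) + 1) := by
  obtain ⟨A, b, hA, hb, hsol⟩ := exists_matrix_form G e
  obtain ⟨z₀, hz₀⟩ := h
  obtain ⟨s, y₀, h₀⟩ := (hsol z₀).1 hz₀
  obtain ⟨x, hx, hsupp, hent⟩ := exists_small_solution (by omega) (one_le_maxCoeff Ψ) (hA s) (hb s)
    (x₀ := Sum.elim z₀ y₀) h₀
  refine ⟨x ∘ Sum.inl, (hsol _).2 ⟨s, x ∘ Sum.inr, ?_⟩, le_trans ?_ (hsupp.trans (le_of_eq ?_)), ?_⟩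
  · rw [Sum.elim_comp_inl_inr]
    exact hx
  · rw [Nat.cast_le]
    refine Finset.card_le_card_of_injOn Sum.inl (fun v hv => ?_) (Sum.inl_injective.injOn)
    simpa using hv
  · push_cast
    rfl
  · intro v
    -- The argument gives the exponent `2d`; it is relaxed to `2d + 1`, the base being at least `1`.
    refine (hent (Sum.inl v)).trans (Nat.mul_le_mul ?_ (Nat.pow_le_pow_right ?_ (by omega)))
    · rw [Fintype.card_sum, Fintype.card_fin]
      have := card_var_le Ψ
      omega
    · exact Nat.mul_pos (by omega) (one_le_maxCoeff Ψ)

end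

/-! ### Words and solutions -/

section

variable {Ψ : Sentence}

/-- The symbols `R` with `R(x,y)` in the label. -/
def lab (v : Var Ψ) : Finset ℕ := v.1.1.1.1

theorem mem_optionsList {G : Graph Ψ} {π : UnaryType Ψ} {es : List (Edge Ψ)}
    (hes : es.toFinset = G.E) {B : Finset ℕ} :
    B ∈ optionsList π es ↔ ∃ v ∈ G.out π, lab v = B := by
  simp only [optionsList, List.mem_reverse, List.mem_map, List.mem_filter, decide_eq_true_eq,
    Graph.out, Finset.mem_filter, Finset.mem_univ, true_and, ← hes, List.mem_toFinset, lab]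
  constructor
  · rintro ⟨⟨π', v⟩, ⟨h, rfl⟩, rfl⟩
    exact ⟨v, h, rfl⟩
  · rintro ⟨v, h, rfl⟩
    exact ⟨(π, v.1, v.2), ⟨h, rfl⟩, rfl⟩

/-- The constraint of `P` only depends on how often the symbols occur. -/
theorem sat_constraint_iff {G : Graph Ψ} {π : UnaryType Ψ} (P : LP) {z : Var Ψ → ℕ}
    {w : List (Finset ℕ)} (h : ∀ R : ℕ, w.countP (R ∈ ·) = ∑ v ∈ (G.out π).filter (R ∈ lab ·), z v) :
    (P.constraint G π).Sat z ↔ P.cmp.Holds (P.valOn w) P.rhs := by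
  have : (((P.constraint G π).terms.map fun t => t.1 * ∑ v ∈ t.2, (z v : ℤ)).sum) = P.valOn w := by
    simp only [LP.constraint, LP.valOn, List.map_map, Function.comp_def, h]
    push_cast
    rfl
  rw [LinConstraint.Sat, this]
  rfl

/-- The link between words and solutions. Different edges may share a letter, so a word does not
determine `z`, but the constraints of the conjuncts only see the number of letters containing each
`R`. -/
theorem isSolution_iff_forall_not_violates {G : Graph Ψ} {e : Edge Ψ} {z : Var Ψ → ℕ}
    {w : List (Finset ℕ)}
    (h : ∀ R : ℕ, w.countP (R ∈ ·) = ∑ v ∈ (G.out e.1).filter (R ∈ lab ·), z v) :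
    IsSolution (edgeSystem G e) z ↔ 1 ≤ z e.2 ∧ ∀ d ∈ Ψ.counting, ¬ Violates e.1 w d := by
  rw [isSolution_edgeSystem_iff]
  refine and_congr_right fun _ => ?_
  simp only [sat_constraint_iff _ h, Violates, not_and, not_not]
  constructor
  · intro h d hd
    obtain ⟨i, rfl⟩ := List.get_of_mem hd
    exact h i
  · exact fun h i => h _ (List.get_mem _ _)

theorem sum_countP_eq {α : Type} [DecidableEq α] (S : Finset α) (l : List α) :
    ∑ v ∈ S, l.countP (· = v) = l.countP (· ∈ S) := by
  induction l with
  | nil => simp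
  | cons a l ih =>
    simp only [Finset.sum_add_distrib, ih, List.countP_cons]
    simp

theorem forall_mem_of_mem_iterate {O : List (Finset ℕ)} : ∀ {n : ℕ} {w : List (Finset ℕ)},
    w ∈ (extendWords O)^[n] [[]] → ∀ B ∈ w, B ∈ O
  | 0, w, h => by simp_all
  | n + 1, w, h => by
    rw [Function.iterate_succ_apply', mem_extendWords] at h
    obtain ⟨x, hx, h⟩ := h
    have ih := forall_mem_of_mem_iterate hx
    rcases h with rfl | rfl | ⟨A, hA, rfl⟩
    · exact ih
    · simpa using ih
    · simpa using ⟨hA, ih⟩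

theorem mem_iterate_mono {O : List (Finset ℕ)} {w : List (Finset ℕ)} {n m : ℕ} (hnm : n ≤ m)
    (h : w ∈ (extendWords O)^[n] [[]]) : w ∈ (extendWords O)^[m] [[]] := by
  induction m, hnm using Nat.le_induction with
  | base => exact h
  | succ m _ ih =>
    rw [Function.iterate_succ_apply', mem_extendWords]
    exact ⟨w, ih, .inl rfl⟩

/-- A good word gives a solution. -/
theorem exists_solution_of_word {G : Graph Ψ} {e : Edge Ψ} (he : e ∈ G.E) {es : List (Edge Ψ)}
    (hes : es.toFinset = G.E) {w : List (Finset ℕ)} (hw : ∀ B ∈ w, B ∈ optionsList e.1 es)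
    (h : ∀ d ∈ Ψ.counting, ¬ Violates e.1 (lab e.2 :: w) d) :
    ∃ z, IsSolution (edgeSystem G e) z := by
  -- Choose an outgoing edge for each letter. The solution counts how often a variable has been
  -- chosen, the distinguished one being counted once more.
  have hlist : ∀ w : List (Finset ℕ), (∀ B ∈ w, B ∈ optionsList e.1 es) →
      ∃ vs : List (Var Ψ), (∀ v ∈ vs, v ∈ G.out e.1) ∧ vs.map lab = w := by
    intro w hw
    induction w with
    | nil => exact ⟨[], by simp⟩
    | cons B w ih =>
      rw [List.forall_mem_cons] at hw
      obtain ⟨vs, h1, h2⟩ := ih hw.2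
      obtain ⟨v, hv, hvB⟩ := (mem_optionsList hes).1 hw.1
      exact ⟨v :: vs, List.forall_mem_cons.2 ⟨hv, h1⟩, by simp [h2, hvB]⟩
  obtain ⟨vs, hvs, rfl⟩ := hlist w hw
  have heo : e.2 ∈ G.out e.1 := by simpa [Graph.out] using he
  have hvs' : ∀ v ∈ e.2 :: vs, v ∈ G.out e.1 := List.forall_mem_cons.2 ⟨heo, hvs⟩
  refine ⟨fun v => (e.2 :: vs).countP (· = v),
    (isSolution_iff_forall_not_violates (w := lab e.2 :: vs.map lab) fun R => ?_).2 ⟨by simp, h⟩⟩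
  rw [sum_countP_eq, ← List.map_cons, List.countP_map]
  refine List.countP_congr fun v hv => ?_
  simp [hvs' v hv]

/-- One binary digit of all multiplicities is added, one round per element of `T`; a round with
digit `0` keeps the word. -/
theorem exists_word_add {O : List (Finset ℕ)} {n : ℕ} {x : List (Finset ℕ)}
    (hx : x ∈ (extendWords O)^[n] [[]]) (r : Var Ψ → ℕ) (hr : ∀ v, r v ≤ 1) (T : Finset (Var Ψ))
    (hT : ∀ v ∈ T, lab v ∈ O) :
    ∃ w ∈ (extendWords O)^[n + T.card] [[]], ∀ R : ℕ, w.countP (R ∈ ·) =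
      x.countP (R ∈ ·) + ∑ v ∈ T, if R ∈ lab v then r v else 0 := by
  induction T using Finset.induction_on with
  | empty => exact ⟨x, by simpa using hx, by simp⟩
  | insert v T hv ih =>
    obtain ⟨w, hw, hcount⟩ := ih fun v hv => hT v (Finset.mem_insert_of_mem hv)
    rw [Finset.card_insert_of_notMem hv, ← add_assoc]
    rcases Nat.le_one_iff_eq_zero_or_eq_one.1 (hr v) with h0 | h1
    · refine ⟨w, mem_iterate_mono (by omega) hw, fun R => ?_⟩
      rw [Finset.sum_insert hv, hcount, h0]
      simp
    · refine ⟨lab v :: w, ?_, fun R => ?_⟩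
      · rw [Function.iterate_succ_apply', mem_extendWords]
        exact ⟨w, hw, .inr (.inr ⟨_, hT v (Finset.mem_insert_self _ _), rfl⟩)⟩
      · rw [Finset.sum_insert hv, List.countP_cons, hcount, h1]
        simp only [decide_eq_true_eq]
        omega

/-- Words with given numbers of letters are reached by doubling and adding. -/
theorem exists_word {O : List (Finset ℕ)} (T : Finset (Var Ψ)) (hT : ∀ v ∈ T, lab v ∈ O) :
    ∀ (b : ℕ) (c : Var Ψ → ℕ), (∀ v, c v < 2 ^ b) →
      ∃ w ∈ (extendWords O)^[b * (T.card + 1)] [[]], ∀ R : ℕ, w.countP (R ∈ ·) =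
        ∑ v ∈ T, if R ∈ lab v then c v else 0
  | 0, c, hc => ⟨[], by simp, fun R => by
      have : ∀ v, c v = 0 := fun v => by simpa using hc v
      simp [this]⟩
  | b + 1, c, hc => by
    -- Horner's scheme: a word for the halves is doubled, then the parities are added, so a digit
    -- costs `|T| + 1` rounds.
    obtain ⟨x, hx, hxc⟩ := exists_word T hT b (fun v => c v / 2) fun v => by
      have := hc v
      rw [pow_succ] at this
      omega
    have hxx : x ++ x ∈ (extendWords O)^[b * (T.card + 1) + 1] [[]] := by
      rw [Function.iterate_succ_apply', mem_extendWords]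
      exact ⟨x, hx, .inr (.inl rfl)⟩
    obtain ⟨w, hw, hwc⟩ := exists_word_add hxx (fun v => c v % 2) (fun v => by omega) T hT
    refine ⟨w, ?_, fun R => ?_⟩
    · convert hw using 2
      ring
    · rw [hwc, List.countP_append, hxc, ← Finset.sum_add_distrib, ← Finset.sum_add_distrib]
      refine Finset.sum_congr rfl fun v _ => ?_
      split_ifs
      · omega
      · rfl

/-- A small solution gives a good word. -/
theorem exists_word_of_solution {G : Graph Ψ} {e : Edge Ψ} (he : e ∈ G.E) {es : List (Edge Ψ)}
    (hes : es.toFinset = G.E) {z : Var Ψ → ℕ} (hz : IsSolution (edgeSystem G e) z) {b K n : ℕ}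
    (hb : ∀ v, z v < 2 ^ b) (hK : (Finset.univ.filter fun v => z v ≠ 0).card ≤ K)
    (hn : b * (K + 1) ≤ n) :
    ∃ w ∈ (extendWords (optionsList e.1 es))^[n] [[]],
      ∀ d ∈ Ψ.counting, ¬ Violates e.1 (lab e.2 :: w) d := by
  have h1 : 1 ≤ z e.2 := ((isSolution_edgeSystem_iff G e).1 hz).1
  have heo : e.2 ∈ G.out e.1 := by simpa [Graph.out] using he
  set T := (G.out e.1).filter fun v => z v ≠ 0 with hT
  have heT : e.2 ∈ T := by
    simp only [hT, Finset.mem_filter]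
    exact ⟨heo, by omega⟩
  have hTK : T.card ≤ K :=
    (Finset.card_le_card (Finset.filter_subset_filter _ (Finset.subset_univ _))).trans hK
  -- One occurrence of the distinguished edge is left out, because its letter is prepended to the
  -- word.
  obtain ⟨w, hw, hwc⟩ := exists_word (O := optionsList e.1 es) T
    (fun v hv => (mem_optionsList hes).2 ⟨v, (Finset.mem_filter.1 hv).1, rfl⟩) b
    (fun v => if v = e.2 then z v - 1 else z v) fun v => by
      have := hb v
      split_ifs <;> omega
  refine ⟨w, mem_iterate_mono ((Nat.mul_le_mul_left _ (by omega)).trans hn) hw,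
    ((isSolution_iff_forall_not_violates fun R => ?_).1 hz).2⟩
  have hsum : ∑ v ∈ (G.out e.1).filter (R ∈ lab ·), z v = ∑ v ∈ T, if R ∈ lab v then z v else 0 := by
    rw [Finset.sum_filter, hT, Finset.sum_filter]
    refine Finset.sum_congr rfl fun v _ => ?_
    by_cases h0 : z v = 0 <;> simp [h0]
  rw [hsum, List.countP_cons, hwc, ← Finset.add_sum_erase _ _ heT, ← Finset.add_sum_erase _ _ heT]
  have hrest : ∑ v ∈ T.erase e.2, (if R ∈ lab v then (if v = e.2 then z v - 1 else z v) else 0) =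
      ∑ v ∈ T.erase e.2, if R ∈ lab v then z v else 0 :=
    Finset.sum_congr rfl fun v hv => by rw [if_neg (Finset.ne_of_mem_erase hv)]
  rw [hrest]
  generalize (∑ v ∈ T.erase e.2, if R ∈ lab v then z v else 0) = X
  by_cases hR : R ∈ lab e.2
  · simp only [hR, decide_true, if_true]
    omega
  · simp only [hR, decide_false, if_false, Bool.false_eq_true, zero_add, add_zero]

end

/-! ### Bounds in terms of the length of the sentence -/

section

variable (Ψ : Sentence)

/-- Each conjunct needs an `item` and an atom; the other three tokens are one of `gamma` and the two
list ends. -/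
theorem two_mul_ell_add_three_le : 2 * Ψ.ell + 3 ≤ Ψ.length := by
  have h1 : ∀ l : List (UAtom × LP),
      2 * l.length + 1 ≤ (encList (fun c : UAtom × LP => c.1.enc ++ c.2.enc) l).length := by
    intro l
    induction l with
    | nil => simp [encList]
    | cons c l ih =>
      have : 1 ≤ c.1.enc.length := by cases c.1 <;> simp [UAtom.enc]
      simp only [encList, List.flatMap_cons, List.length_append, List.length_cons,
        List.length_nil] at ih ⊢
      omega
  have h2 : 1 ≤ (encList (fun c : ℕ × QF 2 => encNat c.1 ++ c.2.enc) Ψ.guarded).length := by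
    simp [encList]
  have h3 : 1 ≤ Ψ.gamma.enc.length := by
    cases Ψ.gamma <;> simp [QF.enc]
  have := h1 Ψ.counting
  simp only [Sentence.length, Sentence.enc, List.length_append, Sentence.ell]
  omega

theorem three_le_length : 3 ≤ Ψ.length := by
  have := two_mul_ell_add_three_le Ψ
  omega

theorem dim_mul_maxCoeff_le : (2 * Ψ.ell + 1) * Ψ.maxCoeff ≤ 2 ^ (2 * Ψ.length) := by
  have h1 := two_mul_ell_add_three_le Ψ
  have h2 : Ψ.length < 2 ^ Ψ.length := Nat.lt_two_pow_self
  rw [two_mul Ψ.length, pow_add]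
  exact Nat.mul_le_mul (by omega) Ψ.maxCoeff_le

/-- The number of rounds suffices for the small solution. -/
theorem exists_small_solution_rounds (G : Graph Ψ) (e : Edge Ψ)
    (h : ∃ z, IsSolution (edgeSystem G e) z) :
    ∃ (z : Var Ψ → ℕ) (b K : ℕ), IsSolution (edgeSystem G e) z ∧ (∀ v, z v < 2 ^ b) ∧
      (Finset.univ.filter fun v => z v ≠ 0).card ≤ K ∧ b * (K + 1) ≤ Ψ.length ^ 8 := by
  obtain ⟨z, hz, hsupp, hent⟩ := exists_small_solution_edgeSystem G e h
  have hd := two_mul_ell_add_three_le Ψ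
  have hL := three_le_length Ψ
  have hdM := dim_mul_maxCoeff_le Ψ
  have hM := one_le_maxCoeff Ψ
  have hsy := Ψ.card_syms_le
  set L := Ψ.length
  -- The entries are at most `2 ^ (3L + 1) * 2 ^ (2L (2L + 1))`, and one more bit makes the
  -- inequality strict. The support is at most `2L (2 + 2L)`.
  refine ⟨z, 4 * L ^ 2 + 5 * L + 2, 4 * L ^ 2 + 4 * L, hz, fun v => ?_, ?_, ?_⟩
  · have h1 : 2 ^ (Ψ.unarySyms.card + 3 * Ψ.binarySyms.card) + 4 * Ψ.ell + 1 ≤ 2 ^ (3 * L + 1) := by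
      have : 2 ^ (Ψ.unarySyms.card + 3 * Ψ.binarySyms.card) ≤ 2 ^ (3 * L) :=
        Nat.pow_le_pow_right (by norm_num) (by omega)
      have : 3 * L < 2 ^ (3 * L) := Nat.lt_two_pow_self
      rw [pow_succ]
      omega
    have h2 : ((2 * Ψ.ell + 1) * Ψ.maxCoeff) ^ (2 * (2 * Ψ.ell + 1) + 1) ≤
        2 ^ (2 * L * (2 * L + 1)) := by
      rw [pow_mul]
      refine (Nat.pow_le_pow_left hdM _).trans (Nat.pow_le_pow_right (by positivity) (by omega))
    refine lt_of_le_of_lt ((hent v).trans (Nat.mul_le_mul h1 h2)) ?_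
    rw [← pow_add]
    refine Nat.pow_lt_pow_right (by norm_num) ?_
    nlinarith
  · have hlog : Real.logb 2 (4 * (2 * Ψ.ell + 1) * Ψ.maxCoeff) ≤ 2 + 2 * L := by
      have h1 : (4 * (2 * Ψ.ell + 1) * Ψ.maxCoeff : ℝ) ≤ 2 ^ (2 + 2 * L) := by
        have : 4 * ((2 * Ψ.ell + 1) * Ψ.maxCoeff) ≤ 2 ^ (2 + 2 * L) := by
          rw [pow_add]
          exact Nat.mul_le_mul (by norm_num) hdM
        rw [mul_assoc]
        exact_mod_cast this
      have hpos : (0 : ℝ) < 4 * (2 * Ψ.ell + 1) * Ψ.maxCoeff := by positivity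
      refine (Real.logb_le_logb_of_le (by norm_num) hpos h1).trans (le_of_eq ?_)
      rw [Real.logb_pow, Real.logb_self_eq_one (by norm_num)]
      push_cast
      ring
    have hd' : (2 * Ψ.ell + 1 : ℝ) ≤ L := by
      have : 2 * Ψ.ell + 1 ≤ L := by omega
      exact_mod_cast this
    have : ((Finset.univ.filter fun v => z v ≠ 0).card : ℝ) ≤ ((4 * L ^ 2 + 4 * L : ℕ) : ℝ) := by
      refine hsupp.trans ?_
      calc 2 * (2 * Ψ.ell + 1) * Real.logb 2 (4 * (2 * Ψ.ell + 1) * Ψ.maxCoeff)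
          ≤ 2 * (2 * Ψ.ell + 1) * (2 + 2 * L) := by gcongr
        _ ≤ 2 * L * (2 + 2 * L) := by gcongr
        _ = ((4 * L ^ 2 + 4 * L : ℕ) : ℝ) := by push_cast; ring
    exact_mod_cast this
  · have h1 : 4 * L ^ 2 + 5 * L + 2 ≤ 6 * L ^ 2 := by nlinarith
    have h2 : 4 * L ^ 2 + 4 * L + 1 ≤ 6 * L ^ 2 := by nlinarith
    -- The number of rounds is at most `36 L ^ 4`; as `L ≥ 3`, the constant is absorbed by `L ^ 8`,
    -- a power obtained by three squarings.
    have h3 : 36 ≤ L ^ 4 := le_trans (by norm_num) (Nat.pow_le_pow_left hL 4)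
    calc (4 * L ^ 2 + 5 * L + 2) * (4 * L ^ 2 + 4 * L + 1) ≤ 6 * L ^ 2 * (6 * L ^ 2) :=
          Nat.mul_le_mul h1 h2
      _ = 36 * L ^ 4 := by ring
      _ ≤ L ^ 4 * L ^ 4 := Nat.mul_le_mul_right _ h3
      _ = L ^ 8 := by ring

/-- The program answers correctly. -/
theorem exists_word_iff_exists_solution {G : Graph Ψ} {e : Edge Ψ} (he : e ∈ G.E)
    {es : List (Edge Ψ)} (hes : es.toFinset = G.E) :
    (∃ w ∈ (extendWords (optionsList e.1 es))^[Ψ.length ^ 8] [[]],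
      ∀ d ∈ Ψ.counting, ¬ Violates e.1 (e.2.1.1.1.1 :: w) d) ↔
    ∃ z, IsSolution (edgeSystem G e) z := by
  constructor
  · rintro ⟨w, hw, h⟩
    exact exists_solution_of_word he hes (forall_mem_of_mem_iterate hw) h
  · intro h
    obtain ⟨z, b, K, hz, hb, hK, hn⟩ := exists_small_solution_rounds Ψ G e h
    exact exists_word_of_solution he hes hz hb hK hn

theorem length_encSet (A : Finset ℕ) :
    (encSet A).length = ∑ i ∈ A, ((encNat i).length + 1) + 1 := by
  have h : ∀ l : List ℕ, (encList encNat l).length =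
      (l.map fun i => (encNat i).length + 1).sum + 1 := by
    intro l
    induction l with
    | nil => simp [encList]
    | cons a l ih =>
      simp only [encList, List.flatMap_cons, List.length_append, List.length_cons, List.map_cons,
        List.sum_cons] at ih ⊢
      omega
  rw [encSet, h]
  congr 1
  conv_rhs => rw [← A.sort_toFinset (· ≤ ·)]
  exact (List.sum_toFinset _ (A.sort_nodup _)).symm

theorem length_encSet_le {A S : Finset ℕ} (hA : A ⊆ S)
    (hS : ∑ i ∈ S, (encNat i).length ≤ Ψ.length) : (encSet A).length ≤ 2 * Ψ.length + 1 := by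
  have h1 : ∑ i ∈ A, ((encNat i).length + 1) ≤ ∑ i ∈ A, 2 * (encNat i).length :=
    Finset.sum_le_sum fun i _ => by have := length_encNat_pos i; omega
  have h2 : ∑ i ∈ A, (encNat i).length ≤ ∑ i ∈ S, (encNat i).length :=
    Finset.sum_le_sum_of_subset hA
  rw [← Finset.mul_sum] at h1
  rw [length_encSet]
  omega

theorem length_encSet_unary_le {A : Finset ℕ} (hA : A ∈ Ψ.unarySyms.powerset) :
    (encSet A).length ≤ 2 * Ψ.length + 1 := by
  have := Ψ.symLength_le
  exact length_encSet_le Ψ (Finset.mem_powerset.1 hA) (by simp only [symLength] at this; omega)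

theorem length_encSet_binary_le {A : Finset ℕ} (hA : A ∈ Ψ.binarySyms.powerset) :
    (encSet A).length ≤ 2 * Ψ.length + 1 := by
  have := Ψ.symLength_le
  exact length_encSet_le Ψ (Finset.mem_powerset.1 hA) (by simp only [symLength] at this; omega)

theorem length_encUnaryType_le (π : UnaryType Ψ) :
    (encUnaryType π).length ≤ 4 * Ψ.length + 2 := by
  have h1 := length_encSet_unary_le Ψ π.1.2
  have h2 := length_encSet_binary_le Ψ π.2.2
  simp only [encUnaryType, List.length_append]
  omega

theorem length_encEdge_le (e : Edge Ψ) : (encEdge e).length ≤ 12 * Ψ.length + 6 := by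
  have h1 := length_encUnaryType_le Ψ e.1
  have h2 := length_encUnaryType_le Ψ e.2.2
  have h3 := length_encSet_binary_le Ψ e.2.1.1.1.2
  have h4 := length_encSet_binary_le Ψ e.2.1.1.2.2
  simp only [encEdge, List.length_append]
  omega

theorem length_encList_le {α : Type} {f : α → List Tok} {K : ℕ} (h : ∀ a, (f a).length ≤ K)
    (l : List α) : (encList f l).length ≤ l.length * (K + 1) + 1 := by
  induction l with
  | nil => simp [encList]
  | cons a l ih =>
    have := h a
    simp only [encList, List.flatMap_cons, List.length_append, List.length_cons, List.length_nil]
      at ih ⊢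
    rw [add_mul]
    omega

theorem length_unaryTypes_le {vs : List (UnaryType Ψ)} (hvs : vs.Nodup) :
    vs.length ≤ 2 ^ Ψ.length := by
  refine (hvs.length_le_card).trans ?_
  simp only [Fintype.card_prod, Fintype.card_coe, Finset.card_powerset]
  rw [← pow_add]
  exact Nat.pow_le_pow_right (by norm_num) Ψ.card_syms_le

theorem length_edges_le {es : List (Edge Ψ)} (hes : es.Nodup) :
    es.length ≤ 2 ^ (4 * Ψ.length) := by
  have h1 : es.length ≤ Fintype.card (Edge Ψ) := hes.length_le_card
  have h2 : Fintype.card (Edge Ψ) = Fintype.card (UnaryType Ψ) * Fintype.card (Var Ψ) :=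
    Fintype.card_prod _ _
  have h3 : Fintype.card (UnaryType Ψ) = 2 ^ (Ψ.unarySyms.card + Ψ.binarySyms.card) := by
    simp only [Fintype.card_prod, Fintype.card_coe, Finset.card_powerset, pow_add]
  rw [h2, h3] at h1
  refine h1.trans ((Nat.mul_le_mul_left _ (card_var_le Ψ)).trans ?_)
  rw [← pow_add]
  refine Nat.pow_le_pow_right (by norm_num) ?_
  have := Ψ.card_syms_le
  omega

/-- The length of the input. -/
theorem length_input_le {vs : List (UnaryType Ψ)} (hvs : vs.Nodup) {es : List (Edge Ψ)}
    (hes : es.Nodup) (e : Edge Ψ) :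
    (Ψ.enc ++ encList encUnaryType vs ++ encList encEdge es ++ encEdge e).length ≤
      2 ^ (8 * Ψ.length) := by
  have h1 := length_encList_le (length_encUnaryType_le Ψ) vs
  have h2 := length_encList_le (length_encEdge_le Ψ) es
  have h3 := length_encEdge_le Ψ e
  have h4 := length_unaryTypes_le Ψ hvs
  have h5 := length_edges_le Ψ hes
  have h6 : Ψ.length < 2 ^ Ψ.length := Nat.lt_two_pow_self
  have h7 : 2 ^ 3 ≤ 2 ^ Ψ.length := Nat.pow_le_pow_right (by norm_num) (three_le_length Ψ)
  have h8 : Ψ.enc.length = Ψ.length := rfl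
  simp only [List.length_append, h8]
  rw [mul_comm, pow_mul] at h5 ⊢
  set x := 2 ^ Ψ.length
  have h9 : vs.length * (4 * Ψ.length + 2 + 1) ≤ x * (5 * x) := Nat.mul_le_mul h4 (by omega)
  have h10 : es.length * (12 * Ψ.length + 6 + 1) ≤ x ^ 4 * (13 * x) := Nat.mul_le_mul h5 (by omega)
  -- Here `x = 2 ^ L ≥ 8`, so `x ^ 3` exceeds the sum `33` of the coefficients.
  have h11 : x * (5 * x) + x ^ 4 * (13 * x) + 15 * x ≤ x ^ 8 := by
    have ha : x * (5 * x) ≤ 5 * x ^ 5 := by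
      have : x ^ 2 ≤ x ^ 5 := Nat.pow_le_pow_right (by omega) (by norm_num)
      nlinarith
    have hb : 15 * x ≤ 15 * x ^ 5 := Nat.mul_le_mul_left _ (Nat.le_self_pow (by norm_num) _)
    have hc : 8 ^ 3 ≤ x ^ 3 := Nat.pow_le_pow_left (by omega) 3
    calc x * (5 * x) + x ^ 4 * (13 * x) + 15 * x ≤ 33 * x ^ 5 := by
          have : x ^ 4 * (13 * x) = 13 * x ^ 5 := by ring
          omega
      _ ≤ x ^ 3 * x ^ 5 := Nat.mul_le_mul_right _ (by omega)
      _ = x ^ 8 := by ring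
  omega

theorem length_wordStr_optionsList_le (π : UnaryType Ψ) {es : List (Edge Ψ)} (hes : es.Nodup) :
    (wordStr (optionsList π es)).length ≤ 2 ^ (6 * Ψ.length) := by
  have h1 : ∀ w : List (Finset ℕ), (∀ B ∈ w, B ∈ Ψ.binarySyms.powerset) →
      (wordStr w).length ≤ w.length * (2 * Ψ.length + 1) := by
    intro w hw
    induction w with
    | nil => simp [wordStr]
    | cons B w ih =>
      simp only [List.mem_cons, forall_eq_or_imp] at hw
      have h1 := length_encSet_binary_le Ψ hw.1
      have h2 := ih hw.2
      have e : wordStr (B :: w) = encSet B ++ wordStr w := rfl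
      rw [e, List.length_append, List.length_cons, add_mul]
      omega
  have h2 : (optionsList π es).length ≤ 2 ^ (4 * Ψ.length) := by
    refine le_trans ?_ (length_edges_le Ψ hes)
    simp only [optionsList, List.length_reverse, List.length_map]
    exact List.length_filter_le _ _
  have h3 : 2 * Ψ.length + 1 ≤ 2 ^ (2 * Ψ.length) := by
    have : 2 * Ψ.length < 2 ^ (2 * Ψ.length) := Nat.lt_two_pow_self
    omega
  refine (h1 _ fun B hB => ?_).trans ((Nat.mul_le_mul h2 h3).trans (le_of_eq ?_))
  · simp only [optionsList, List.mem_reverse, List.mem_map] at hB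
    obtain ⟨e, -, rfl⟩ := hB
    exact e.2.1.1.1.2
  · rw [← pow_add]
    congr 1
    ring

theorem length_wordsStr_iterate_le (O : List (Finset ℕ)) (i : ℕ) :
    (wordsStr ((extendWords O)^[i] [[]])).length ≤ (3 + 2 * (wordStr O).length) ^ i := by
  induction i with
  | zero => simp [wordsStr, wordStr]
  | succ i ih =>
    rw [Function.iterate_succ_apply', pow_succ]
    exact (length_wordsStr_extendWords _ _).trans (Nat.mul_le_mul_right _ ih)

/-- Each of the at most `L ^ 8` rounds multiplies the length by at most `2 ^ (8L)`. Exhaustive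
generation therefore remains within single exponential space in a polynomial of `L`. -/
theorem length_words_le (π : UnaryType Ψ) {es : List (Edge Ψ)} (hes : es.Nodup) {i : ℕ}
    (hi : i ≤ Ψ.length ^ 8) :
    (wordsStr ((extendWords (optionsList π es))^[i] [[]])).length ≤ 2 ^ (8 * Ψ.length ^ 9) := by
  have h1 := length_wordStr_optionsList_le Ψ π hes
  have h2 : 3 + 2 * (wordStr (optionsList π es)).length ≤ 2 ^ (8 * Ψ.length) := by
    have h3 : 2 ^ (6 * Ψ.length) * 2 ^ 3 ≤ 2 ^ (8 * Ψ.length) := by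
      rw [← pow_add]
      have := three_le_length Ψ
      exact Nat.pow_le_pow_right (by norm_num) (by omega)
    have h4 : 1 ≤ 2 ^ (6 * Ψ.length) := Nat.one_le_two_pow
    omega
  refine (length_wordsStr_iterate_le _ _).trans ((Nat.pow_le_pow_left h2 _).trans ?_)
  rw [← pow_mul]
  refine Nat.pow_le_pow_right (by norm_num) ((Nat.mul_le_mul_left _ hi).trans (le_of_eq ?_))
  ring

/-- All loops of the program make at most `2 ^ (10 |Ψ| ^ 9)` iterations. -/
theorem exec_decideProg_of_describes {G : Graph Ψ} {e : Edge Ψ} (he : e ∈ G.E) {w : List Tok}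
    (hw : Describes Ψ G e w) {b : Bool}
    (hb : b = true ↔ ∃ z, IsSolution (edgeSystem G e) z) :
    Exec (2 ^ (10 * Ψ.length ^ 9)) decideProg (fun r => if r = .inp then w else [])
      (fun r => if r = .res ∧ b = true then [.top] else []) := by
  obtain ⟨vs, es, hvs, -, hes, hesE, rfl⟩ := hw
  have hL := three_le_length Ψ
  have hw := fun i (hi : i ≤ Ψ.length ^ 8) => length_words_le Ψ e.1 hes hi
  have hO := length_wordStr_optionsList_le Ψ e.1 hes
  have hinp := length_input_le Ψ hvs hes e
  have hA := length_encSet_binary_le Ψ e.2.1.1.1.2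
  have hweight : ∀ d ∈ Ψ.counting, 2 * d.2.weight + 1 ≤ 2 ^ (Ψ.length + 1) := fun d hd => by
    have h1 := Ψ.weight_succ_le_maxCoeff hd
    have h2 := Ψ.maxCoeff_le
    rw [pow_succ]
    omega
  set L := Ψ.length
  have hL9 : L ≤ L ^ 9 := Nat.le_self_pow (by norm_num) _
  have hpow : ∀ {k : ℕ}, k ≤ 10 * L ^ 9 → 2 ^ k ≤ 2 ^ (10 * L ^ 9) := fun h =>
    Nat.pow_le_pow_right (by norm_num) h
  have h8 : 2 ^ 1 ≤ 2 ^ (8 * L ^ 9) := Nat.pow_le_pow_right (by norm_num) (by omega)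
  refine exec_decideProg Ψ vs es e (hinp.trans (hpow (by omega))) (hO.trans (hpow (by omega)))
    ?_ (fun i hi => ?_) (fun d hd => ?_) (hb.trans (exists_word_iff_exists_solution Ψ he hesE).symm)
  · have : L ^ 8 ≤ (2 ^ L) ^ 8 := Nat.pow_le_pow_left Nat.lt_two_pow_self.le 8
    rw [← pow_mul] at this
    exact this.trans (hpow (by omega))
  · have h1 : 2 * L < 2 ^ (2 * L) := Nat.lt_two_pow_self
    have h2 : 2 ^ (2 * L) ≤ 2 ^ (8 * L ^ 9) := Nat.pow_le_pow_right (by norm_num) (by omega)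
    have h3 : 2 ^ (8 * L ^ 9 + 1) ≤ 2 ^ (10 * L ^ 9) := hpow (by omega)
    have h4 := hw i hi
    rw [pow_succ] at h3
    omega
  -- Length of the words times size of the coefficients: this bounds the unary accumulators.
  · have h1 : (wordsStr ((extendWords (optionsList e.1 es))^[L ^ 8] [[]])).length + 2 ≤
        2 ^ (8 * L ^ 9 + 1) := by
      have := hw _ le_rfl
      rw [pow_succ 2]
      omega
    refine (Nat.mul_le_mul h1 (hweight d hd)).trans ?_
    rw [← pow_add]
    exact hpow (by omega)

end

/-! ### The exponential time bound for the machine -/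

theorem AnswersWithin.mono {T : Turing.TM2ComputableAux Tok Bool} {w : List Tok} {b : Bool}
    {n m : ℕ} (hnm : n ≤ m) (h : AnswersWithin T w b n) : AnswersWithin T w b m := by
  obtain ⟨h⟩ := h
  exact ⟨⟨h.toEvalsTo, h.steps_le_m.trans hnm⟩⟩

/-- One machine decides solvability in exponential time. -/
theorem exists_machine : ∃ (T : Turing.TM2ComputableAux Tok Bool) (p : Polynomial ℕ),
    ∀ (Ψ : Sentence) (G : Graph Ψ) (e : Edge Ψ), e ∈ G.E → ∀ w : List Tok, Describes Ψ G e w →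
      ∃ b : Bool, (b = true ↔ ∃ z, IsSolution (edgeSystem G e) z) ∧
        AnswersWithin T w b (2 ^ p.eval Ψ.length) := by
  classical
  obtain ⟨c, k, hck⟩ := decideProg.exists_time_le
  -- With `n = L ^ 9` and `N = 2 ^ (10 n)`, the time `c (N + 1) ^ k` is at most `2 ^ c * 2 ^ ((10 n
  -- + 1) k)`. One more factor of two pays for the final step.
  refine ⟨decideProg.machine .inp .res, .C (c + k + 1) + .C (10 * k) * .X ^ 9, ?_⟩
  intro Ψ G e he w hw
  refine ⟨decide (∃ z, IsSolution (edgeSystem G e) z), by simp, ?_⟩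
  refine AnswersWithin.mono ?_ (Prog.machine_answers decideProg .inp .res
    (exec_decideProg_of_describes Ψ he hw (by simp)))
  simp only [Polynomial.eval_add, Polynomial.eval_C, Polynomial.eval_mul, Polynomial.eval_pow,
    Polynomial.eval_X]
  set n := Ψ.length ^ 9
  have h1 : 2 ^ (10 * n) + 1 ≤ 2 ^ (10 * n + 1) := by
    have : 1 ≤ 2 ^ (10 * n) := Nat.one_le_two_pow
    rw [pow_succ]
    omega
  have h2 : decideProg.time (2 ^ (10 * n)) ≤ 2 ^ c * 2 ^ ((10 * n + 1) * k) := by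
    refine (hck _).trans (Nat.mul_le_mul Nat.lt_two_pow_self.le ?_)
    rw [pow_mul 2 (10 * n + 1)]
    exact Nat.pow_le_pow_left h1 k
  rw [← pow_add] at h2
  have h3 : 1 ≤ 2 ^ (c + (10 * n + 1) * k) := Nat.one_le_two_pow
  calc decideProg.time (2 ^ (10 * n)) + 1 ≤ 2 ^ (c + (10 * n + 1) * k + 1) := by
        rw [pow_succ]; omega
    _ = 2 ^ (c + k + 1 + 10 * k * n) := by congr 1; ring

end GP2

theorem mainTheorem3 :
    -- one machine decides in time `2 ^ poly(|Ψ|)` whether the system of an edge is solvable in `ℕ`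
    (∃ (T : Turing.TM2ComputableAux GP2.Tok Bool) (p : Polynomial ℕ),
      ∀ (Ψ : GP2.Sentence) (G : GP2.Graph Ψ) (e : GP2.Edge Ψ), e ∈ G.E →
        ∀ w : List GP2.Tok, GP2.Describes Ψ G e w →
          ∃ b : Bool, (b = true ↔ ∃ z, GP2.IsSolution (GP2.edgeSystem G e) z) ∧
            GP2.AnswersWithin T w b (2 ^ p.eval Ψ.length)) ∧
    (∀ (Ψ : GP2.Sentence) (G : GP2.Graph Ψ) (e : GP2.Edge Ψ), e ∈ G.E →
      -- number of constraints, number of variables, size of the coefficients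
      (GP2.edgeSystem G e).length ≤ Ψ.ell + 1 ∧
      Fintype.card (GP2.Var Ψ) ≤ 2 ^ (Ψ.unarySyms.card + 3 * Ψ.binarySyms.card) ∧
      Ψ.unarySyms.card + Ψ.binarySyms.card ≤ Ψ.length ∧
      Ψ.maxCoeff ≤ 2 ^ Ψ.length ∧
      -- matrix form, one system `A x = b` for each way of resolving the disequalities
      (∃ (A : Fin (2 ^ Ψ.numNe) →
            Matrix (Fin (2 * Ψ.ell + 1)) (GP2.Var Ψ ⊕ Fin (4 * Ψ.ell + 1)) ℤ)
          (b : Fin (2 ^ Ψ.numNe) → Fin (2 * Ψ.ell + 1) → ℤ),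
        (∀ s i j, (A s i j).natAbs ≤ Ψ.maxCoeff) ∧
        (∀ s i, (b s i).natAbs ≤ Ψ.maxCoeff) ∧
        ∀ z : GP2.Var Ψ → ℕ, GP2.IsSolution (GP2.edgeSystem G e) z ↔
          ∃ (s : Fin (2 ^ Ψ.numNe)) (y : Fin (4 * Ψ.ell + 1) → ℕ),
            (A s).mulVec (fun j => ((Sum.elim z y j : ℕ) : ℤ)) = b s) ∧
      -- small support and small entries
      ((∃ z, GP2.IsSolution (GP2.edgeSystem G e) z) →
        ∃ z, GP2.IsSolution (GP2.edgeSystem G e) z ∧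
          ((Finset.univ.filter fun v => z v ≠ 0).card : ℝ) ≤
            2 * (2 * Ψ.ell + 1) * Real.logb 2 (4 * (2 * Ψ.ell + 1) * Ψ.maxCoeff) ∧
          ∀ v, z v ≤ (2 ^ (Ψ.unarySyms.card + 3 * Ψ.binarySyms.card) + 4 * Ψ.ell + 1) *
            ((2 * Ψ.ell + 1) * Ψ.maxCoeff) ^ (2 * (2 * Ψ.ell + 1) + 1))) :=
  ⟨GP2.exists_machine, fun Ψ G e _ => ⟨GP2.length_edgeSystem_le G e, GP2.card_var_le Ψ,
    Ψ.card_syms_le, Ψ.maxCoeff_le, GP2.exists_matrix_form G e,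
    GP2.exists_small_solution_edgeSystem G e⟩⟩
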